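/- Let $\lambda\in\mathbb R$ and consider the periodic initial value problem $$u_{xt}+uu_{xx}-\lambda u_x^2=-(\lambda+1)\int_0^1u_x^2\,dx\quad(t>0),\qquad u(x,0)=u_0(x),\qquad u(x+1,t)=u(x,t),$$ where $u_0\in C^\infty(\mathbb R)$ is $1$-periodic and satisfies: if $\lambda>0$ (respectively $\lambda<0$), then $u_0'$ attains its greatest value $M_0$ (respectively its least value $m_0$) at only finitely many points of $[0,1]$, and $u_0'''\neq0$ at each of the points where it is attained. By a solution on $[0,T)$, $0<T\le+\infty$, we mean a function $u$ that satisfies the problem for $0\le t<T$, is continuous on $\mathbb R\times[0,T)$ and differentiable in $x$, with $u_x\in C^1(\mathbb R\times[0,T))$. Put $\eta_*=1/(\lambda M_0)$ if $\lambda>0$, $\eta_*=1/(\lambda m_0)$ if $\lambda<0$, and $$t_*=\lim_{\eta\uparrow\eta_*}\int_0^{\eta}\left(\int_0^1\frac{d\alpha}{(1-\lambda\mu u_0'(\alpha))^{1/\lambda}}\right)^{2\lambda}d\mu\quad(\lambda\ne0),\qquad t_*=+\infty\quad(\lambda=0).$$ Then $t_*>0$; $t_*=+\infty$ if and only if $\lambda\in[0,1]$;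 a solution on $[0,t_*)$ exists; and every solution $u$ on $[0,t_*)$ satisfies, with norms $\|\cdot\|_p$ taken in $L^p(0,1)$ and $E(t)=\|u_x(\cdot,t)\|_2^2$: 0. If $\lambda\notin[0,1]$, then $\lim_{t\uparrow t_*}\|u_x\|_\infty=+\infty$ (so $t_*$ is the finite $L^\infty$ blow-up time). 1. For $1\le p<\infty$ and $\frac{2}{1-2p}<\lambda\le1$, the limit $\lim_{t\uparrow t_*}\|u_x\|_p$ exists and is finite. 2. For $1<p<\infty$ and either $\lambda\in\mathbb R\setminus(-2,1]$ or $\lambda\in(-2,-2/p]$, $\lim_{t\uparrow t_*}\|u_x\|_p=+\infty$. 3. If $\lambda\in\mathbb R\setminus(-2/3,1]$, then $\lim_{t\uparrow t_*}E(t)=+\infty$; if $\lambda\in(-2/3,1]$, then $E$ is bounded on $[0,t_*)$ and has a finite limit as $t\uparrow t_*$. Moreover $E$ is differentiable on $[0,t_*)$ (one-sidedly at $t=0$), and: $\lim_{t\uparrow t_*}\dot E(t)=+\infty$ if $\lambda\in\mathbb R\setminus[-1/2,1]$; $\dot E(t)=0$ for all $t\in[0,t_*)$ if $\lambda=-1/2$;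 $\lim_{t\uparrow t_*}\dot E(t)=-\infty$ if $\lambda\in(-1/2,-2/5]$; and $\dot E$ is bounded on $[0,t_*)$ if $\lambda\in(-2/5,1]$. -/

import Mathlib

open Set Filter Topology MeasureTheory

namespace ProudmanJohnson

noncomputable section

/-- Times `t` with `0 ≤ t < T`, where `T` may be `+∞`. -/
def timeInterval (T : EReal) : Set ℝ := {t : ℝ | 0 ≤ t ∧ (t : EReal) < T}

/-- The filter `t ↑ T`: left neighbourhoods of a finite `T`, and `t → +∞` when `T = +∞`. -/
def upTo (T : EReal) : Filter ℝ := if T = ⊤ then atTop else 𝓝[<] T.toReal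

/-- The spatial derivative `u_x(x,t)` of `u`, where `u t x` is the value at time `t` and place `x`. -/
def ux (u : ℝ → ℝ → ℝ) (t x : ℝ) : ℝ := deriv (u t) x

/-- The energy `E(t) = ∫₀¹ u_x(x,t)² dx`. -/
def energy (u : ℝ → ℝ → ℝ) (t : ℝ) : ℝ := ∫ x in (0 : ℝ)..1, ux u t x ^ 2

/-- The `L^p(0,1)` norm of `u_x(·,t)`, with values in `[0,∞]`. -/
def uxNorm (u : ℝ → ℝ → ℝ) (p : ENNReal) (t : ℝ) : ENNReal :=
  eLpNorm (ux u t) p (volume.restrict (Ioo (0 : ℝ) 1))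

/-- Classical spatially periodic solutions on `[0,T)` of
`u_xt + u u_xx - lam u_x² = -(lam + 1) ∫₀¹ u_x² dx`, `u(x,0) = u0(x)`. -/
structure IsSolution (lam : ℝ) (u0 : ℝ → ℝ) (T : EReal) (u : ℝ → ℝ → ℝ) : Prop where
  continuousOn : ContinuousOn (fun z : ℝ × ℝ => u z.1 z.2) (timeInterval T ×ˢ univ)
  differentiable : ∀ t ∈ timeInterval T, Differentiable ℝ (u t)
  contDiffOn_ux : ContDiffOn ℝ 1 (fun z : ℝ × ℝ => ux u z.1 z.2) (timeInterval T ×ˢ univ)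
  periodic : ∀ t ∈ timeInterval T, Function.Periodic (u t) 1
  initial : ∀ x, u 0 x = u0 x
  equation : ∀ t ∈ timeInterval T, 0 < t → ∀ x,
    deriv (fun s => ux u s x) t + u t x * deriv (ux u t) x - lam * ux u t x ^ 2
      = -(lam + 1) * ∫ y in (0 : ℝ)..1, ux u t y ^ 2

/-- The class of smooth data: `u0` is smooth and `1`-periodic and, relative to the sign of `lam`,
the greatest (`lam > 0`) or least (`lam < 0`) value of `u0'` is attained at finitely many points
of the period, at each of which the second derivative of `u0'` does not vanish. -/
structure IsAdmissible (lam : ℝ) (u0 : ℝ → ℝ) : Prop where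
  smooth : ContDiff ℝ (⊤ : ℕ∞) u0
  periodic : Function.Periodic u0 1
  finite_max : 0 < lam → {a ∈ Icc (0 : ℝ) 1 | IsMaxOn (deriv u0) univ a}.Finite
  nondegenerate_max : 0 < lam → ∀ a, IsMaxOn (deriv u0) univ a → iteratedDeriv 3 u0 a ≠ 0
  finite_min : lam < 0 → {a ∈ Icc (0 : ℝ) 1 | IsMinOn (deriv u0) univ a}.Finite
  nondegenerate_min : lam < 0 → ∀ a, IsMinOn (deriv u0) univ a → iteratedDeriv 3 u0 a ≠ 0

/-- `η_* = 1/(lam M₀)` for `lam > 0` and `η_* = 1/(lam m₀)` for `lam < 0`, where `M₀` and `m₀` are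
the greatest and the least value of `u0'`. -/
def etaStar (lam : ℝ) (u0 : ℝ → ℝ) : ℝ :=
  if 0 < lam then 1 / (lam * sSup (deriv u0 '' Icc 0 1))
  else 1 / (lam * sInf (deriv u0 '' Icc 0 1))

/-- `t(η) = ∫₀^η (∫₀¹ (1 - lam μ u0'(α))^{-1/lam} dα)^{2 lam} dμ`, for `lam ≠ 0`. -/
def timeOfEta (lam : ℝ) (u0 : ℝ → ℝ) (η : ℝ) : ℝ :=
  ∫ μ in (0 : ℝ)..η,
    (∫ α in (0 : ℝ)..1, 1 / (1 - lam * μ * deriv u0 α) ^ (1 / lam)) ^ (2 * lam)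

/-- The time `t_*`, the limit of `t(η)` as `η ↑ η_*`. As `t` is increasing on `(0, η_*)`, the limit
is the supremum. For `lam = 0` one puts `t_* = +∞`. -/
def tStar (lam : ℝ) (u0 : ℝ → ℝ) : EReal :=
  if lam = 0 then ⊤ else ⨆ η ∈ Ioo 0 (etaStar lam u0), (timeOfEta lam u0 η : EReal)

end

end ProudmanJohnson

/-! Write f = u0'. Along a characteristic γ the gradient g = u_x∘γ satisfies the Riccati equation g'
= λg² − (λ+1)E(t), whose nonlocal term is the same for all particles. Subtracting the equation of a
particle a0 with f(a0) = 0 removes that term, and the difference integrates exactly. In the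
parameter s with ds/dt = exp(2λ∫g(a0)), the Jacobian γ_a is proportional to k = (1 − λsf)^(−1/λ),
which is read as exp(sf) for λ = 0. A circle diffeomorphism has Jacobian of mean 1, so γ_a = k/K₀
with K₀ = ∫k, and dt/ds = K₀^(2λ). As u_x has mean zero, g = K₀^(−2λ) (f/(1 − λsf) − K₁/K₀), where
K₁ = ∫ fk/(1 − λsf).

So the distribution of u_x at each time is the same for all solutions (`IsSolution.exists_param`),
though u itself is determined only up to a drift in space. Read backwards, the same formulas give a
solution (`exists_isSolution`). The norms and the energy become integrals in s, `timeOf` is an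
integral of K₀^(2λ), and E' = (1+2λ)∫u_x³.

For λ ≠ 0 let M be the extremal value of f with λM > 0, and put q = 1 − f/M ≥ 0 and e = 1 − λMs.
Then 1 − λsf = e + (1−e)q, and s ↑ η_* means e ↓ 0. The zeros of q are nondegenerate, so the scale
√e governs the integrals I_r = ∫(e + (1−e)q)^(−r). With H_r = ∫₀^∞(1+s²)^(−r) ds, I_r behaves like S
H_r e^(1/2−r) for r > 1/2; it diverges more slowly than any power of 1/e for r = 1/2, and converges
for r < 1/2. One constant S serves all integrands (`HasWeight`), so ratios of leading coefficients
follow from H_{r+1}/H_r = (r − 1/2)/r.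

Since f/(1 − λsf) is an affine function of 1/(1 − λsf), the central moments of u_x are those of 1/(e
+ (1−e)q) under the weight (e + (1−e)q)^(−b), b = 1/λ. For 0 < λ < 2 the p-th moment has exact order
e^(p(1−λ)). For λ ≥ 2 the integral I_b grows at most subpolynomially while the mean diverges. For λ
< 0 the integral I_b converges, and the p-th moment, p > 1, diverges exactly when I_{p+b} does, that
is, when p + 1/λ ≥ 1/2. The third moment is treated similarly, its sign being that of M. The density
I_b^(2λ) of time is integrable at e = 0 if and only if λ ∉ (0,1]. For λ = 0, s is the time itself
and exponential tilting concentrates the mass where f is greatest, so all moments tend to 0. -/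

namespace ProudmanJohnson
noncomputable section

/-! ### The explicit solution in Lagrangian variables -/

/-- Differentiation of an integral whose integrand and its derivative are jointly continuous. -/
theorem hasDerivAt_intervalIntegral_of_continuousOn {U : Set ℝ} (hU : IsOpen U) {F F' : ℝ → ℝ → ℝ}
    (hF : ContinuousOn (Function.uncurry F) (U ×ˢ univ))
    (hF' : ContinuousOn (Function.uncurry F') (U ×ˢ univ))
    (hd : ∀ s ∈ U, ∀ x, HasDerivAt (fun s => F s x) (F' s x) s) (a b : ℝ) {s : ℝ} (hs : s ∈ U) :
    HasDerivAt (fun s => ∫ x in a..b, F s x) (∫ x in a..b, F' s x) s := by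
  obtain ⟨δ, hδ, hball⟩ := Metric.nhds_basis_closedBall.mem_iff.1 (hU.mem_nhds hs)
  obtain ⟨C, hC⟩ := ((isCompact_closedBall s δ).prod (isCompact_uIcc (a := a) (b := b)))
    |>.exists_bound_of_continuousOn (hF'.mono (prod_mono hball (subset_univ _)))
  have cont : ∀ G : ℝ → ℝ → ℝ, ContinuousOn (Function.uncurry G) (U ×ˢ univ) → ∀ s ∈ U,
      Continuous (G s) := fun G hG s hs =>
    hG.comp_continuous (f := fun x => (s, x)) (by fun_prop) (fun x => ⟨hs, mem_univ _⟩)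
  refine (intervalIntegral.hasDerivAt_integral_of_dominated_loc_of_deriv_le
    (bound := fun _ => C) (s := Metric.closedBall s δ) (Metric.closedBall_mem_nhds s hδ) ?_
    ((cont F hF s hs).intervalIntegrable _ _) (cont F' hF' s hs).aestronglyMeasurable ?_ ?_ ?_).2
  · filter_upwards [hU.mem_nhds hs] with y hy using (cont F hF y hy).aestronglyMeasurable
  · exact Eventually.of_forall fun x hx y hy => hC (y, x) ⟨hy, uIoc_subset_uIcc hx⟩
  · exact intervalIntegrable_const
  · exact Eventually.of_forall fun x _ y hy => hd y (hball hy) x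

theorem continuousOn_parametric_primitive {U : Set ℝ} {F : ℝ → ℝ → ℝ}
    (hF : ContinuousOn (Function.uncurry F) (U ×ˢ univ)) (a : ℝ) :
    ContinuousOn (fun z : ℝ × ℝ => ∫ x in a..z.2, F z.1 x) (U ×ˢ univ) := by
  rw [continuousOn_iff_continuous_domRestrict]
  have := intervalIntegral.continuous_parametric_intervalIntegral_of_continuous (μ := volume)
    (X := ↥(U ×ˢ (univ : Set ℝ))) (f := fun z x => F z.1.1 x) (a₀ := a) ?_
    (s := fun z => z.1.2) (by fun_prop)
  · exact this
  · exact hF.comp_continuous (f := fun z : ↥(U ×ˢ (univ : Set ℝ)) × ℝ => (z.1.1.1, z.2))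
      (by fun_prop) (fun z => ⟨z.1.2.1, mem_univ _⟩)

theorem continuousOn_parametric_integral {U : Set ℝ} {F : ℝ → ℝ → ℝ}
    (hF : ContinuousOn (Function.uncurry F) (U ×ˢ univ)) (a b : ℝ) :
    ContinuousOn (fun s => ∫ x in a..b, F s x) U :=
  (continuousOn_parametric_primitive hF a).comp (f := fun s => (s, b)) (by fun_prop)
    (fun s hs => ⟨hs, mem_univ _⟩)

/-- The solution of `∂ₛ k = v k / (1 - lam s v)`, `k(0, v) = 1`. -/
def ker (lam s v : ℝ) : ℝ := if lam = 0 then Real.exp (s * v) else (1 - lam * s * v) ^ (-(1 / lam))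

/-- The parameters `s` for which `1 - lam s f` is positive. -/
def dom (lam : ℝ) (f : ℝ → ℝ) : Set ℝ := {s | ∀ a, 0 < 1 - lam * s * f a}

/-- The integrals `∫₀¹ f^j k / (1 - lam s f)^j`. -/
def kerInt (lam : ℝ) (f : ℝ → ℝ) (j : ℕ) (s : ℝ) : ℝ :=
  ∫ a in (0 : ℝ)..1, f a ^ j * ker lam s (f a) / (1 - lam * s * f a) ^ j

/-- The time as a function of the parameter. -/
def timeOf (lam : ℝ) (f : ℝ → ℝ) (s : ℝ) : ℝ := ∫ r in (0 : ℝ)..s, kerInt lam f 0 r ^ (2 * lam)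

/-- The Jacobian of the flow. -/
def jac (lam : ℝ) (f : ℝ → ℝ) (s a : ℝ) : ℝ := ker lam s (f a) / kerInt lam f 0 s

/-- The velocity gradient in Lagrangian variables. -/
def grad (lam : ℝ) (f : ℝ → ℝ) (s a : ℝ) : ℝ :=
  kerInt lam f 0 s ^ (-(2 * lam)) *
    (f a / (1 - lam * s * f a) - kerInt lam f 1 s / kerInt lam f 0 s)

theorem ker_pos {lam s v : ℝ} (h : 0 < 1 - lam * s * v) : 0 < ker lam s v := by
  unfold ker; split_ifs
  · positivity
  · positivity

theorem hasDerivAt_ker {lam s v : ℝ} (h : 0 < 1 - lam * s * v) :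
    HasDerivAt (fun s => ker lam s v) (v * ker lam s v / (1 - lam * s * v)) s := by
  unfold ker
  split_ifs with h0
  · subst h0
    refine ((hasDerivAt_id s).mul_const v).exp.congr_deriv ?_
    simp [mul_comm]
  · have h1 : HasDerivAt (fun s => 1 - lam * s * v) (-(lam * v)) s := by
      simpa using (((hasDerivAt_id s).const_mul lam).mul_const v).const_sub 1
    convert h1.rpow_const (p := -(1 / lam)) (Or.inl h.ne') using 1
    rw [Real.rpow_sub_one h.ne']
    field_simp

theorem ker_zero (lam v : ℝ) : ker lam 0 v = 1 := by simp [ker]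

variable {lam : ℝ} {f : ℝ → ℝ}

theorem continuousOn_ker (hf : Continuous f) :
    ContinuousOn (fun z : ℝ × ℝ => ker lam z.1 (f z.2)) (dom lam f ×ˢ univ) := by
  unfold ker
  split_ifs
  · fun_prop
  · exact ContinuousOn.rpow_const (by fun_prop) (fun z hz => Or.inl (hz.1 z.2).ne')

theorem zero_mem_dom : (0 : ℝ) ∈ dom lam f := fun a => by simp

/-- For each `a` the condition is affine in `s`, so the set is an intersection of half-lines (or
whole lines) containing 0. -/
theorem ordConnected_dom : (dom lam f).OrdConnected := by
  refine ⟨fun x hx y hy z hz a => ?_⟩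
  have h1 := hx a
  have h2 := hy a
  rcases le_total 0 (lam * f a) with h | h
  · nlinarith [mul_le_mul_of_nonneg_left hz.2 h]
  · nlinarith [mul_le_mul_of_nonpos_left hz.1 h]

/-- By periodicity the infimum over `a` is a minimum over one period, hence positive, and a small
change of `s` perturbs the expression uniformly little. -/
theorem isOpen_dom (hf : Continuous f) (hp : Function.Periodic f 1) : IsOpen (dom lam f) := by
  rw [isOpen_iff_mem_nhds]
  intro s hs
  have hc : Continuous fun a => 1 - lam * s * f a := by fun_prop
  obtain ⟨a0, ha0, hmin⟩ := (isCompact_Icc (a := (0 : ℝ)) (b := 1)).exists_isMinOn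
    (nonempty_Icc.2 zero_le_one) hc.continuousOn
  obtain ⟨C, hC⟩ := (isCompact_Icc (a := (0 : ℝ)) (b := 1)).exists_bound_of_continuousOn
    hf.continuousOn
  have hC0 : 0 ≤ C := (norm_nonneg _).trans (hC 0 (by simp))
  set c := 1 - lam * s * f a0 with hcdef
  have hcpos : 0 < c := hs a0
  have hcont : ContinuousAt (fun r => |lam * (r - s)| * C) s := by fun_prop
  have : ∀ᶠ r in 𝓝 s, |lam * (r - s)| * C < c := by
    apply hcont.eventually_lt_const
    simpa using hcpos
  filter_upwards [this] with r hr a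
  obtain ⟨b, hb, hab⟩ := hp.exists_mem_Ico₀ one_pos a
  rw [hab]
  have h1 : c ≤ 1 - lam * s * f b := hmin (Ico_subset_Icc_self hb)
  have h2 : lam * (r - s) * f b ≤ |lam * (r - s)| * C := by
    calc _ ≤ |lam * (r - s) * f b| := le_abs_self _
      _ = |lam * (r - s)| * |f b| := abs_mul _ _
      _ ≤ _ := by gcongr; exact hC b (Ico_subset_Icc_self hb)
  nlinarith

theorem continuousOn_kerInt_integrand (hf : Continuous f) (j : ℕ) :
    ContinuousOn (Function.uncurry fun s a =>
      f a ^ j * ker lam s (f a) / (1 - lam * s * f a) ^ j) (dom lam f ×ˢ univ) := by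
  refine ContinuousOn.div ?_ (by fun_prop) (fun z hz => pow_ne_zero _ (hz.1 z.2).ne')
  exact (by fun_prop : ContinuousOn (fun z : ℝ × ℝ => f z.2 ^ j) _).mul (continuousOn_ker hf)

/-- With D = 1 − λsf, differentiating k contributes a factor f/D and differentiating D^(−j)
contributes jλ f/D. The integrals thus form a closed hierarchy, and the derivatives of the energy
and of the gradient reduce to algebra. -/
theorem hasDerivAt_kerInt (hf : Continuous f) (hp : Function.Periodic f 1) (j : ℕ) {s : ℝ}
    (hs : s ∈ dom lam f) :
    HasDerivAt (kerInt lam f j) ((1 + j * lam) * kerInt lam f (j + 1) s) s := by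
  have := hasDerivAt_intervalIntegral_of_continuousOn (isOpen_dom (lam := lam) hf hp)
    (continuousOn_kerInt_integrand hf j)
    (F' := fun s a => (1 + j * lam) *
      (f a ^ (j + 1) * ker lam s (f a) / (1 - lam * s * f a) ^ (j + 1)))
    (continuousOn_const.mul (continuousOn_kerInt_integrand hf (j + 1))) ?_ 0 1 hs
  · rw [intervalIntegral.integral_const_mul] at this
    exact this
  · intro s hs a
    have h := hs a
    have h1 : HasDerivAt (fun s => 1 - lam * s * f a) (-(lam * f a)) s := by
      simpa using (((hasDerivAt_id s).const_mul lam).mul_const (f a)).const_sub 1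
    refine (((hasDerivAt_ker h).const_mul (f a ^ j)).fun_div (h1.fun_pow j)
      (pow_ne_zero _ h.ne')).congr_deriv ?_
    rcases j with _ | j
    · simp
    · have := h.ne'
      simp only [Nat.add_sub_cancel]
      generalize 1 - lam * s * f a = D at *
      field_simp
      push_cast
      ring

theorem continuousOn_kerInt (hf : Continuous f) (hp : Function.Periodic f 1) (j : ℕ) :
    ContinuousOn (kerInt lam f j) (dom lam f) := fun _ hs =>
  (hasDerivAt_kerInt hf hp j hs).continuousAt.continuousWithinAt

theorem continuous_kerInt_integrand (hf : Continuous f) (j : ℕ) {s : ℝ} (hs : s ∈ dom lam f) :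
    Continuous fun a => f a ^ j * ker lam s (f a) / (1 - lam * s * f a) ^ j :=
  (continuousOn_kerInt_integrand hf j).comp_continuous (f := fun x => (s, x)) (by fun_prop)
    (fun _ => ⟨hs, mem_univ _⟩)

theorem continuous_ker (hf : Continuous f) {s : ℝ} (hs : s ∈ dom lam f) :
    Continuous fun a => ker lam s (f a) := by
  simpa using continuous_kerInt_integrand hf 0 hs

theorem kerInt_pos (hf : Continuous f) {s : ℝ} (hs : s ∈ dom lam f) : 0 < kerInt lam f 0 s := by
  have h : ∀ a, 0 < f a ^ 0 * ker lam s (f a) / (1 - lam * s * f a) ^ 0 := fun a => by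
    simpa using ker_pos (hs a)
  exact intervalIntegral.intervalIntegral_pos_of_pos
    ((continuous_kerInt_integrand hf 0 hs).intervalIntegrable _ _) h one_pos

theorem kerInt_zero_zero : kerInt lam f 0 0 = 1 := by simp [kerInt, ker_zero]

theorem hasDerivAt_timeOf (hf : Continuous f) (hp : Function.Periodic f 1) {s : ℝ}
    (hs : s ∈ dom lam f) : HasDerivAt (timeOf lam f) (kerInt lam f 0 s ^ (2 * lam)) s := by
  have hc : ContinuousOn (fun r => kerInt lam f 0 r ^ (2 * lam)) (dom lam f) :=
    (continuousOn_kerInt hf hp 0).rpow_const (fun r hr => Or.inl (kerInt_pos hf hr).ne')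
  have ho := isOpen_dom (lam := lam) hf hp
  refine intervalIntegral.integral_hasDerivAt_right ?_ ?_ (hc.continuousAt (ho.mem_nhds hs))
  · exact (hc.mono (ordConnected_dom.uIcc_subset zero_mem_dom hs)).intervalIntegrable
  · exact hc.stronglyMeasurableAtFilter ho s hs

theorem strictMonoOn_timeOf (hf : Continuous f) (hp : Function.Periodic f 1) :
    StrictMonoOn (timeOf lam f) (dom lam f) := by
  refine strictMonoOn_of_deriv_pos (ordConnected_dom.convex)
    (fun s hs => (hasDerivAt_timeOf hf hp hs).continuousAt.continuousWithinAt) fun s hs => ?_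
  have hs := interior_subset hs
  rw [(hasDerivAt_timeOf hf hp hs).deriv]
  exact Real.rpow_pos_of_pos (kerInt_pos hf hs) _

theorem timeOf_zero : timeOf lam f 0 = 0 := by simp [timeOf]

/-- The parameter as a function of time. -/
def paramOf (lam : ℝ) (f : ℝ → ℝ) (t : ℝ) : ℝ := Function.invFunOn (timeOf lam f) (dom lam f) t

theorem paramOf_timeOf (hf : Continuous f) (hp : Function.Periodic f 1) {s : ℝ}
    (hs : s ∈ dom lam f) : paramOf lam f (timeOf lam f s) = s :=
  (strictMonoOn_timeOf hf hp).injOn.leftInvOn_invFunOn hs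

theorem paramOf_mem {t : ℝ} (ht : t ∈ timeOf lam f '' dom lam f) : paramOf lam f t ∈ dom lam f :=
  Function.invFunOn_mem ht

theorem timeOf_paramOf {t : ℝ} (ht : t ∈ timeOf lam f '' dom lam f) :
    timeOf lam f (paramOf lam f t) = t := Function.invFunOn_eq ht

/-- Openness supplies an interval around time 0 that includes negative times. The explicit formulas
can then be differentiated two-sidedly even at the initial time. -/
theorem isOpen_timeOf_image (hf : Continuous f) (hp : Function.Periodic f 1) :
    IsOpen (timeOf lam f '' dom lam f) := by
  rw [isOpen_iff_mem_nhds]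
  rintro _ ⟨s, hs, rfl⟩
  have hev : ∀ᶠ x in 𝓝 s, HasDerivAt (timeOf lam f) (kerInt lam f 0 x ^ (2 * lam)) x := by
    filter_upwards [(isOpen_dom hf hp).mem_nhds hs] with x hx using hasDerivAt_timeOf hf hp hx
  have hcont : ContinuousAt (fun x => kerInt lam f 0 x ^ (2 * lam)) s :=
    (hasDerivAt_kerInt hf hp 0 hs).continuousAt.rpow_const (Or.inl (kerInt_pos hf hs).ne')
  have hstrict := hasStrictDerivAt_of_hasDerivAt_of_continuousAt hev hcont
  rw [← hstrict.map_nhds_eq (Real.rpow_pos_of_pos (kerInt_pos hf hs) _).ne']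
  exact image_mem_map ((isOpen_dom hf hp).mem_nhds hs)

theorem hasDerivAt_paramOf (hf : Continuous f) (hp : Function.Periodic f 1) {t : ℝ}
    (ht : t ∈ timeOf lam f '' dom lam f) :
    HasDerivAt (paramOf lam f) (kerInt lam f 0 (paramOf lam f t) ^ (-(2 * lam))) t := by
  obtain ⟨s, hs, rfl⟩ := ht
  have ho := isOpen_timeOf_image (lam := lam) hf hp
  rw [paramOf_timeOf hf hp hs]
  -- The strict derivative of the time is nonzero, so it maps neighbourhoods of `s` onto
  -- neighbourhoods of its value. Continuity of the inverse is then the identity limit upstairs.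
  have hc : ContinuousAt (paramOf lam f) (timeOf lam f s) := by
    have hev : ∀ᶠ x in 𝓝 s, HasDerivAt (timeOf lam f) (kerInt lam f 0 x ^ (2 * lam)) x := by
      filter_upwards [(isOpen_dom hf hp).mem_nhds hs] with x hx using hasDerivAt_timeOf hf hp hx
    have hcont : ContinuousAt (fun x => kerInt lam f 0 x ^ (2 * lam)) s :=
      (hasDerivAt_kerInt hf hp 0 hs).continuousAt.rpow_const (Or.inl (kerInt_pos hf hs).ne')
    have hstrict := hasStrictDerivAt_of_hasDerivAt_of_continuousAt hev hcont
    have hne := (Real.rpow_pos_of_pos (kerInt_pos hf hs) (2 * lam)).ne'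
    rw [ContinuousAt, ← hstrict.map_nhds_eq hne, tendsto_map'_iff, paramOf_timeOf hf hp hs]
    refine tendsto_id.congr' ?_
    filter_upwards [(isOpen_dom hf hp).mem_nhds hs] with x hx
    exact (paramOf_timeOf hf hp hx).symm
  rw [Real.rpow_neg (kerInt_pos hf hs).le]
  refine HasDerivAt.of_local_left_inverse (f := timeOf lam f) hc ?_
    (Real.rpow_pos_of_pos (kerInt_pos hf hs) _).ne' ?_
  · rw [paramOf_timeOf hf hp hs]; exact hasDerivAt_timeOf hf hp hs
  · filter_upwards [ho.mem_nhds ⟨s, hs, rfl⟩] with t ht using timeOf_paramOf ht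

theorem jac_pos (hf : Continuous f) {s : ℝ} (hs : s ∈ dom lam f) (a : ℝ) : 0 < jac lam f s a :=
  div_pos (ker_pos (hs a)) (kerInt_pos hf hs)

theorem continuousOn_jac (hf : Continuous f) (hp : Function.Periodic f 1) :
    ContinuousOn (Function.uncurry (jac lam f)) (dom lam f ×ˢ univ) :=
  (continuousOn_ker hf).div ((continuousOn_kerInt hf hp 0).comp continuousOn_fst
    (fun _ hz => hz.1)) (fun _ hz => (kerInt_pos hf hz.1).ne')

theorem continuousOn_grad (hf : Continuous f) (hp : Function.Periodic f 1) :
    ContinuousOn (Function.uncurry (grad lam f)) (dom lam f ×ˢ univ) := by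
  have h0 : ContinuousOn (fun z : ℝ × ℝ => kerInt lam f 0 z.1) (dom lam f ×ˢ univ) :=
    (continuousOn_kerInt hf hp 0).comp continuousOn_fst (fun _ hz => hz.1)
  have h1 : ContinuousOn (fun z : ℝ × ℝ => kerInt lam f 1 z.1) (dom lam f ×ˢ univ) :=
    (continuousOn_kerInt hf hp 1).comp continuousOn_fst (fun _ hz => hz.1)
  refine (h0.rpow_const (fun _ hz => Or.inl (kerInt_pos hf hz.1).ne')).mul (ContinuousOn.sub ?_ ?_)
  · exact ContinuousOn.div (by fun_prop) (by fun_prop) (fun z hz => (hz.1 z.2).ne')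
  · exact h1.div h0 (fun _ hz => (kerInt_pos hf hz.1).ne')

theorem continuous_jac (hf : Continuous f) {s : ℝ} (hs : s ∈ dom lam f) :
    Continuous (jac lam f s) := (continuous_ker hf hs).div_const _

theorem continuous_grad (hf : Continuous f) {s : ℝ} (hs : s ∈ dom lam f) :
    Continuous (grad lam f s) :=
  ((hf.div (by fun_prop) (fun a => (hs a).ne')).sub continuous_const).const_mul _

theorem integral_jac (hf : Continuous f) {s : ℝ} (hs : s ∈ dom lam f) :
    ∫ a in (0 : ℝ)..1, jac lam f s a = 1 := by
  have := kerInt_pos hf hs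
  unfold jac
  rw [intervalIntegral.integral_div]
  simp only [kerInt, pow_zero, one_mul, div_one] at *
  exact div_self this.ne'

/-- The energy in terms of the parameter. -/
def energyOf (lam : ℝ) (f : ℝ → ℝ) (s : ℝ) : ℝ :=
  ∫ a in (0 : ℝ)..1, grad lam f s a ^ 2 * jac lam f s a

/-- The third moment of the velocity gradient in terms of the parameter. -/
def cubeOf (lam : ℝ) (f : ℝ → ℝ) (s : ℝ) : ℝ :=
  ∫ a in (0 : ℝ)..1, grad lam f s a ^ 3 * jac lam f s a

/-- `jac` is a probability density, and `grad` is a multiple of f/(1 − λsf) minus its mean under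
that density; the bracket is the variance. -/
theorem energyOf_eq (hf : Continuous f) {s : ℝ} (hs : s ∈ dom lam f) :
    energyOf lam f s = (kerInt lam f 0 s ^ (-(2 * lam))) ^ 2 *
      (kerInt lam f 2 s / kerInt lam f 0 s - (kerInt lam f 1 s / kerInt lam f 0 s) ^ 2) := by
  have h0 := (kerInt_pos hf hs).ne'
  have hi := fun j => (continuous_kerInt_integrand hf j hs).intervalIntegrable (μ := volume) 0 1
  set P := kerInt lam f 0 s ^ (-(2 * lam))
  set k0 := kerInt lam f 0 s with hk0
  set k1 := kerInt lam f 1 s with hk1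
  set k2 := kerInt lam f 2 s with hk2
  have : ∀ a, grad lam f s a ^ 2 * jac lam f s a =
      P ^ 2 / k0 * (f a ^ 2 * ker lam s (f a) / (1 - lam * s * f a) ^ 2)
      + (-(2 * P ^ 2 / k0 * (k1 / k0)) * (f a ^ 1 * ker lam s (f a) / (1 - lam * s * f a) ^ 1)
      + P ^ 2 / k0 * (k1 / k0) ^ 2 * (f a ^ 0 * ker lam s (f a) / (1 - lam * s * f a) ^ 0)) := by
    intro a
    have := (hs a).ne'
    simp only [grad, jac]
    simp only [← hk0, ← hk1]
    change (P * _) ^ 2 * _ = _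
    generalize 1 - lam * s * f a = D at *
    field_simp
    ring
  unfold energyOf
  rw [intervalIntegral.integral_congr fun a _ => this a,
    intervalIntegral.integral_add ((hi 2).const_mul _) (((hi 1).const_mul _).add
      ((hi 0).const_mul _)), intervalIntegral.integral_add ((hi 1).const_mul _)
      ((hi 0).const_mul _)]
  simp only [intervalIntegral.integral_const_mul]
  change P ^ 2 / k0 * k2 + (-(2 * P ^ 2 / k0 * (k1 / k0)) * k1 +
    P ^ 2 / k0 * (k1 / k0) ^ 2 * k0) = _
  field_simp
  ring

/-- The bracket is the third central moment of f/(1 − λsf) under the density `jac`. -/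
theorem cubeOf_eq (hf : Continuous f) {s : ℝ} (hs : s ∈ dom lam f) :
    cubeOf lam f s = (kerInt lam f 0 s ^ (-(2 * lam))) ^ 3 *
      (kerInt lam f 3 s / kerInt lam f 0 s
        - 3 * (kerInt lam f 2 s / kerInt lam f 0 s) * (kerInt lam f 1 s / kerInt lam f 0 s)
        + 2 * (kerInt lam f 1 s / kerInt lam f 0 s) ^ 3) := by
  have h0 := (kerInt_pos hf hs).ne'
  have hi := fun j => (continuous_kerInt_integrand hf j hs).intervalIntegrable (μ := volume) 0 1
  set P := kerInt lam f 0 s ^ (-(2 * lam))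
  set k0 := kerInt lam f 0 s with hk0
  set k1 := kerInt lam f 1 s with hk1
  set k2 := kerInt lam f 2 s with hk2
  set k3 := kerInt lam f 3 s with hk3
  have : ∀ a, grad lam f s a ^ 3 * jac lam f s a =
      P ^ 3 / k0 * (f a ^ 3 * ker lam s (f a) / (1 - lam * s * f a) ^ 3)
      + (-(3 * P ^ 3 / k0 * (k1 / k0)) * (f a ^ 2 * ker lam s (f a) / (1 - lam * s * f a) ^ 2)
      + (3 * P ^ 3 / k0 * (k1 / k0) ^ 2 * (f a ^ 1 * ker lam s (f a) / (1 - lam * s * f a) ^ 1)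
      + -(P ^ 3 / k0 * (k1 / k0) ^ 3) *
          (f a ^ 0 * ker lam s (f a) / (1 - lam * s * f a) ^ 0))) := by
    intro a
    have := (hs a).ne'
    simp only [grad, jac]
    simp only [← hk0, ← hk1]
    change (P * _) ^ 3 * _ = _
    generalize 1 - lam * s * f a = D at *
    field_simp
    ring
  unfold cubeOf
  rw [intervalIntegral.integral_congr fun a _ => this a,
    intervalIntegral.integral_add ((hi 3).const_mul _) (((hi 2).const_mul _).add
      (((hi 1).const_mul _).add ((hi 0).const_mul _))),
    intervalIntegral.integral_add ((hi 2).const_mul _) (((hi 1).const_mul _).add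
      ((hi 0).const_mul _)), intervalIntegral.integral_add ((hi 1).const_mul _)
      ((hi 0).const_mul _)]
  simp only [intervalIntegral.integral_const_mul]
  change P ^ 3 / k0 * k3 + (-(3 * P ^ 3 / k0 * (k1 / k0)) * k2 +
    (3 * P ^ 3 / k0 * (k1 / k0) ^ 2 * k1 + -(P ^ 3 / k0 * (k1 / k0) ^ 3) * k0)) = _
  field_simp
  ring

/-- The recursion for `kerInt` turns the derivative of the variance, with that of its prefactor,
into the third central moment times 1 + 2λ. The remaining power of `kerInt` is dt/ds and cancels
once time is the variable. -/
theorem hasDerivAt_energyOf (hf : Continuous f) (hp : Function.Periodic f 1) {s : ℝ}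
    (hs : s ∈ dom lam f) :
    HasDerivAt (energyOf lam f)
      ((1 + 2 * lam) * cubeOf lam f s * kerInt lam f 0 s ^ (2 * lam)) s := by
  have hpos := kerInt_pos hf hs
  have h0 := hpos.ne'
  have d0 := hasDerivAt_kerInt (lam := lam) hf hp 0 hs
  have d1 := hasDerivAt_kerInt (lam := lam) hf hp 1 hs
  have d2 := hasDerivAt_kerInt (lam := lam) hf hp 2 hs
  have key := ((d0.rpow_const (p := -(2 * lam)) (Or.inl h0)).fun_pow 2).fun_mul
    ((d2.fun_div d0 h0).fun_sub ((d1.fun_div d0 h0).fun_pow 2))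
  refine (key.congr_of_eventuallyEq ?_).congr_deriv ?_
  · filter_upwards [(isOpen_dom hf hp).mem_nhds hs] with r hr using energyOf_eq hf hr
  · rw [cubeOf_eq hf hs]
    simp only [Real.rpow_sub_one h0]
    have hP : kerInt lam f 0 s ^ (2 * lam) = (kerInt lam f 0 s ^ (-(2 * lam)))⁻¹ := by
      rw [Real.rpow_neg hpos.le, inv_inv]
    have hQ : kerInt lam f 0 s ^ (-(2 * lam)) ≠ 0 := (Real.rpow_pos_of_pos hpos _).ne'
    rw [hP]
    push_cast
    generalize kerInt lam f 0 s ^ (-(2 * lam)) = Q at *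
    field_simp
    ring

theorem hasDerivAt_energyOf_paramOf (hf : Continuous f) (hp : Function.Periodic f 1) {t : ℝ}
    (ht : t ∈ timeOf lam f '' dom lam f) :
    HasDerivAt (fun t => energyOf lam f (paramOf lam f t))
      ((1 + 2 * lam) * cubeOf lam f (paramOf lam f t)) t := by
  have hs := paramOf_mem ht
  refine ((hasDerivAt_energyOf hf hp hs).comp t (hasDerivAt_paramOf hf hp ht)).congr_deriv ?_
  rw [mul_assoc, ← Real.rpow_add (kerInt_pos hf hs)]
  simp

end

end ProudmanJohnson

/-! ### Flows of time-dependent vector fields on the line -/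

namespace ProudmanJohnson
noncomputable section

/-- Derivatives are required only in the open interval, because the equation is imposed only for
positive times. This is the tool behind every exact integration below. -/
theorem eq_of_hasDerivAt_zero {g : ℝ → ℝ} {a b : ℝ} (hg : ContinuousOn g (Icc a b))
    (hd : ∀ t ∈ Ioo a b, HasDerivAt g 0 t) {t : ℝ} (ht : t ∈ Icc a b) : g t = g a := by
  rcases ht.1.eq_or_lt with h | h
  · rw [h]
  · obtain ⟨c, hc, hc'⟩ := exists_hasDerivAt_eq_slope g (fun _ => 0) h
      (hg.mono (Icc_subset_Icc_right ht.2)) (fun x hx => hd x ⟨hx.1, hx.2.trans_le ht.2⟩)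
    have := sub_ne_zero.2 h.ne'
    field_simp at hc'
    linarith

theorem sub_eq_mul_integral {g g' : ℝ → ℝ} (hg : ∀ x, HasDerivAt g (g' x) x) (hc : Continuous g')
    (x y : ℝ) : g y - g x = (y - x) * ∫ s in (0 : ℝ)..1, g' (x + s * (y - x)) := by
  have h1 : ∀ s ∈ uIcc (0 : ℝ) 1, HasDerivAt (fun s => g (x + s * (y - x)))
      (g' (x + s * (y - x)) * (y - x)) s := fun s _ => by
    have : HasDerivAt (fun s => x + s * (y - x)) (y - x) s := by
      simpa using ((hasDerivAt_id s).mul_const (y - x)).const_add x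
    exact (hg _).comp s this
  have := intervalIntegral.integral_eq_sub_of_hasDerivAt h1
    (Continuous.intervalIntegrable (by fun_prop) _ _)
  rw [intervalIntegral.integral_mul_const] at this
  simp only [one_mul, zero_mul, add_zero, add_sub_cancel] at this
  linarith

/-- A vector field on the line, bounded and with bounded derivative, depending on time. -/
structure IsField (v vx : ℝ → ℝ → ℝ) (B L : ℝ) : Prop where
  cont : Continuous (Function.uncurry v)
  cont' : Continuous (Function.uncurry vx)
  deriv : ∀ t x, HasDerivAt (v t) (vx t x) x
  bound : ∀ t x, |v t x| ≤ B
  bound' : ∀ t x, |vx t x| ≤ L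

/-- Its flow for `0 ≤ t ≤ T`. -/
structure IsFlow (v : ℝ → ℝ → ℝ) (T : ℝ) (g : ℝ → ℝ → ℝ) : Prop where
  initial : ∀ a, g 0 a = a
  cont : ∀ a, Continuous fun t => g t a
  deriv : ∀ a, ∀ t ∈ Icc 0 T, HasDerivAt (fun t => g t a) (v t (g t a)) t

variable {v vx : ℝ → ℝ → ℝ} {B L T : ℝ}

theorem continuous_clamp (T : ℝ) : Continuous fun s : ℝ => max 0 (min s T) := by fun_prop

theorem clamp_mem {T : ℝ} (hT : 0 ≤ T) (s : ℝ) : max 0 (min s T) ∈ Icc 0 T :=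
  ⟨le_max_left _ _, max_le hT (min_le_right _ _)⟩

theorem clamp_eq {T s : ℝ} (hs : s ∈ Icc 0 T) : max 0 (min s T) = s := by
  rw [min_eq_left hs.2, max_eq_right hs.1]

/-- Picard–Lindelöf gives curves on `[0, T]` with one-sided derivatives at the ends. Integrating the
velocity along the curve with clamped time extends them to the line with two-sided derivatives on
the closed interval. -/
theorem IsField.exists_flow (h : IsField v vx B L) (hT : 0 ≤ T) : ∃ g, IsFlow v T g := by
  have hB : 0 ≤ B := (abs_nonneg _).trans (h.bound 0 0)
  have hL : 0 ≤ L := (abs_nonneg _).trans (h.bound' 0 0)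
  have hex : ∀ a : ℝ, ∃ y : ℝ → ℝ, y 0 = a ∧
      ∀ t ∈ Icc (0 : ℝ) T, HasDerivWithinAt y (v t (y t)) (Icc 0 T) t := by
    intro a
    -- Speed at most `B` cannot leave the ball of radius `B * T` before time `T`, so the whole
    -- interval is reached in one application.
    have hpl : IsPicardLindelof v (tmin := 0) (tmax := T) ⟨0, le_refl _, hT⟩ a
        ⟨B * T, by positivity⟩ 0 ⟨B, hB⟩ ⟨L, hL⟩ := by
      refine ⟨fun t _ => ?_, fun x _ => ?_, fun t _ x _ => h.bound t x, ?_⟩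
      · refine LipschitzWith.lipschitzOnWith ?_
        refine lipschitzWith_of_nnnorm_deriv_le (fun x => (h.deriv t x).differentiableAt)
          fun x => ?_
        rw [(h.deriv t x).deriv]
        exact h.bound' t x
      · exact (h.cont.comp (f := fun t => (t, x)) (by fun_prop)).continuousOn
      · simp only [sub_zero, NNReal.coe_zero, max_eq_left hT]
        exact le_refl (B * T)
    exact hpl.exists_eq_forall_mem_Icc_hasDerivWithinAt₀
  choose y hy0 hy using hex
  have hyc : ∀ a, Continuous fun s => y a (max 0 (min s T)) := fun a =>
    (show ContinuousOn (y a) (Icc 0 T) from fun t ht => (hy a t ht).continuousWithinAt)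
      |>.comp_continuous (continuous_clamp T) (clamp_mem hT)
  have hvc : ∀ a, Continuous fun s => v s (y a (max 0 (min s T))) := fun a =>
    h.cont.comp (f := fun s => (s, y a (max 0 (min s T)))) (continuous_id.prodMk (hyc a))
  set g : ℝ → ℝ → ℝ := fun t a => a + ∫ s in (0 : ℝ)..t, v s (y a (max 0 (min s T))) with hgdef
  have hgd : ∀ a t, HasDerivAt (fun t => g t a) (v t (y a (max 0 (min t T)))) t := fun a t =>
    ((hvc a).integral_hasStrictDerivAt 0 t).hasDerivAt.const_add a
  have hgy : ∀ a, ∀ t ∈ Icc 0 T, g t a = y a t := by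
    intro a t ht
    have := eq_of_hasDerivAt_zero (g := fun t => y a t - g t a) (a := 0) (b := T) ?_ ?_ ht
    · simp only [hy0, hgdef, intervalIntegral.integral_same] at this ⊢
      linarith
    · exact ContinuousOn.sub (fun t ht => (hy a t ht).continuousWithinAt)
        (fun t _ => (hgd a t).continuousAt.continuousWithinAt)
    · intro t ht
      have h1 := (hy a t (Ioo_subset_Icc_self ht)).hasDerivAt (Icc_mem_nhds ht.1 ht.2)
      simpa [clamp_eq (Ioo_subset_Icc_self ht)] using h1.fun_sub (hgd a t)
  refine ⟨g, fun a => by simp [hgdef], fun a => continuous_iff_continuousAt.2 fun t =>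
    (hgd a t).continuousAt, fun a t ht => ?_⟩
  have := hgd a t
  rwa [clamp_eq ht, ← hgy a t ht] at this

/-- Two integral curves of the field differ by an exponential factor. -/
theorem IsField.curve_sub (h : IsField v vx B L) {x y : ℝ → ℝ} (hx : Continuous x)
    (hy : Continuous y) (hx' : ∀ t ∈ Icc 0 T, HasDerivAt x (v t (x t)) t)
    (hy' : ∀ t ∈ Icc 0 T, HasDerivAt y (v t (y t)) t) {t : ℝ} (ht : t ∈ Icc 0 T) :
    y t - x t = (y 0 - x 0) *
      Real.exp (∫ s in (0 : ℝ)..t, ∫ r in (0 : ℝ)..1, vx s (x s + r * (y s - x s))) := by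
  have hvx := h.cont'
  have hc : Continuous fun s => ∫ r in (0 : ℝ)..1, vx s (x s + r * (y s - x s)) :=
    intervalIntegral.continuous_parametric_intervalIntegral_of_continuous'
      (f := fun s r => vx s (x s + r * (y s - x s)))
      (hvx.comp (f := fun z : ℝ × ℝ => (z.1, x z.1 + z.2 * (y z.1 - x z.1))) (by fun_prop)) 0 1
  set A := fun t => ∫ s in (0 : ℝ)..t, ∫ r in (0 : ℝ)..1, vx s (x s + r * (y s - x s)) with hA
  have hAd : ∀ t, HasDerivAt A (∫ r in (0 : ℝ)..1, vx t (x t + r * (y t - x t))) t := fun t =>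
    (hc.integral_hasStrictDerivAt 0 t).hasDerivAt
  have hd : ∀ t ∈ Icc 0 T, HasDerivAt (fun t => (y t - x t) * Real.exp (-A t)) 0 t := by
    intro t ht
    refine (((hy' t ht).sub (hx' t ht)).mul (hAd t).neg.exp).congr_deriv ?_
    simp only [Pi.sub_apply]
    rw [sub_eq_mul_integral (h.deriv t) (h.cont'.comp (f := fun x => (t, x)) (by fun_prop))]
    simp only [Pi.neg_apply]
    change (_ * ∫ r in (0 : ℝ)..1, vx t (x t + r * (y t - x t))) * _ + _ = 0
    ring
  have := eq_of_hasDerivAt_zero (fun t ht => (hd t ht).continuousAt.continuousWithinAt)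
    (fun t ht => hd t (Ioo_subset_Icc_self ht)) ht
  have hA0 : A 0 = 0 := by simp [hA]
  beta_reduce at this
  rw [hA0, neg_zero, Real.exp_zero, mul_one] at this
  rw [← this, mul_assoc, ← Real.exp_add, neg_add_cancel, Real.exp_zero, mul_one]

theorem IsField.flow_sub (h : IsField v vx B L) {g : ℝ → ℝ → ℝ} (hg : IsFlow v T g) (a b : ℝ)
    {t : ℝ} (ht : t ∈ Icc 0 T) :
    g t b - g t a = (b - a) *
      Real.exp (∫ s in (0 : ℝ)..t, ∫ r in (0 : ℝ)..1, vx s (g s a + r * (g s b - g s a))) := by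
  have := h.curve_sub (hg.cont a) (hg.cont b) (hg.deriv a) (hg.deriv b) ht
  rwa [hg.initial, hg.initial] at this

/-- The exponential factor in `IsField.flow_sub` is at most exp(Lt), so the flow map is Lipschitz.
-/
theorem IsField.continuous_flow (h : IsField v vx B L) {g : ℝ → ℝ → ℝ} (hg : IsFlow v T g)
    {t : ℝ} (ht : t ∈ Icc 0 T) : Continuous (g t) := by
  have hlip : LipschitzWith ⟨Real.exp (L * t), (Real.exp_pos _).le⟩ (g t) := by
    refine LipschitzWith.of_dist_le_mul fun b a => ?_
    rw [Real.dist_eq, Real.dist_eq, h.flow_sub hg a b ht, abs_mul, Real.abs_exp, mul_comm]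
    refine mul_le_mul_of_nonneg_right (Real.exp_le_exp.2 ?_) (abs_nonneg _)
    refine (le_abs_self _).trans ?_
    have := intervalIntegral.norm_integral_le_of_norm_le_const (a := 0) (b := t) (C := L)
      (f := fun s => ∫ r in (0 : ℝ)..1, vx s (g s a + r * (g s b - g s a))) fun s _ => by
        have := intervalIntegral.norm_integral_le_of_norm_le_const (a := 0) (b := 1) (C := L)
          (f := fun r => vx s (g s a + r * (g s b - g s a))) fun r _ => h.bound' _ _
        simpa using this
    simpa [abs_of_nonneg ht.1] using this
  exact hlip.continuous

/-- By `IsField.flow_sub` the difference quotient is exactly the exponential of an averaged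
derivative of the field. Dominated convergence lets the second point tend to the first. -/
theorem IsField.hasDerivAt_flow (h : IsField v vx B L) {g : ℝ → ℝ → ℝ} (hg : IsFlow v T g)
    (a : ℝ) {t : ℝ} (ht : t ∈ Icc 0 T) :
    HasDerivAt (g t) (Real.exp (∫ s in (0 : ℝ)..t, vx s (g s a))) a := by
  have hvx := h.cont'
  have hga := hg.cont a
  rw [hasDerivAt_iff_tendsto_slope]
  have key : ContinuousAt (fun b => ∫ s in (0 : ℝ)..t, ∫ r in (0 : ℝ)..1,
      vx s (g s a + r * (g s b - g s a))) a := by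
    refine intervalIntegral.continuousAt_of_dominated_interval (bound := fun _ => L) ?_ ?_
      intervalIntegrable_const ?_
    · refine Eventually.of_forall fun b => ?_
      have hgb := hg.cont b
      refine Continuous.aestronglyMeasurable ?_
      exact intervalIntegral.continuous_parametric_intervalIntegral_of_continuous'
        (f := fun s r => vx s (g s a + r * (g s b - g s a)))
        (hvx.comp (f := fun z : ℝ × ℝ => (z.1, g z.1 a + z.2 * (g z.1 b - g z.1 a)))
          (by fun_prop)) 0 1
    · refine Eventually.of_forall fun b => Eventually.of_forall fun s _ => ?_
      have := intervalIntegral.norm_integral_le_of_norm_le_const (a := 0) (b := 1) (C := L)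
          (f := fun r => vx s (g s a + r * (g s b - g s a))) fun r _ => h.bound' _ _
      simpa using this
    · refine Eventually.of_forall fun s hs => Continuous.continuousAt ?_
      rw [uIoc_of_le ht.1] at hs
      have hgs := h.continuous_flow hg (t := s) ⟨hs.1.le, hs.2.trans ht.2⟩
      exact intervalIntegral.continuous_parametric_intervalIntegral_of_continuous'
        (f := fun b r => vx s (g s a + r * (g s b - g s a)))
        (hvx.comp (f := fun z : ℝ × ℝ => (s, g s a + z.2 * (g s z.1 - g s a)))
          (by fun_prop)) 0 1
  have h2 : Tendsto (fun b => Real.exp (∫ s in (0 : ℝ)..t, ∫ r in (0 : ℝ)..1,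
      vx s (g s a + r * (g s b - g s a)))) (𝓝[≠] a)
      (𝓝 (Real.exp (∫ s in (0 : ℝ)..t, vx s (g s a)))) := by
    have := (Real.continuous_exp.continuousAt.comp key).tendsto.mono_left
      (nhdsWithin_le_nhds (s := {a}ᶜ))
    simpa [Function.comp_def] using this
  refine h2.congr' ?_
  filter_upwards [self_mem_nhdsWithin] with b hb
  have hba : b - a ≠ 0 := sub_ne_zero.2 hb
  rw [slope_def_field, h.flow_sub hg a b ht]
  field_simp

/-- Both sides are integral curves with the same initial point, and `IsField.curve_sub` makes their
difference a multiple of the initial one. -/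
theorem IsField.flow_add_one (h : IsField v vx B L) (hp : ∀ t, Function.Periodic (v t) 1)
    {g : ℝ → ℝ → ℝ} (hg : IsFlow v T g) (a : ℝ) {t : ℝ} (ht : t ∈ Icc 0 T) :
    g t (a + 1) = g t a + 1 := by
  have := h.curve_sub ((hg.cont a).add continuous_const) (hg.cont (a + 1))
    (y := fun t => g t (a + 1)) (x := fun t => g t a + 1)
    (fun t ht => by simpa [hp t (g t a)] using (hg.deriv a t ht).add_const (1 : ℝ))
    (hg.deriv (a + 1)) ht
  simp only [hg.initial, sub_self, zero_mul] at this
  linarith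

/-- Change of variables along a map of the circle. -/
theorem integral_comp_mul_jac {G g g' : ℝ → ℝ} (hG : Continuous G) (hGp : Function.Periodic G 1)
    (hg : ∀ a, HasDerivAt g (g' a) a) (hg' : Continuous g') (h1 : g 1 = g 0 + 1) :
    ∫ a in (0 : ℝ)..1, G (g a) * g' a = ∫ x in (0 : ℝ)..1, G x := by
  have := intervalIntegral.integral_comp_mul_deriv (a := 0) (b := 1) (fun x _ => hg x)
    hg'.continuousOn hG
  simp only [Function.comp] at this
  rw [this, h1, hGp.intervalIntegral_add_eq (g 0) 0, zero_add]

end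
end ProudmanJohnson

/-! ### Every solution has the explicit gradient distribution -/

namespace ProudmanJohnson
noncomputable section

variable {lam : ℝ} {u0 : ℝ → ℝ} {T : EReal} {u : ℝ → ℝ → ℝ}

theorem continuous_deriv_data (h0 : IsAdmissible lam u0) : Continuous (deriv u0) :=
  h0.smooth.continuous_deriv (by simp)

theorem hasDerivAt_data (h0 : IsAdmissible lam u0) (a : ℝ) : HasDerivAt u0 (deriv u0 a) a :=
  (h0.smooth.differentiable (by simp) a).hasDerivAt

theorem periodic_deriv {g : ℝ → ℝ} (hg : Function.Periodic g 1) : Function.Periodic (deriv g) 1 :=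
  fun x => by rw [← deriv_comp_add_const, show (fun x => g (x + 1)) = g from funext hg]

theorem mem_timeInterval_of_le {s t : ℝ} (ht : t ∈ timeInterval T) (h0 : 0 ≤ s) (hs : s ≤ t) :
    s ∈ timeInterval T :=
  ⟨h0, (EReal.coe_le_coe_iff.2 hs).trans_lt ht.2⟩

theorem mem_nhds_timeInterval {t : ℝ} (ht : t ∈ timeInterval T) (h0 : 0 < t) :
    timeInterval T ∈ 𝓝 t := by
  have h1 : ∀ᶠ s : ℝ in 𝓝 t, (s : EReal) < T :=
    continuous_coe_real_ereal.continuousAt.eventually_lt_const ht.2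
  filter_upwards [h1, lt_mem_nhds h0] with s hs h0s using ⟨h0s.le, hs⟩

/-- A bound for a continuous function that is periodic in space. -/
theorem exists_bound_of_periodic {v : ℝ → ℝ → ℝ} {P : ℝ → ℝ} {t : ℝ}
    (hP : ∀ s, P s ∈ Icc 0 t) (hPP : ∀ s ∈ Icc 0 t, P s = s)
    (hv : Continuous (Function.uncurry fun s x => v (P s) x))
    (hp : ∀ s, Function.Periodic (v (P s)) 1) : ∃ B, ∀ s x, |v (P s) x| ≤ B := by
  obtain ⟨B, hB⟩ := ((isCompact_Icc (a := (0 : ℝ)) (b := t)).prod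
    (isCompact_Icc (a := (0 : ℝ)) (b := 1))).exists_bound_of_continuousOn hv.continuousOn
  refine ⟨B, fun s x => ?_⟩
  obtain ⟨y, hy, hxy⟩ := (hp s).exists_mem_Ico₀ one_pos x
  rw [hxy]
  have := hB (P s, y) ⟨hP s, Ico_subset_Icc_self hy⟩
  simpa [Function.uncurry, hPP _ (hP s)] using this

theorem IsSolution.hasDerivAt_ux (hu : IsSolution lam u0 T u) {t : ℝ} (ht : t ∈ timeInterval T)
    (x : ℝ) : HasDerivAt (u t) (ux u t x) x := (hu.differentiable t ht x).hasDerivAt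

theorem IsSolution.periodic_ux (hu : IsSolution lam u0 T u) {t : ℝ} (ht : t ∈ timeInterval T) :
    Function.Periodic (ux u t) 1 := periodic_deriv (hu.periodic t ht)

theorem IsSolution.continuous_ux (hu : IsSolution lam u0 T u) {t : ℝ} (ht : t ∈ timeInterval T) :
    Continuous (ux u t) :=
  hu.contDiffOn_ux.continuousOn.comp_continuous (f := fun x => (t, x)) (by fun_prop)
    (fun _ => ⟨ht, mem_univ _⟩)

theorem IsSolution.ux_zero (hu : IsSolution lam u0 T u) : ux u 0 = deriv u0 := by
  unfold ux; rw [show u 0 = u0 from funext hu.initial]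

/-- The equation along a characteristic. -/
theorem IsSolution.hasDerivAt_along (hu : IsSolution lam u0 T u) {t : ℝ}
    (ht : t ∈ timeInterval T) (h0 : 0 < t) {g : ℝ → ℝ} (hg : HasDerivAt g (u t (g t)) t) :
    HasDerivAt (fun s => ux u s (g s)) (lam * ux u t (g t) ^ 2 - (lam + 1) * energy u t) t := by
  have hn : timeInterval T ×ˢ univ ∈ 𝓝 (t, g t) :=
    prod_mem_nhds (mem_nhds_timeInterval ht h0) univ_mem
  have hd := ((hu.contDiffOn_ux.contDiffAt hn).differentiableAt (by simp)).hasFDerivAt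
  set D := fderiv ℝ (fun z : ℝ × ℝ => ux u z.1 z.2) (t, g t)
  have h1 : HasDerivAt (fun s => ux u s (g t)) (D (1, 0)) t :=
    hd.comp_hasDerivAt t (f := fun s => (s, g t)) ((hasDerivAt_id t).prodMk (hasDerivAt_const t _))
  have h2 : HasDerivAt (ux u t) (D (0, 1)) (g t) :=
    hd.comp_hasDerivAt (g t) (f := fun x => (t, x))
      ((hasDerivAt_const _ t).prodMk (hasDerivAt_id _))
  have h3 : HasDerivAt (fun s => ux u s (g s)) (D (1, u t (g t))) t :=
    hd.comp_hasDerivAt t (f := fun s => (s, g s)) ((hasDerivAt_id t).prodMk hg)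
  refine h3.congr_deriv ?_
  have h4 : D (1, u t (g t)) = D (1, 0) + u t (g t) * D (0, 1) := by
    rw [← smul_eq_mul, ← map_smul, ← map_add]; simp
  have := hu.equation t ht h0 (g t)
  rw [h1.deriv, h2.deriv] at this
  rw [h4, energy]
  linarith

/-- Every solution is, up to a rearrangement by the flow, the explicit one. -/
theorem IsSolution.exists_param (h0 : IsAdmissible lam u0) (hu : IsSolution lam u0 T u) {τ : ℝ}
    (hτ : τ ∈ timeInterval T) :
    ∃ s ∈ dom lam (deriv u0), 0 ≤ s ∧ timeOf lam (deriv u0) s = τ ∧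
      ∀ F : ℝ → ℝ, Continuous F → ∫ x in (0 : ℝ)..1, F (ux u τ x) =
        ∫ a in (0 : ℝ)..1, F (grad lam (deriv u0) s a) * jac lam (deriv u0) s a := by
  set f := deriv u0 with hf
  have hfc : Continuous f := continuous_deriv_data h0
  have hfp : Function.Periodic f 1 := periodic_deriv h0.periodic
  -- Freezing the time outside `[0, τ]` makes the velocity a field for all times, bounded with
  -- bounded derivative by periodicity.
  set P : ℝ → ℝ := fun s => max 0 (min s τ) with hPdef
  have hP : ∀ s, P s ∈ Icc 0 τ := clamp_mem hτ.1
  have hPP : ∀ s ∈ Icc 0 τ, P s = s := fun s hs => clamp_eq hs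
  have hPc : Continuous P := continuous_clamp τ
  have hPT : ∀ s, P s ∈ timeInterval T := fun s => mem_timeInterval_of_le hτ (hP s).1 (hP s).2
  have hvc : Continuous (Function.uncurry fun s x => u (P s) x) :=
    hu.continuousOn.comp_continuous (f := fun z : ℝ × ℝ => (P z.1, z.2)) (by fun_prop)
      (fun z => ⟨hPT _, mem_univ _⟩)
  have hwc : Continuous (Function.uncurry fun s x => ux u (P s) x) :=
    hu.contDiffOn_ux.continuousOn.comp_continuous (f := fun z : ℝ × ℝ => (P z.1, z.2))
      (by fun_prop) (fun z => ⟨hPT _, mem_univ _⟩)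
  obtain ⟨B, hB⟩ := exists_bound_of_periodic hP hPP hvc fun s => hu.periodic _ (hPT s)
  obtain ⟨L, hL⟩ := exists_bound_of_periodic hP hPP hwc fun s => hu.periodic_ux (hPT s)
  have hF : IsField (fun s x => u (P s) x) (fun s x => ux u (P s) x) B L :=
    ⟨hvc, hwc, fun s x => hu.hasDerivAt_ux (hPT s) x, hB, hL⟩
  obtain ⟨g, hg⟩ := hF.exists_flow hτ.1
  -- the velocity gradient along characteristics
  set q : ℝ → ℝ → ℝ := fun s a => ux u (P s) (g s a) with hq
  have hqc : ∀ a, Continuous fun s => q s a := fun a =>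
    hwc.comp (f := fun s => (s, g s a)) (continuous_id.prodMk (hg.cont a))
  have hq0 : ∀ a, q 0 a = f a := fun a => by
    simp only [hq, hPP 0 ⟨le_rfl, hτ.1⟩, hg.initial, hu.ux_zero]
    rfl
  have hqd : ∀ a, ∀ t ∈ Ioo 0 τ,
      HasDerivAt (fun s => q s a) (lam * q t a ^ 2 - (lam + 1) * energy u t) t := by
    intro a t ht
    have ht' := Ioo_subset_Icc_self ht
    have h1 := hg.deriv a t ht'
    simp only [hPP t ht'] at h1
    have h2 := hu.hasDerivAt_along (mem_timeInterval_of_le hτ ht'.1 ht'.2) ht.1 h1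
    simp only [hq, hPP t ht']
    refine h2.congr_of_eventuallyEq ?_
    filter_upwards [Ioo_mem_nhds ht.1 ht.2] with s hs
    rw [hPP s (Ioo_subset_Icc_self hs)]
  set S : ℝ → ℝ → ℝ := fun t a => ∫ s in (0 : ℝ)..t, q s a with hS
  have hSd : ∀ a t, HasDerivAt (fun t => S t a) (q t a) t := fun a t =>
    ((hqc a).integral_hasStrictDerivAt 0 t).hasDerivAt
  have hSc : ∀ a, Continuous fun t => S t a := fun a =>
    continuous_iff_continuousAt.2 fun t => (hSd a t).continuousAt
  have hS0 : ∀ a, S 0 a = 0 := fun a => by simp [hS]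
  -- a point where the datum has zero slope
  obtain ⟨a0, -, ha0⟩ : ∃ a ∈ Ioo (0 : ℝ) 1, deriv u0 a = 0 :=
    exists_deriv_eq_zero one_pos h0.smooth.continuous.continuousOn
      (by simpa using (h0.periodic 0).symm)
  change f a0 = 0 at ha0
  -- Subtracting two Riccati equations cancels the energy and leaves (q_a − q_{a0})' = λ(q_a +
  -- q_{a0})(q_a − q_{a0}), which is linear in the difference.
  have hconst : ∀ a, ∀ t ∈ Icc 0 τ,
      q t a - q t a0 = f a * Real.exp (lam * (S t a + S t a0)) := by
    intro a t ht
    have := eq_of_hasDerivAt_zero (a := 0) (b := τ)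
      (g := fun t => (q t a - q t a0) * Real.exp (-(lam * (S t a + S t a0)))) ?_ ?_ ht
    · simp only [hq0, hS0, ha0, add_zero, mul_zero, neg_zero, Real.exp_zero, mul_one,
        sub_zero] at this
      rw [← this, mul_assoc, ← Real.exp_add, neg_add_cancel, Real.exp_zero, mul_one]
    · have h1 := hqc a
      have h2 := hqc a0
      have h3 := hSc a
      have h4 := hSc a0
      exact Continuous.continuousOn (by fun_prop)
    · intro t ht
      refine (((hqd a t ht).fun_sub (hqd a0 t ht)).fun_mul
        ((((hSd a t).fun_add (hSd a0 t)).const_mul lam).fun_neg.exp)).congr_deriv ?_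
      ring
  -- the parameter
  have hec : Continuous fun s => Real.exp (2 * lam * S s a0) := by
    have := hSc a0
    fun_prop
  set η : ℝ → ℝ := fun t => ∫ s in (0 : ℝ)..t, Real.exp (2 * lam * S s a0) with hη
  have hηd : ∀ t, HasDerivAt η (Real.exp (2 * lam * S t a0)) t := fun t =>
    (hec.integral_hasStrictDerivAt 0 t).hasDerivAt
  have hηc : Continuous η := continuous_iff_continuousAt.2 fun t => (hηd t).continuousAt
  have hη0 : η 0 = 0 := by simp [hη]
  -- Both sides are 1 at time 0 and have the same derivative by `hconst`. In particular the left
  -- side stays positive, so the parameter never leaves `dom`.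
  have hden : ∀ a, ∀ t ∈ Icc 0 τ,
      1 - lam * η t * f a = Real.exp (-(lam * (S t a - S t a0))) := by
    intro a t ht
    have := eq_of_hasDerivAt_zero (a := 0) (b := τ)
      (g := fun t => 1 - lam * η t * f a - Real.exp (-(lam * (S t a - S t a0)))) ?_ ?_ ht
    · simp only [hS0, hη0, sub_self, mul_zero, zero_mul, neg_zero, Real.exp_zero] at this
      linarith
    · have h3 := hSc a
      have h4 := hSc a0
      exact Continuous.continuousOn (by fun_prop)
    · intro t ht
      refine (((((hηd t).const_mul lam).mul_const (f a)).const_sub 1).fun_sub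
        ((((hSd a t).fun_sub (hSd a0 t)).const_mul lam).fun_neg.exp)).congr_deriv ?_
      rw [hconst a t (Ioo_subset_Icc_self ht)]
      have : Real.exp (2 * lam * S t a0) =
          Real.exp (-(lam * (S t a - S t a0))) * Real.exp (lam * (S t a + S t a0)) := by
        rw [← Real.exp_add]; ring_nf
      rw [this]
      ring
  have hdom : ∀ t ∈ Icc 0 τ, η t ∈ dom lam f := fun t ht a => by
    rw [hden a t ht]; exact Real.exp_pos _
  have hker : ∀ a, ∀ t ∈ Icc 0 τ, ker lam (η t) (f a) = Real.exp (S t a - S t a0) := by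
    intro a t ht
    unfold ker
    split_ifs with hl
    · subst hl
      have := eq_of_hasDerivAt_zero (a := 0) (b := τ)
        (g := fun t => η t * f a - (S t a - S t a0)) ?_ ?_ ht
      · simp only [hS0, hη0, sub_self, zero_mul] at this
        congr 1; linarith
      · have h3 := hSc a
        have h4 := hSc a0
        exact Continuous.continuousOn (by fun_prop)
      · intro t ht
        refine (((hηd t).mul_const (f a)).fun_sub ((hSd a t).fun_sub (hSd a0 t))).congr_deriv ?_
        rw [hconst a t (Ioo_subset_Icc_self ht)]
        simp
    · rw [hden a t ht, ← Real.exp_mul]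
      congr 1
      field_simp
  -- normalization
  have hgd : ∀ t ∈ Icc 0 τ, ∀ a, HasDerivAt (g t) (Real.exp (S t a)) a := fun t ht a =>
    hF.hasDerivAt_flow hg a ht
  have hSsplit : ∀ t ∈ Icc 0 τ, ∀ a,
      Real.exp (S t a) = Real.exp (S t a0) * ker lam (η t) (f a) := fun t ht a => by
    rw [hker a t ht, ← Real.exp_add]; ring_nf
  have hSac : ∀ t ∈ Icc 0 τ, Continuous fun a => Real.exp (S t a) := fun t ht => by
    rw [funext (hSsplit t ht)]
    exact (continuous_ker hfc (hdom t ht)).const_mul _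
  have hg1 : ∀ t ∈ Icc 0 τ, g t 1 = g t 0 + 1 := fun t ht => by
    simpa using hF.flow_add_one (fun s => hu.periodic _ (hPT s)) hg 0 ht
  -- The flow map advances by 1 over a period, so its Jacobian integrates to 1; this fixes the one
  -- unknown function S(t, a0).
  have hK : ∀ t ∈ Icc 0 τ, Real.exp (S t a0) * kerInt lam f 0 (η t) = 1 := by
    intro t ht
    have h1 := integral_comp_mul_jac (G := fun _ => 1) continuous_const (fun _ => rfl)
      (hgd t ht) (hSac t ht) (hg1 t ht)
    simp only [one_mul, intervalIntegral.integral_const, sub_zero, smul_eq_mul, mul_one] at h1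
    rw [funext (hSsplit t ht), intervalIntegral.integral_const_mul] at h1
    simpa [kerInt] using h1
  have hKS : ∀ t ∈ Icc 0 τ, kerInt lam f 0 (η t) = Real.exp (-S t a0) := fun t ht => by
    rw [Real.exp_neg]; exact eq_inv_of_mul_eq_one_right (hK t ht)
  have hτm : τ ∈ Icc 0 τ := ⟨hτ.1, le_rfl⟩
  -- The derivative of `timeOf` is `kerInt` to the power 2λ, which `hKS` identifies with exp(−2λ
  -- S(t, a0)), the inverse of the derivative of η.
  have htime : ∀ t ∈ Icc 0 τ, timeOf lam f (η t) = t := by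
    intro t ht
    have hd : ∀ t ∈ Icc 0 τ, HasDerivAt (fun t => timeOf lam f (η t) - t) 0 t := by
      intro t ht
      refine (((hasDerivAt_timeOf hfc hfp (hdom t ht)).comp t (hηd t)).fun_sub
        (hasDerivAt_id t)).congr_deriv ?_
      rw [hKS t ht, ← Real.exp_mul, ← Real.exp_add, sub_eq_zero, ← Real.exp_zero]
      ring_nf
    have := eq_of_hasDerivAt_zero (fun t ht => (hd t ht).continuousAt.continuousWithinAt)
      (fun t ht => hd t (Ioo_subset_Icc_self ht)) ht
    beta_reduce at this
    rw [hη0, timeOf_zero] at this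
    linarith
  have hjac : ∀ a, jac lam f (η τ) a = Real.exp (S τ a) := fun a => by
    rw [jac, hSsplit τ hτm, hKS τ hτm, Real.exp_neg]
    field_simp
  have hq1 : ∀ a, q τ a = q τ a0 +
      kerInt lam f 0 (η τ) ^ (-(2 * lam)) * (f a / (1 - lam * η τ * f a)) := fun a => by
    rw [hKS τ hτm, ← Real.exp_mul, hden a τ hτm, ← sub_eq_iff_eq_add', hconst a τ hτm,
      mul_div_assoc', mul_comm, mul_div_right_comm, ← Real.exp_sub]
    ring_nf
  -- By periodicity of `u` the gradient has zero mean over a period; this determines the remaining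
  -- constant q(τ, a0).
  have hmean : ∫ a in (0 : ℝ)..1, q τ a * Real.exp (S τ a) = 0 := by
    have h1 := integral_comp_mul_jac (hu.continuous_ux hτ) (hu.periodic_ux hτ)
      (hgd τ hτm) (hSac τ hτm) (hg1 τ hτm)
    simp only [hq, hPP τ hτm]
    rw [h1, intervalIntegral.integral_eq_sub_of_hasDerivAt (fun x _ => hu.hasDerivAt_ux hτ x)
      ((hu.continuous_ux hτ).intervalIntegrable _ _)]
    simpa [sub_eq_zero] using hu.periodic τ hτ 0
  have hdτ := hdom τ hτm
  have hKpos := kerInt_pos hfc hdτ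
  have hqgrad : ∀ a, q τ a = grad lam f (η τ) a := by
    have hcont := continuous_kerInt_integrand hfc 1 hdτ
    have hcont0 := continuous_ker hfc hdτ
    have : q τ a0 = -(kerInt lam f 0 (η τ) ^ (-(2 * lam)) *
        (kerInt lam f 1 (η τ) / kerInt lam f 0 (η τ))) := by
      have h2 : ∀ a, q τ a * Real.exp (S τ a) =
          q τ a0 * Real.exp (S τ a0) * ker lam (η τ) (f a) +
          kerInt lam f 0 (η τ) ^ (-(2 * lam)) * Real.exp (S τ a0) *
            (f a ^ 1 * ker lam (η τ) (f a) / (1 - lam * η τ * f a) ^ 1) := fun a => by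
        rw [hq1, hSsplit τ hτm]
        simp only [pow_one]
        ring
      rw [funext h2, intervalIntegral.integral_add
        ((hcont0.intervalIntegrable _ _).const_mul _) ((hcont.intervalIntegrable _ _).const_mul _),
        intervalIntegral.integral_const_mul, intervalIntegral.integral_const_mul] at hmean
      have h3 : ∫ a in (0 : ℝ)..1, ker lam (η τ) (f a) = kerInt lam f 0 (η τ) := by simp [kerInt]
      change _ + _ * kerInt lam f 1 (η τ) = 0 at hmean
      rw [h3] at hmean
      have h5 : Real.exp (S τ a0) = (kerInt lam f 0 (η τ))⁻¹ :=
        eq_inv_of_mul_eq_one_left (hK τ hτm)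
      rw [h5] at hmean
      field_simp at hmean ⊢
      linarith
    intro a
    rw [hq1, this, grad]
    ring
  refine ⟨η τ, hdτ, ?_, htime τ hτm, fun F hFc => ?_⟩
  · exact intervalIntegral.integral_nonneg hτ.1 fun s _ => (Real.exp_pos _).le
  · have h1 := integral_comp_mul_jac (G := fun x => F (ux u τ x))
      (hFc.comp (hu.continuous_ux hτ)) (fun x => by simp only [hu.periodic_ux hτ x])
      (hgd τ hτm) (hSac τ hτm) (hg1 τ hτm)
    rw [← h1]
    refine intervalIntegral.integral_congr fun a _ => ?_
    simp only [← hqgrad, hjac, hq, hPP τ hτm]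

end
end ProudmanJohnson

/-! ### Existence: inverting the Lagrangian flow -/

namespace ProudmanJohnson
noncomputable section

theorem contDiffAt_one_of_hasDerivAt {O : Set ℝ} (hO : IsOpen O) {h h' : ℝ → ℝ}
    (hd : ∀ t ∈ O, HasDerivAt h (h' t) t) (hc : ContinuousOn h' O) {t : ℝ} (ht : t ∈ O) :
    ContDiffAt ℝ 1 h t := by
  rw [contDiffAt_one_iff]
  refine ⟨fun t => ContinuousLinearMap.toSpanSingleton ℝ (h' t), O, hO.mem_nhds ht, ?_,
    fun t ht => (hd t ht).hasFDerivAt⟩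
  exact (ContinuousLinearMap.toSpanSingletonCLE (𝕜 := ℝ) (E := ℝ)).continuous.comp_continuousOn hc

/-- A family of diffeomorphisms of the circle, continuously differentiable also in time. -/
structure IsDiffeoFamily (O : Set ℝ) (g V J : ℝ → ℝ → ℝ) : Prop where
  isOpen : IsOpen O
  contV : ContinuousOn (Function.uncurry V) (O ×ˢ univ)
  contJ : ContinuousOn (Function.uncurry J) (O ×ˢ univ)
  derivJ : ∀ t ∈ O, ∀ a, HasDerivAt (g t) (J t a) a
  derivV : ∀ t ∈ O, ∀ a, HasDerivAt (fun t => g t a) (V t a) t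
  pos : ∀ t ∈ O, ∀ a, 0 < J t a
  shift : ∀ t ∈ O, ∀ a, g t (a + 1) = g t a + 1

namespace IsDiffeoFamily

variable {O : Set ℝ} {g V J : ℝ → ℝ → ℝ}

theorem strictMono (h : IsDiffeoFamily O g V J) {t : ℝ} (ht : t ∈ O) : StrictMono (g t) :=
  strictMono_of_deriv_pos fun a => by rw [(h.derivJ t ht a).deriv]; exact h.pos t ht a

/-- The map minus the identity is periodic, so the values at integers are unbounded in both
directions and the intermediate value theorem applies. -/
theorem surjective (h : IsDiffeoFamily O g V J) {t : ℝ} (ht : t ∈ O) :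
    Function.Surjective (g t) := by
  intro x
  have hc : Continuous (g t) :=
    continuous_iff_continuousAt.2 fun a => (h.derivJ t ht a).continuousAt
  have hp : Function.Periodic (fun a => g t a - a) 1 := fun a => by
    simp only [h.shift t ht a]; ring
  have hn : ∀ n : ℤ, g t n = g t 0 + n := fun n => by
    have := hp.int_mul_eq n
    simp only [mul_one, sub_zero] at this
    linarith
  obtain ⟨n, hn'⟩ := exists_nat_ge |x - g t 0|
  have h1 := hn n
  have h2 := hn (-n)
  push_cast at h1 h2
  have h3 := abs_le.1 hn'
  obtain ⟨a, -, ha⟩ := intermediate_value_Icc (a := -(n : ℝ)) (b := n) (f := g t)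
    (by linarith [(abs_nonneg (x - g t 0)).trans hn']) hc.continuousOn
    (show x ∈ Icc _ _ from ⟨by linarith, by linarith⟩)
  exact ⟨a, ha⟩

/-- The inverse diffeomorphism. -/
def inv (g : ℝ → ℝ → ℝ) (t x : ℝ) : ℝ := Function.invFun (g t) x

theorem apply_inv (h : IsDiffeoFamily O g V J) {t : ℝ} (ht : t ∈ O) (x : ℝ) :
    g t (inv g t x) = x := Function.invFun_eq (h.surjective ht x)

theorem inv_apply (h : IsDiffeoFamily O g V J) {t : ℝ} (ht : t ∈ O) (a : ℝ) :
    inv g t (g t a) = a := (h.strictMono ht).injective (h.apply_inv ht _)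

theorem inv_add_one (h : IsDiffeoFamily O g V J) {t : ℝ} (ht : t ∈ O) (x : ℝ) :
    inv g t (x + 1) = inv g t x + 1 :=
  (h.strictMono ht).injective (by rw [h.apply_inv ht, h.shift t ht, h.apply_inv ht])

theorem hasFDerivAt (h : IsDiffeoFamily O g V J) {z : ℝ × ℝ} (hz : z.1 ∈ O) :
    HasFDerivAt (fun z : ℝ × ℝ => g z.1 z.2)
      ((ContinuousLinearMap.toSpanSingleton ℝ (V z.1 z.2)).coprod
        (ContinuousLinearMap.toSpanSingleton ℝ (J z.1 z.2))) z := by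
  have hO : O ×ˢ univ ∈ 𝓝 z := (h.isOpen.prod isOpen_univ).mem_nhds ⟨hz, mem_univ _⟩
  have hspan := (ContinuousLinearMap.toSpanSingletonCLE (𝕜 := ℝ) (E := ℝ)).continuous
  exact (hasStrictFDerivAt_uncurry_coprod (u := z) (f := g)
    (f₁ := fun t a => ContinuousLinearMap.toSpanSingleton ℝ (V t a))
    (f₂ := fun t a => ContinuousLinearMap.toSpanSingleton ℝ (J t a))
    (by filter_upwards [hO] with y hy using (h.derivV y.1 hy.1 y.2).hasFDerivAt)
    (by filter_upwards [hO] with y hy using (h.derivJ y.1 hy.1 y.2).hasFDerivAt)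
    (hspan.continuousAt.comp (f := Function.uncurry V) (h.contV.continuousAt hO))
    (hspan.continuousAt.comp (f := Function.uncurry J) (h.contJ.continuousAt hO))).hasFDerivAt

theorem contDiffAt (h : IsDiffeoFamily O g V J) {z : ℝ × ℝ} (hz : z.1 ∈ O) :
    ContDiffAt ℝ 1 (fun z : ℝ × ℝ => g z.1 z.2) z := by
  have hO : O ×ˢ univ ∈ 𝓝 z := (h.isOpen.prod isOpen_univ).mem_nhds ⟨hz, mem_univ _⟩
  have hspan := (ContinuousLinearMap.toSpanSingletonCLE (𝕜 := ℝ) (E := ℝ)).continuous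
  rw [contDiffAt_one_iff]
  refine ⟨_, _, hO, ?_, fun y hy => h.hasFDerivAt hy.1⟩
  have h1 : ContinuousOn (fun z : ℝ × ℝ => ContinuousLinearMap.toSpanSingleton ℝ (V z.1 z.2))
    (O ×ˢ univ) := hspan.comp_continuousOn h.contV
  have h2 : ContinuousOn (fun z : ℝ × ℝ => ContinuousLinearMap.toSpanSingleton ℝ (J z.1 z.2))
    (O ×ˢ univ) := hspan.comp_continuousOn h.contJ
  have := (h1.clm_comp (continuousOn_const (c := ContinuousLinearMap.fst ℝ ℝ ℝ))).add
    (h2.clm_comp (continuousOn_const (c := ContinuousLinearMap.snd ℝ ℝ ℝ)))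
  refine this.congr fun y _ => ?_
  ext <;> simp

/-- The inverse function theorem is applied to (t, a) ↦ (t, g t a), whose differential is triangular
with nonzero diagonal 1, J. Injectivity of each `g t` identifies the local inverse with `inv`. -/
theorem contDiffAt_inv (h : IsDiffeoFamily O g V J) {z : ℝ × ℝ} (hz : z.1 ∈ O) :
    ContDiffAt ℝ 1 (fun z : ℝ × ℝ => inv g z.1 z.2) z := by
  set a := inv g z.1 z.2 with ha
  have hga : g z.1 a = z.2 := h.apply_inv hz _
  set Φ : ℝ × ℝ → ℝ × ℝ := fun y => (y.1, g y.1 y.2) with hΦ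
  have hΦz : Φ (z.1, a) = z := Prod.ext rfl hga
  have hΦc : ContDiffAt ℝ 1 Φ (z.1, a) :=
    contDiffAt_fst.prodMk (h.contDiffAt (z := (z.1, a)) hz)
  set v := V z.1 a
  set j := J z.1 a
  have hj : j ≠ 0 := (h.pos z.1 hz a).ne'
  let f₁ : ℝ × ℝ →L[ℝ] ℝ × ℝ := (ContinuousLinearMap.fst ℝ ℝ ℝ).prod
    ((ContinuousLinearMap.toSpanSingleton ℝ v).coprod (ContinuousLinearMap.toSpanSingleton ℝ j))
  let f₂ : ℝ × ℝ →L[ℝ] ℝ × ℝ := (ContinuousLinearMap.fst ℝ ℝ ℝ).prod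
    ((ContinuousLinearMap.toSpanSingleton ℝ (-v / j)).coprod
      (ContinuousLinearMap.toSpanSingleton ℝ j⁻¹))
  let e : (ℝ × ℝ) ≃L[ℝ] (ℝ × ℝ) := ContinuousLinearEquiv.equivOfInverse f₁ f₂
    (fun y => by
      refine Prod.ext rfl ?_
      simp [f₁, f₂]; field_simp; ring)
    (fun y => by
      refine Prod.ext rfl ?_
      simp [f₁, f₂]; field_simp; ring)
  have hΦd : HasFDerivAt Φ (e : ℝ × ℝ →L[ℝ] ℝ × ℝ) (z.1, a) :=
    hasFDerivAt_fst.prodMk (h.hasFDerivAt (z := (z.1, a)) hz)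
  have hloc := hΦc.to_localInverse hΦd one_ne_zero
  have hright := (hΦc.hasStrictFDerivAt' hΦd one_ne_zero).eventually_right_inverse
  rw [hΦz] at hloc hright
  refine (contDiffAt_snd.comp z hloc).congr_of_eventuallyEq ?_
  have hO : O ×ˢ univ ∈ 𝓝 z := (h.isOpen.prod isOpen_univ).mem_nhds ⟨hz, mem_univ _⟩
  filter_upwards [hright, hO] with y hy hyO
  have h1 := congrArg Prod.fst hy
  have h2 := congrArg Prod.snd hy
  simp only [hΦ] at h1 h2
  rw [h1] at h2
  refine (h.strictMono hyO.1).injective ?_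
  rw [h.apply_inv hyO.1]
  exact h2.symm

theorem continuousOn_inv (h : IsDiffeoFamily O g V J) :
    ContinuousOn (fun z : ℝ × ℝ => inv g z.1 z.2) (O ×ˢ univ) := fun _ hz =>
  (h.contDiffAt_inv hz.1).continuousAt.continuousWithinAt

theorem hasDerivAt_inv (h : IsDiffeoFamily O g V J) {t : ℝ} (ht : t ∈ O) (x : ℝ) :
    HasDerivAt (inv g t) (J t (inv g t x))⁻¹ x := by
  refine HasDerivAt.of_local_left_inverse (f := g t) ?_ (h.derivJ t ht _) (h.pos t ht _).ne'
    (Eventually.of_forall fun y => h.apply_inv ht y)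
  exact (h.contDiffAt_inv (z := (t, x)) ht).continuousAt.comp (f := fun x => (t, x)) (by fun_prop)

end IsDiffeoFamily

variable {lam : ℝ} {f : ℝ → ℝ}

/-- In terms of time this is the law J_t = (u_x∘γ) J; the power of `kerInt` is dt/ds. -/
theorem hasDerivAt_jac (hf : Continuous f) (hp : Function.Periodic f 1) (a : ℝ) {s : ℝ}
    (hs : s ∈ dom lam f) :
    HasDerivAt (fun s => jac lam f s a)
      (kerInt lam f 0 s ^ (2 * lam) * (grad lam f s a * jac lam f s a)) s := by
  have hpos := kerInt_pos hf hs
  refine ((hasDerivAt_ker (hs a)).fun_div (hasDerivAt_kerInt hf hp 0 hs) hpos.ne').congr_deriv ?_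
  have hP : kerInt lam f 0 s ^ (2 * lam) = (kerInt lam f 0 s ^ (-(2 * lam)))⁻¹ := by
    rw [Real.rpow_neg hpos.le, inv_inv]
  have hQ : kerInt lam f 0 s ^ (-(2 * lam)) ≠ 0 := (Real.rpow_pos_of_pos hpos _).ne'
  have hd := (hs a).ne'
  have h0 := hpos.ne'
  rw [hP, grad, jac]
  generalize kerInt lam f 0 s ^ (-(2 * lam)) = Q at *
  generalize 1 - lam * s * f a = D at *
  push_cast
  field_simp
  ring

/-- The Riccati equation along characteristics, with the factor dt/ds; the energy appears through
its variance formula. -/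
theorem hasDerivAt_grad (hf : Continuous f) (hp : Function.Periodic f 1) (a : ℝ) {s : ℝ}
    (hs : s ∈ dom lam f) :
    HasDerivAt (fun s => grad lam f s a)
      (kerInt lam f 0 s ^ (2 * lam) *
        (lam * grad lam f s a ^ 2 - (lam + 1) * energyOf lam f s)) s := by
  have hpos := kerInt_pos hf hs
  have h0 := hpos.ne'
  have hd := (hs a).ne'
  have d0 := hasDerivAt_kerInt (lam := lam) hf hp 0 hs
  have d1 := hasDerivAt_kerInt (lam := lam) hf hp 1 hs
  have h1 : HasDerivAt (fun s => 1 - lam * s * f a) (-(lam * f a)) s := by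
    simpa using (((hasDerivAt_id s).const_mul lam).mul_const (f a)).const_sub 1
  have key := (d0.rpow_const (p := -(2 * lam)) (Or.inl h0)).fun_mul
    (((hasDerivAt_const s (f a)).fun_div h1 hd).fun_sub (d1.fun_div d0 h0))
  refine key.congr_deriv ?_
  have hP : kerInt lam f 0 s ^ (2 * lam) = (kerInt lam f 0 s ^ (-(2 * lam)))⁻¹ := by
    rw [Real.rpow_neg hpos.le, inv_inv]
  have hQ : kerInt lam f 0 s ^ (-(2 * lam)) ≠ 0 := (Real.rpow_pos_of_pos hpos _).ne'
  rw [hP, energyOf_eq hf hs, grad, Real.rpow_sub_one h0]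
  generalize kerInt lam f 0 s ^ (-(2 * lam)) = Q at *
  generalize 1 - lam * s * f a = D at *
  push_cast
  field_simp
  ring

theorem continuousOn_comp_paramOf (hf : Continuous f) (hp : Function.Periodic f 1)
    {F : ℝ → ℝ → ℝ} (hF : ContinuousOn (Function.uncurry F) (dom lam f ×ˢ univ)) :
    ContinuousOn (Function.uncurry fun t a => F (paramOf lam f t) a)
      ((timeOf lam f '' dom lam f) ×ˢ univ) := by
  have hc : ContinuousOn (paramOf lam f) (timeOf lam f '' dom lam f) := fun t ht =>
    (hasDerivAt_paramOf hf hp ht).continuousAt.continuousWithinAt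
  refine hF.comp (f := fun z : ℝ × ℝ => (paramOf lam f z.1, z.2)) ?_
    fun z hz => ⟨paramOf_mem hz.1, mem_univ _⟩
  exact (hc.comp continuousOn_fst fun z hz => hz.1).prodMk continuousOn_snd

/-- The Lagrangian flow. -/
def flow (lam : ℝ) (f : ℝ → ℝ) (c t a : ℝ) : ℝ :=
  c * t + ∫ b in (0 : ℝ)..a, jac lam f (paramOf lam f t) b

/-- The velocity in Lagrangian variables. -/
def flowVel (lam : ℝ) (f : ℝ → ℝ) (c t a : ℝ) : ℝ :=
  c + ∫ b in (0 : ℝ)..a, grad lam f (paramOf lam f t) b * jac lam f (paramOf lam f t) b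

theorem periodic_jac (hp : Function.Periodic f 1) (s : ℝ) : Function.Periodic (jac lam f s) 1 :=
  fun a => by simp only [jac, hp a]

theorem isDiffeoFamily_flow (hf : Continuous f) (hp : Function.Periodic f 1) (c : ℝ) :
    IsDiffeoFamily (timeOf lam f '' dom lam f) (flow lam f c) (flowVel lam f c)
      (fun t a => jac lam f (paramOf lam f t) a) := by
  have hJ := continuousOn_comp_paramOf hf hp (continuousOn_jac (lam := lam) hf hp)
  have hG := continuousOn_comp_paramOf hf hp (F := fun s a => grad lam f s a * jac lam f s a)
    ((continuousOn_grad (lam := lam) hf hp).mul (continuousOn_jac (lam := lam) hf hp))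
  have ho := isOpen_timeOf_image (lam := lam) hf hp
  refine ⟨ho, ?_, hJ, ?_, ?_, ?_, ?_⟩
  · exact continuousOn_const.add (continuousOn_parametric_primitive hG 0)
  · intro t ht a
    exact ((continuous_jac hf (paramOf_mem ht)).integral_hasStrictDerivAt 0 a).hasDerivAt.const_add
      _
  · intro t ht a
    have := hasDerivAt_intervalIntegral_of_continuousOn ho hJ hG (fun t ht b => by
      have hs := paramOf_mem ht
      refine ((hasDerivAt_jac hf hp b hs).comp t (hasDerivAt_paramOf hf hp ht)).congr_deriv ?_
      rw [mul_right_comm, ← Real.rpow_add (kerInt_pos hf hs)]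
      simp) 0 a ht
    simpa [flow, flowVel] using ((hasDerivAt_id t).const_mul c).fun_add this
  · exact fun t ht a => jac_pos hf (paramOf_mem ht) a
  · intro t ht a
    have hi := fun x y => (continuous_jac hf (paramOf_mem ht)).intervalIntegrable (μ := volume) x y
    have := (periodic_jac (lam := lam) hp (paramOf lam f t)).intervalIntegral_add_eq a 0
    rw [zero_add, integral_jac hf (paramOf_mem ht)] at this
    rw [flow, flow, ← intervalIntegral.integral_add_adjacent_intervals (hi 0 a) (hi a _), this]
    ring

theorem contDiffAt_kerInt (hf : Continuous f) (hp : Function.Periodic f 1) (j : ℕ) {s : ℝ}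
    (hs : s ∈ dom lam f) : ContDiffAt ℝ 1 (kerInt lam f j) s :=
  contDiffAt_one_of_hasDerivAt (isOpen_dom hf hp) (fun _ hs => hasDerivAt_kerInt hf hp j hs)
    ((continuousOn_kerInt hf hp (j + 1)).const_smul (1 + j * lam)) hs

theorem contDiffAt_paramOf (hf : Continuous f) (hp : Function.Periodic f 1) {t : ℝ}
    (ht : t ∈ timeOf lam f '' dom lam f) : ContDiffAt ℝ 1 (paramOf lam f) t := by
  refine contDiffAt_one_of_hasDerivAt (isOpen_timeOf_image hf hp)
    (fun t ht => hasDerivAt_paramOf hf hp ht) ?_ ht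
  have hc : ContinuousOn (paramOf lam f) (timeOf lam f '' dom lam f) := fun t ht =>
    (hasDerivAt_paramOf hf hp ht).continuousAt.continuousWithinAt
  exact ((continuousOn_kerInt hf hp 0).comp hc fun t ht => paramOf_mem ht).rpow_const
    fun t ht => Or.inl (kerInt_pos hf (paramOf_mem ht)).ne'

/-- The velocity gradient as a function of time and place. -/
def eulerGrad (lam : ℝ) (f : ℝ → ℝ) (c t x : ℝ) : ℝ :=
  grad lam f (paramOf lam f t) (IsDiffeoFamily.inv (flow lam f c) t x)

/-- The velocity as a function of time and place. -/
def eulerVel (lam : ℝ) (f : ℝ → ℝ) (c t x : ℝ) : ℝ :=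
  flowVel lam f c t (IsDiffeoFamily.inv (flow lam f c) t x)

theorem contDiffAt_eulerGrad (hf : ContDiff ℝ 1 f) (hp : Function.Periodic f 1) (c : ℝ)
    {z : ℝ × ℝ} (hz : z.1 ∈ timeOf lam f '' dom lam f) :
    ContDiffAt ℝ 1 (fun z : ℝ × ℝ => eulerGrad lam f c z.1 z.2) z := by
  have hfc := hf.continuous
  have hs := paramOf_mem hz
  have hA := (isDiffeoFamily_flow (lam := lam) hfc hp c).contDiffAt_inv hz
  have hP : ContDiffAt ℝ 1 (fun z : ℝ × ℝ => paramOf lam f z.1) z :=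
    (contDiffAt_paramOf hfc hp hz).comp z contDiffAt_fst
  have h0 : ContDiffAt ℝ 1 (fun z : ℝ × ℝ => kerInt lam f 0 (paramOf lam f z.1)) z :=
    (contDiffAt_kerInt hfc hp 0 hs).comp (f := fun z : ℝ × ℝ => paramOf lam f z.1) z hP
  have h1 : ContDiffAt ℝ 1 (fun z : ℝ × ℝ => kerInt lam f 1 (paramOf lam f z.1)) z :=
    (contDiffAt_kerInt hfc hp 1 hs).comp (f := fun z : ℝ × ℝ => paramOf lam f z.1) z hP
  have hF : ContDiffAt ℝ 1
      (fun z : ℝ × ℝ => f (IsDiffeoFamily.inv (flow lam f c) z.1 z.2)) z :=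
    hf.contDiffAt.comp z hA
  have hne := (kerInt_pos hfc hs).ne'
  unfold eulerGrad grad
  exact (h0.rpow_const_of_ne hne).mul
    ((hF.div (contDiffAt_const.sub ((contDiffAt_const.mul hP).mul hF)) (hs _).ne').sub
      (h1.div h0 hne))

/-- The Jacobian in the density of the Lagrangian velocity cancels against the derivative of the
inverse flow. -/
theorem hasDerivAt_eulerVel (hf : Continuous f) (hp : Function.Periodic f 1) (c : ℝ) {t : ℝ}
    (ht : t ∈ timeOf lam f '' dom lam f) (x : ℝ) :
    HasDerivAt (eulerVel lam f c t) (eulerGrad lam f c t x) x := by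
  have hs := paramOf_mem ht
  have h1 := (((continuous_grad hf hs).fun_mul (continuous_jac hf hs)).integral_hasStrictDerivAt 0
    (IsDiffeoFamily.inv (flow lam f c) t x)).hasDerivAt.const_add c
  refine (h1.comp x ((isDiffeoFamily_flow hf hp c).hasDerivAt_inv ht x)).congr_deriv ?_
  rw [mul_assoc, mul_inv_cancel₀ (jac_pos hf hs _).ne', mul_one, eulerGrad]

theorem exists_isSolution {u0 : ℝ → ℝ} (h0 : IsAdmissible lam u0) {T : EReal}
    (hT : timeInterval T ⊆ timeOf lam (deriv u0) '' dom lam (deriv u0)) :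
    ∃ u, IsSolution lam u0 T u := by
  set f := deriv u0 with hfdef
  have hf : Continuous f := continuous_deriv_data h0
  have hf1 : ContDiff ℝ 1 f := by
    have h2 : ContDiff ℝ 2 u0 := h0.smooth.of_le (WithTop.coe_le_coe.2 le_top)
    exact ((contDiff_succ_iff_deriv (n := 1)).1 h2).2.2
  have hp : Function.Periodic f 1 := periodic_deriv h0.periodic
  -- The particle with label 0 moves with constant velocity `c`. The equation leaves the drift of
  -- `u` free, and this choice matches the initial datum at 0.
  set c := u0 0
  have hD := isDiffeoFamily_flow (lam := lam) hf hp c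
  have hux : ∀ t ∈ timeOf lam f '' dom lam f, ux (eulerVel lam f c) t = eulerGrad lam f c t :=
    fun t ht => funext fun x => (hasDerivAt_eulerVel hf hp c ht x).deriv
  have hper : ∀ t ∈ timeOf lam f '' dom lam f, Function.Periodic (eulerVel lam f c t) 1 := by
    intro t ht x
    rw [eulerVel, hD.inv_add_one ht, eulerVel]
    have h1 := hD.derivV t ht (IsDiffeoFamily.inv (flow lam f c) t x + 1)
    have h2 := (hD.derivV t ht (IsDiffeoFamily.inv (flow lam f c) t x)).add_const (1 : ℝ)
    -- Differentiating g(t, a+1) = g(t, a) + 1 in time shows that the velocity is periodic.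
    refine h1.unique (h2.congr_of_eventuallyEq ?_)
    filter_upwards [hD.isOpen.mem_nhds ht] with s hs using hD.shift s hs _
  refine ⟨eulerVel lam f c, ?_, ?_, ?_, ?_, ?_, ?_⟩
  · have h1 : ContinuousOn (fun z : ℝ × ℝ => (z.1, IsDiffeoFamily.inv (flow lam f c) z.1 z.2))
        ((timeOf lam f '' dom lam f) ×ˢ univ) := continuousOn_fst.prodMk hD.continuousOn_inv
    exact (hD.contV.comp h1 fun z hz => ⟨hz.1, mem_univ _⟩).mono (prod_mono hT le_rfl)
  · exact fun t ht x => (hasDerivAt_eulerVel hf hp c (hT ht) x).differentiableAt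
  · intro z hz
    refine (contDiffAt_eulerGrad hf1 hp c (hT hz.1)).contDiffWithinAt.congr ?_ ?_
    · exact fun y hy => congrFun (hux _ (hT hy.1)) _
    · exact congrFun (hux _ (hT hz.1)) _
  · exact fun t ht => hper t (hT ht)
  · intro x
    have hz : (0 : ℝ) ∈ timeOf lam f '' dom lam f := ⟨0, zero_mem_dom, timeOf_zero⟩
    have hp0 : paramOf lam f 0 = 0 := by
      simpa [timeOf_zero] using paramOf_timeOf hf hp (zero_mem_dom (lam := lam) (f := f))
    have hi : ∀ y, ∫ b in (0 : ℝ)..y, f b = u0 y - u0 0 := fun y =>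
      intervalIntegral.integral_eq_sub_of_hasDerivAt (fun a _ => hasDerivAt_data h0 a)
        (hf.intervalIntegrable _ _)
    have hK1 : kerInt lam f 1 0 = 0 := by
      have h1 := hi 1
      have h2 := h0.periodic 0
      simp only [zero_add] at h2
      simp [kerInt, ker_zero, h1, h2]
    have hj : ∀ a, jac lam f 0 a = 1 := fun a => by simp [jac, ker_zero, kerInt_zero_zero]
    have hg : ∀ a, grad lam f 0 a = f a := fun a => by simp [grad, kerInt_zero_zero, hK1]
    have hfl : flow lam f c 0 = id := funext fun a => by simp [flow, hp0, hj]
    have hinv : IsDiffeoFamily.inv (flow lam f c) 0 x = x := by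
      have := hD.apply_inv hz x
      rwa [hfl] at this
    simp only [eulerVel, hinv, flowVel, hp0, hg, hj, mul_one, hi]
    ring
  · intro t ht hpos x
    have ht := hT ht
    have hs := paramOf_mem ht
    set a := IsDiffeoFamily.inv (flow lam f c) t x with ha
    have hga : flow lam f c t a = x := hD.apply_inv ht x
    have hd := ((contDiffAt_eulerGrad hf1 hp c (z := (t, x)) ht).differentiableAt
      (by simp)).hasFDerivAt
    set D := fderiv ℝ (fun z : ℝ × ℝ => eulerGrad lam f c z.1 z.2) (t, x)
    have h1 : HasDerivAt (fun s => eulerGrad lam f c s x) (D (1, 0)) t :=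
      hd.comp_hasDerivAt t (f := fun s => (s, x)) ((hasDerivAt_id t).prodMk (hasDerivAt_const t _))
    have h2 : HasDerivAt (eulerGrad lam f c t) (D (0, 1)) x :=
      hd.comp_hasDerivAt x (f := fun x => (t, x)) ((hasDerivAt_const _ t).prodMk (hasDerivAt_id _))
    -- The derivative along a characteristic is computed twice: by the chain rule it is u_xt + u
    -- u_xx, by the explicit formula it is λu_x² − (λ+1)E.
    have h3 : HasDerivAt (fun s => eulerGrad lam f c s (flow lam f c s a))
        (D (1, flowVel lam f c t a)) t := by
      rw [← hga] at hd
      have := hd.comp_hasDerivAt t (f := fun s => (s, flow lam f c s a))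
        ((hasDerivAt_id t).prodMk (hD.derivV t ht a))
      exact this
    have h4 : HasDerivAt (fun s => eulerGrad lam f c s (flow lam f c s a))
        (lam * grad lam f (paramOf lam f t) a ^ 2
          - (lam + 1) * energyOf lam f (paramOf lam f t)) t := by
      have := (hasDerivAt_grad hf hp a hs).comp t (hasDerivAt_paramOf hf hp ht)
      refine (this.congr_of_eventuallyEq ?_).congr_deriv ?_
      · filter_upwards [hD.isOpen.mem_nhds ht] with s hs
        simp only [eulerGrad, hD.inv_apply hs, Function.comp]
      · rw [mul_right_comm, ← Real.rpow_add (kerInt_pos hf hs)]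
        simp
    have h5 := h3.unique h4
    have h6 : D (1, flowVel lam f c t a) = D (1, 0) + flowVel lam f c t a * D (0, 1) := by
      rw [← smul_eq_mul, ← map_smul, ← map_add]; simp
    have h7 : deriv (fun s => ux (eulerVel lam f c) s x) t = D (1, 0) := by
      refine (h1.congr_of_eventuallyEq ?_).deriv
      filter_upwards [hD.isOpen.mem_nhds ht] with s hs
      rw [hux s hs]
    have hcg : Continuous (eulerGrad lam f c t) :=
      continuous_iff_continuousAt.2 fun y =>
        (contDiffAt_eulerGrad hf1 hp c (z := (t, y)) ht).continuousAt.comp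
          (f := fun y => (t, y)) (by fun_prop)
    have hpg : Function.Periodic (eulerGrad lam f c t) 1 := by
      rw [← hux t ht]; exact periodic_deriv (hper t ht)
    have h8 : ∫ y in (0 : ℝ)..1, eulerGrad lam f c t y ^ 2 = energyOf lam f (paramOf lam f t) := by
      have h01 := hD.shift t ht 0
      rw [zero_add] at h01
      rw [← integral_comp_mul_jac (hcg.fun_pow 2) (fun y => by simp only [hpg y]) (hD.derivJ t ht)
        (continuous_jac hf hs) h01]
      refine intervalIntegral.integral_congr fun b _ => ?_
      simp only [eulerGrad, hD.inv_apply ht]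
    rw [h7, hux t ht, h2.deriv, h8]
    change _ + flowVel lam f c t a * _ - lam * grad lam f (paramOf lam f t) a ^ 2 = _
    linarith

end
end ProudmanJohnson

/-! ### Leading asymptotics at nondegenerate minima -/

namespace ProudmanJohnson
noncomputable section

/-- A nonnegative function on the line with nondegenerate zeros. -/
structure IsProfile (q : ℝ → ℝ) : Prop where
  cont : Continuous q
  nonneg : ∀ a, 0 ≤ q a
  nondeg : ∀ a, q a = 0 → ∃ κ > 0, Tendsto (fun x => q x / (x - a) ^ 2) (𝓝[≠] a) (𝓝 κ)

/-- The regularization of a profile, positive for positive `e`. -/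
def reg (q : ℝ → ℝ) (e a : ℝ) : ℝ := e + (1 - e) * q a

/-- Integrands `g e z` with `|g e z| ≤ C z ^ r`, converging to `g0` as `e ↓ 0`. -/
structure IsTestFamily (r C : ℝ) (g : ℝ → ℝ → ℝ) (g0 : ℝ → ℝ) : Prop where
  half_lt : 1 / 2 < r
  cont : ∀ᶠ e in 𝓝[>] (0 : ℝ), ContinuousOn (g e) (Ioc 0 1)
  bound : ∀ᶠ e in 𝓝[>] (0 : ℝ), ∀ z ∈ Ioc (0 : ℝ) 1, |g e z| ≤ C * z ^ r
  conv : ∀ z0 ∈ Ioc (0 : ℝ) 1, ∀ z : ℝ → ℝ, (∀ᶠ e in 𝓝[>] (0 : ℝ), z e ∈ Ioc (0 : ℝ) 1) →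
    Tendsto z (𝓝[>] 0) (𝓝 z0) → Tendsto (fun e => g e (z e)) (𝓝[>] 0) (𝓝 (g0 z0))

/-- The interval `[x, y]` contributes the multiple `S` of a universal integral to the leading
asymptotics of integrals of functions of `e / reg q e`. -/
def HasWeight (q : ℝ → ℝ) (x y S : ℝ) : Prop :=
  ∀ r C g g0, IsTestFamily r C g g0 →
    Tendsto (fun e => (√e)⁻¹ * ∫ a in x..y, g e (e / reg q e a)) (𝓝[>] 0)
      (𝓝 (S * ∫ s in Ioi (0 : ℝ), g0 (1 / (1 + s ^ 2))))

variable {q : ℝ → ℝ}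

theorem eventually_mem_Ioo {c : ℝ} (hc : 0 < c) : ∀ᶠ e in 𝓝[>] (0 : ℝ), e ∈ Ioo 0 c :=
  Ioo_mem_nhdsGT hc

theorem IsTestFamily.bound_nonneg {r C : ℝ} {g : ℝ → ℝ → ℝ} {g0 : ℝ → ℝ}
    (hg : IsTestFamily r C g g0) : 0 ≤ C := by
  obtain ⟨e, he⟩ := hg.bound.exists
  simpa using (abs_nonneg _).trans (he 1 (by simp))

namespace IsProfile

theorem le_reg (hq : IsProfile q) {e : ℝ} (he : e ∈ Ioo (0 : ℝ) 1) (a : ℝ) : e ≤ reg q e a := by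
  have := mul_nonneg (sub_nonneg.2 he.2.le) (hq.nonneg a)
  unfold reg; linarith

theorem reg_pos (hq : IsProfile q) {e : ℝ} (he : e ∈ Ioo (0 : ℝ) 1) (a : ℝ) : 0 < reg q e a :=
  he.1.trans_le (hq.le_reg he a)

theorem ratio_mem (hq : IsProfile q) {e : ℝ} (he : e ∈ Ioo (0 : ℝ) 1) (a : ℝ) :
    e / reg q e a ∈ Ioc (0 : ℝ) 1 :=
  ⟨div_pos he.1 (hq.reg_pos he a), (div_le_one (hq.reg_pos he a)).2 (hq.le_reg he a)⟩

theorem continuous_reg (hq : IsProfile q) (e : ℝ) : Continuous (reg q e) := by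
  have := hq.cont; unfold reg; fun_prop

theorem continuous_ratio (hq : IsProfile q) {e : ℝ} (he : e ∈ Ioo (0 : ℝ) 1) :
    Continuous fun a => e / reg q e a :=
  continuous_const.div (hq.continuous_reg e) fun a => (hq.reg_pos he a).ne'

theorem continuous_test (hq : IsProfile q) {e : ℝ} (he : e ∈ Ioo (0 : ℝ) 1) {g : ℝ → ℝ}
    (hg : ContinuousOn g (Ioc 0 1)) : Continuous fun a => g (e / reg q e a) :=
  hg.comp_continuous (hq.continuous_ratio he) (hq.ratio_mem he)

theorem hasWeight_add (hq : IsProfile q) {x y z S S' : ℝ} (h : HasWeight q x y S)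
    (h' : HasWeight q y z S') : HasWeight q x z (S + S') := by
  intro r C g g0 hg
  have := (h r C g g0 hg).add (h' r C g g0 hg)
  rw [← add_mul] at this
  refine this.congr' ?_
  filter_upwards [hg.cont, eventually_mem_Ioo one_pos] with e hc he
  have := hq.continuous_test he hc
  rw [← mul_add, intervalIntegral.integral_add_adjacent_intervals
    (this.intervalIntegrable _ _) (this.intervalIntegrable _ _)]

theorem reg_lower (hq : IsProfile q) {e c a : ℝ} (he : e ∈ Ioo (0 : ℝ) (1 / 2)) (hc : c ≤ q a) :
    e + c / 2 ≤ reg q e a := by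
  unfold reg
  nlinarith [hq.nonneg a, he.1, he.2]

/-- Away from the zeros `e / reg q e` is O(e), so the integral is O(e^r), which is negligible
against √e because r > 1/2. -/
theorem hasWeight_zero_of_pos (hq : IsProfile q) {x y : ℝ} (hxy : x ≤ y)
    (hpos : ∀ a ∈ Icc x y, 0 < q a) : HasWeight q x y 0 := by
  intro r C g g0 hg
  obtain ⟨a0, ha0, hmin⟩ := (isCompact_Icc (a := x) (b := y)).exists_isMinOn
    (nonempty_Icc.2 hxy) hq.cont.continuousOn
  have hc := hpos a0 ha0
  have hC := hg.bound_nonneg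
  rw [zero_mul]
  have hlim : Tendsto (fun e : ℝ => C * (2 / q a0) ^ r * (y - x) * e ^ (r - 1 / 2)) (𝓝[>] 0)
      (𝓝 0) := by
    have h1 : Tendsto (fun e : ℝ => e ^ (r - 1 / 2)) (𝓝[>] 0) (𝓝 0) := by
      have := (Real.continuousAt_rpow_const 0 (r - 1 / 2)
        (Or.inr (sub_nonneg.2 hg.half_lt.le))).tendsto
      rw [Real.zero_rpow (sub_pos.2 hg.half_lt).ne'] at this
      exact this.mono_left nhdsWithin_le_nhds
    simpa using h1.const_mul (C * (2 / q a0) ^ r * (y - x))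
  refine squeeze_zero_norm' ?_ hlim
  filter_upwards [hg.bound, eventually_mem_Ioo (half_pos one_pos)] with e hb he
  have he1 : e ∈ Ioo (0 : ℝ) 1 := ⟨he.1, he.2.trans (by norm_num)⟩
  have h1 : ∀ a ∈ uIoc x y, ‖g e (e / reg q e a)‖ ≤ C * (2 / q a0) ^ r * e ^ r := by
    intro a ha
    rw [uIoc_of_le hxy] at ha
    refine (hb _ (hq.ratio_mem he1 a)).trans ?_
    rw [mul_assoc, ← Real.mul_rpow (by positivity) he.1.le]
    have hr : 0 ≤ r := by linarith [hg.half_lt]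
    refine mul_le_mul_of_nonneg_left (Real.rpow_le_rpow (hq.ratio_mem he1 a).1.le ?_ hr) hC
    have h2 := hq.reg_lower he (hmin (Ioc_subset_Icc_self ha))
    rw [div_le_iff₀ (hq.reg_pos he1 a)]
    calc e = 2 / q a0 * e * (q a0 / 2) := by field_simp
      _ ≤ _ := by
        have := he.1
        gcongr
        linarith
  have h2 := intervalIntegral.norm_integral_le_of_norm_le_const h1
  rw [norm_mul, norm_inv, Real.norm_of_nonneg (Real.sqrt_nonneg e), abs_of_nonneg
    (sub_nonneg.2 hxy)] at *
  rw [Real.rpow_sub he.1, ← Real.sqrt_eq_rpow]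
  have := Real.sqrt_pos.2 he.1
  rw [inv_mul_le_iff₀ this]
  refine h2.trans_eq ?_
  field_simp

theorem integrableOn_kernel {r : ℝ} (hr : 1 / 2 < r) {κ : ℝ} (hκ : 0 < κ) :
    IntegrableOn (fun s : ℝ => (1 + κ * s ^ 2) ^ (-r)) (Ioi 0) := by
  have h := integrable_rpow_neg_one_add_norm_sq (E := ℝ) (μ := volume) (r := 2 * r)
    (by simp; linarith)
  have h2 := (integrableOn_Ioi_comp_mul_left_iff _ 0 (Real.sqrt_pos.2 hκ)).2
    (h.integrableOn (s := Ioi (√κ * 0)))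
  refine h2.congr_fun (fun s _ => ?_) measurableSet_Ioi
  simp only [Real.norm_eq_abs, sq_abs, mul_pow, Real.sq_sqrt hκ.le]
  congr 1
  ring

/-- Substituting a = c + √e s, with q(c + x) ~ κx², makes `e / reg q e` tend to 1/(1 + κs²) and the
upper limit tend to infinity. A last rescaling in s produces the weight κ^(−1/2), independent of the
integrand. -/
theorem exists_hasWeight_right (hq : IsProfile q) {c : ℝ} (hc : q c = 0) :
    ∃ δ > 0, ∀ y ∈ Ioo c (c + δ), ∃ S > 0, HasWeight q c y S := by
  obtain ⟨κ, hκ, hlim⟩ := hq.nondeg c hc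
  have hlim' : Tendsto (fun x => q x / (x - c) ^ 2) (𝓝[>] c) (𝓝 κ) :=
    hlim.mono_left (nhdsWithin_mono _ fun x hx => ne_of_gt hx)
  obtain ⟨y1, hy1, hlow⟩ := (mem_nhdsGT_iff_exists_Ioo_subset).1
    (hlim'.eventually (lt_mem_nhds (half_lt_self hκ)))
  have hlow' : ∀ x ∈ Ioo c y1, κ / 2 * (x - c) ^ 2 ≤ q x := fun x hx => by
    have h1 := hlow hx
    have : 0 < (x - c) ^ 2 := by have := sub_pos.2 hx.1; positivity
    exact ((lt_div_iff₀ this).1 h1).le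
  refine ⟨y1 - c, sub_pos.2 hy1, fun y hy => ⟨(√κ)⁻¹, by positivity, ?_⟩⟩
  rw [add_sub_cancel] at hy
  intro r C g g0 hg
  have hC := hg.bound_nonneg
  have hr := hg.half_lt
  set d := y - c with hd
  have hd0 : 0 < d := sub_pos.2 hy.1
  have hsub : (√κ)⁻¹ * ∫ s in Ioi (0 : ℝ), g0 (1 / (1 + s ^ 2)) =
      ∫ s in Ioi (0 : ℝ), g0 (1 / (1 + κ * s ^ 2)) := by
    have := integral_comp_mul_left_Ioi (fun s => g0 (1 / (1 + s ^ 2))) 0 (Real.sqrt_pos.2 hκ)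
    rw [mul_zero, smul_eq_mul] at this
    rw [← this]
    simp only [mul_pow, Real.sq_sqrt hκ.le]
  rw [hsub]
  set F : ℝ → ℝ → ℝ := fun e s =>
    (Ioc 0 (d / √e)).indicator (fun s => g e (e / reg q e (c + √e * s))) s with hF
  have hrew : ∀ᶠ e in 𝓝[>] (0 : ℝ), ∫ s in Ioi (0 : ℝ), F e s =
      (√e)⁻¹ * ∫ a in c..y, g e (e / reg q e a) := by
    filter_upwards [eventually_mem_Ioo one_pos] with e he
    have hs := Real.sqrt_pos.2 he.1
    rw [setIntegral_indicator measurableSet_Ioc, inter_eq_right.2 Ioc_subset_Ioi_self,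
      ← intervalIntegral.integral_of_le (by positivity), eq_inv_mul_iff_mul_eq₀ hs.ne',
      ← smul_eq_mul, intervalIntegral.smul_integral_comp_add_mul
        (fun a => g e (e / reg q e a)) (√e) c]
    congr 1
    · ring
    · field_simp; simp [hd]
  refine Tendsto.congr' hrew ?_
  -- In the majorant, κ/4 loses one factor 1/2 from q ≥ (κ/2)x² near the zero and another from 1 − e
  -- ≥ 1/2.
  refine tendsto_integral_filter_of_dominated_convergence
    (fun s => C * (1 + κ / 4 * s ^ 2) ^ (-r)) ?_ ?_ ?_ ?_
  · filter_upwards [eventually_mem_Ioo one_pos, hg.cont] with e he hc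
    refine (Continuous.aestronglyMeasurable ?_).indicator measurableSet_Ioc
    exact (hq.continuous_test he hc).comp (by fun_prop)
  · filter_upwards [eventually_mem_Ioo (half_pos one_pos), hg.bound] with e he hb
    have he1 : e ∈ Ioo (0 : ℝ) 1 := ⟨he.1, he.2.trans (by norm_num)⟩
    have hs := Real.sqrt_pos.2 he.1
    refine (ae_restrict_iff' measurableSet_Ioi).2 (Eventually.of_forall fun s hs0 => ?_)
    have hs0 : 0 < s := hs0
    by_cases hmem : s ∈ Ioc 0 (d / √e)
    · simp only [hF, indicator_of_mem hmem]
      refine (hb _ (hq.ratio_mem he1 _)).trans (mul_le_mul_of_nonneg_left ?_ hC)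
      rw [Real.rpow_neg (by positivity), ← Real.inv_rpow (by positivity)]
      refine Real.rpow_le_rpow (hq.ratio_mem he1 _).1.le ?_ (by linarith)
      have hx : c + √e * s ∈ Ioo c y1 := by
        refine ⟨by have := mul_pos hs hs0; linarith, ?_⟩
        have := (le_div_iff₀ hs).1 hmem.2
        have := hy.2
        linarith
      have h1 := hq.reg_lower he (hlow' _ hx)
      rw [add_sub_cancel_left, mul_pow, Real.sq_sqrt he.1.le] at h1
      rw [div_le_iff₀ (hq.reg_pos he1 _), ← div_eq_inv_mul, le_div_iff₀ (by positivity)]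
      linarith
    · simp only [hF, indicator_of_notMem hmem, norm_zero]
      positivity
  · exact (integrableOn_kernel hr (by positivity)).const_mul C
  · refine (ae_restrict_iff' measurableSet_Ioi).2 (Eventually.of_forall fun s hs0 => ?_)
    have hs0 : 0 < s := hs0
    have hsq : Tendsto (fun e : ℝ => √e) (𝓝[>] 0) (𝓝[>] 0) := by
      refine tendsto_nhdsWithin_iff.2 ⟨?_, ?_⟩
      · have := Real.continuous_sqrt.tendsto 0
        rw [Real.sqrt_zero] at this
        exact this.mono_left nhdsWithin_le_nhds
      · filter_upwards [self_mem_nhdsWithin] with e he using Real.sqrt_pos.2 he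
    have hx : Tendsto (fun e : ℝ => c + √e * s) (𝓝[>] 0) (𝓝[>] c) := by
      refine tendsto_nhdsWithin_iff.2 ⟨?_, ?_⟩
      · have := ((hsq.mono_right nhdsWithin_le_nhds).mul_const s).const_add c
        simpa using this
      · filter_upwards [self_mem_nhdsWithin] with e he
        have := mul_pos (Real.sqrt_pos.2 he) hs0
        simp only [mem_Ioi]; linarith
    have hid : Tendsto (fun e : ℝ => e) (𝓝[>] 0) (𝓝 0) := tendsto_id.mono_left nhdsWithin_le_nhds
    have hz : Tendsto (fun e : ℝ => e / reg q e (c + √e * s)) (𝓝[>] 0)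
        (𝓝 (1 / (1 + κ * s ^ 2))) := by
      have h1 : Tendsto (fun e : ℝ => 1 / (1 + (1 - e) *
          (q (c + √e * s) / (c + √e * s - c) ^ 2 * s ^ 2))) (𝓝[>] 0)
          (𝓝 (1 / (1 + (1 - 0) * (κ * s ^ 2)))) := by
        refine tendsto_const_nhds.div (((hid.const_sub 1).mul
          ((hlim'.comp hx).mul_const _)).const_add 1) ?_
        simp only [sub_zero]; positivity
      rw [sub_zero, one_mul] at h1
      refine h1.congr' ?_
      filter_upwards [eventually_mem_Ioo one_pos] with e he
      have := (hq.reg_pos he (c + √e * s)).ne'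
      have he0 := he.1.ne'
      have h2 : q (c + √e * s) / (c + √e * s - c) ^ 2 * s ^ 2 = q (c + √e * s) / e := by
        rw [add_sub_cancel_left, mul_pow, Real.sq_sqrt he.1.le]
        field_simp
      rw [h2]
      rw [reg] at this ⊢
      rw [div_eq_div_iff _ this]
      · field_simp
      · intro h0
        apply this
        field_simp at h0
        linarith
    have hmem : ∀ᶠ e : ℝ in 𝓝[>] 0, s ∈ Ioc 0 (d / √e) := by
      have : Tendsto (fun e : ℝ => √e * s) (𝓝[>] 0) (𝓝 0) := by
        simpa using (hsq.mono_right nhdsWithin_le_nhds).mul_const s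
      filter_upwards [this.eventually (gt_mem_nhds hd0), self_mem_nhdsWithin] with e he he0
      refine ⟨hs0, ?_⟩
      rw [le_div_iff₀ (Real.sqrt_pos.2 he0)]
      linarith
    refine (hg.conv (1 / (1 + κ * s ^ 2)) ⟨by positivity, ?_⟩ _ ?_ hz).congr' ?_
    · rw [div_le_one (by positivity)]
      have : 0 ≤ κ * s ^ 2 := by positivity
      linarith
    · filter_upwards [eventually_mem_Ioo one_pos] with e he using hq.ratio_mem he _
    · filter_upwards [hmem] with e he
      simp only [hF, indicator_of_mem he]

theorem comp_neg (hq : IsProfile q) : IsProfile fun x => q (-x) := by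
  refine ⟨hq.cont.comp continuous_neg, fun a => hq.nonneg _, fun a ha => ?_⟩
  obtain ⟨κ, hκ, h⟩ := hq.nondeg (-a) ha
  refine ⟨κ, hκ, ?_⟩
  have : Tendsto (fun x : ℝ => -x) (𝓝[≠] a) (𝓝[≠] (-a)) := by
    refine tendsto_nhdsWithin_iff.2 ⟨(continuous_neg.tendsto a).mono_left nhdsWithin_le_nhds, ?_⟩
    filter_upwards [self_mem_nhdsWithin] with x hx
    simpa using hx
  refine (h.comp this).congr fun x => ?_
  simp only [Function.comp]
  congr 1; ring

/-- Reflection reduces the left side of a zero to the right side. -/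
theorem hasWeight_of_comp_neg {x y S : ℝ} (h : HasWeight (fun x => q (-x)) (-y) (-x) S) :
    HasWeight q x y S := by
  intro r C g g0 hg
  refine (h r C g g0 hg).congr fun e => ?_
  have := intervalIntegral.integral_comp_neg (a := -y) (b := -x) (fun a => g e (e / reg q e a))
  simp only [neg_neg] at this
  rw [← this]
  rfl

theorem exists_hasWeight_left (hq : IsProfile q) {c : ℝ} (hc : q c = 0) :
    ∃ δ > 0, ∀ x ∈ Ioo (c - δ) c, ∃ S > 0, HasWeight q x c S := by
  obtain ⟨δ, hδ, h⟩ := hq.comp_neg.exists_hasWeight_right (c := -c) (by simpa using hc)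
  refine ⟨δ, hδ, fun x hx => ?_⟩
  obtain ⟨S, hS, hw⟩ := h (-x) ⟨by linarith [hx.2], by linarith [hx.1]⟩
  exact ⟨S, hS, hasWeight_of_comp_neg hw⟩

theorem hasWeight_self (x : ℝ) : HasWeight q x x 0 := by
  intro r C g g0 _
  simp

/-- A nondegenerate zero is isolated, so a short interval near `c` either lies to one side of it
with q positive or splits at `c` into two one-sided pieces. -/
theorem exists_hasWeight_nhds (hq : IsProfile q) (c : ℝ) :
    ∃ δ > 0, ∀ x y, c - δ < x → x ≤ y → y < c + δ → ∃ S ≥ 0, HasWeight q x y S := by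
  by_cases hc : q c = 0
  · obtain ⟨δ1, hδ1, h1⟩ := hq.exists_hasWeight_right hc
    obtain ⟨δ2, hδ2, h2⟩ := hq.exists_hasWeight_left hc
    obtain ⟨κ, hκ, hlim⟩ := hq.nondeg c hc
    have hpos : ∀ᶠ x in 𝓝 c, x ≠ c → 0 < q x := by
      refine eventually_nhdsWithin_iff.1 (?_ : ∀ᶠ x in 𝓝[≠] c, 0 < q x)
      filter_upwards [hlim.eventually (lt_mem_nhds hκ), self_mem_nhdsWithin] with x hx hxc
      refine (hq.nonneg x).lt_of_ne' fun h0 => ?_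
      rw [h0, zero_div] at hx
      exact lt_irrefl _ hx
    obtain ⟨δ3, hδ3, h3⟩ := Metric.eventually_nhds_iff.1 hpos
    refine ⟨min δ1 (min δ2 δ3), by positivity, fun x y hx hxy hy => ?_⟩
    have m1 := min_le_left δ1 (min δ2 δ3)
    have m2 := (min_le_right δ1 (min δ2 δ3)).trans (min_le_left _ _)
    have m3 := (min_le_right δ1 (min δ2 δ3)).trans (min_le_right _ _)
    have hleft : ∀ x, c - min δ1 (min δ2 δ3) < x → x ≤ c → ∃ S ≥ 0, HasWeight q x c S := by
      intro x hx hxc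
      rcases hxc.eq_or_lt with rfl | h
      · exact ⟨0, le_rfl, hasWeight_self _⟩
      · obtain ⟨S, hS, hw⟩ := h2 x ⟨by linarith, h⟩
        exact ⟨S, hS.le, hw⟩
    have hright : ∀ y, y < c + min δ1 (min δ2 δ3) → c ≤ y → ∃ S ≥ 0, HasWeight q c y S := by
      intro y hy hyc
      rcases hyc.eq_or_lt with rfl | h
      · exact ⟨0, le_rfl, hasWeight_self _⟩
      · obtain ⟨S, hS, hw⟩ := h1 y ⟨h, by linarith⟩
        exact ⟨S, hS.le, hw⟩
    by_cases hcm : c ∈ Icc x y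
    · obtain ⟨S, hS, hw⟩ := hleft x hx hcm.1
      obtain ⟨S', hS', hw'⟩ := hright y hy hcm.2
      exact ⟨S + S', by positivity, hq.hasWeight_add hw hw'⟩
    · refine ⟨0, le_rfl, hq.hasWeight_zero_of_pos hxy fun a ha => h3 ?_ ?_⟩
      · rw [Real.dist_eq, abs_lt]
        constructor <;> linarith [ha.1, ha.2]
      · rintro rfl
        exact hcm ha
  · have hpos : ∀ᶠ x in 𝓝 c, 0 < q x :=
      hq.cont.continuousAt.eventually_const_lt ((hq.nonneg c).lt_of_ne' hc)
    obtain ⟨δ, hδ, h⟩ := Metric.eventually_nhds_iff.1 hpos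
    refine ⟨δ, hδ, fun x y hx hxy hy => ⟨0, le_rfl, hq.hasWeight_zero_of_pos hxy fun a ha => h ?_⟩⟩
    rw [Real.dist_eq, abs_lt]
    constructor <;> linarith [ha.1, ha.2]

/-- Compactness subdivides the interval into pieces on which the local statement holds, and weights
add. -/
theorem exists_hasWeight (hq : IsProfile q) {x y : ℝ} (hxy : x ≤ y) :
    ∃ S ≥ 0, HasWeight q x y S := by
  choose δ hδ hw using hq.exists_hasWeight_nhds
  obtain ⟨t, ht0, htm, ⟨m, hm⟩, hcov⟩ := exists_monotone_Icc_subset_open_cover_Icc hxy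
    (c := fun c : ℝ => {z : Icc x y | (z : ℝ) ∈ Metric.ball c (δ c)})
    (fun c => Metric.isOpen_ball.preimage continuous_subtype_val)
    (fun z _ => mem_iUnion.2 ⟨z, by simpa using hδ z⟩)
  have key : ∀ n, ∃ S ≥ 0, HasWeight q x (t n) S := by
    intro n
    induction n with
    | zero => exact ⟨0, le_rfl, by rw [ht0]; exact hasWeight_self _⟩
    | succ n ih =>
      obtain ⟨S, hS, h⟩ := ih
      obtain ⟨c, hc⟩ := hcov n
      have hle := htm (Nat.le_succ n)
      have h1 := hc (left_mem_Icc.2 hle)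
      have h2 := hc (right_mem_Icc.2 hle)
      simp only [mem_ofPred_eq, Metric.mem_ball, Real.dist_eq, abs_lt] at h1 h2
      obtain ⟨S', hS', h'⟩ := hw c (t n) (t (n + 1)) (by linarith [h1.1]) hle (by linarith [h2.2])
      exact ⟨S + S', by positivity, hq.hasWeight_add h h'⟩
  obtain ⟨S, hS, h⟩ := key m
  rw [hm m le_rfl] at h
  exact ⟨S, hS, h⟩

/-- One side of the zero inside `[0, 1]` already contributes a positive weight. At the right
endpoint only the left side is available. -/
theorem exists_hasWeight_pos (hq : IsProfile q) {c : ℝ} (hc : c ∈ Icc (0 : ℝ) 1) (h0 : q c = 0) :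
    ∃ S > 0, HasWeight q 0 1 S := by
  rcases hc.2.eq_or_lt with rfl | h1
  · obtain ⟨δ, hδ, h⟩ := hq.exists_hasWeight_left h0
    obtain ⟨x, hx1, hx2⟩ := exists_between (show max 0 (1 - δ) < 1 by simp [hδ])
    obtain ⟨S, hS, hw⟩ := h x ⟨(le_max_right _ _).trans_lt hx1, hx2⟩
    obtain ⟨S', hS', hw'⟩ := hq.exists_hasWeight (x := 0) (y := x)
      ((le_max_left _ _).trans hx1.le)
    exact ⟨S' + S, by positivity, hq.hasWeight_add hw' hw⟩
  · obtain ⟨δ, hδ, h⟩ := hq.exists_hasWeight_right h0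
    obtain ⟨y, hy1, hy2⟩ := exists_between (show c < min 1 (c + δ) by simp [hδ, h1])
    obtain ⟨S, hS, hw⟩ := h y ⟨hy1, hy2.trans_le (min_le_right _ _)⟩
    obtain ⟨S1, hS1, hw1⟩ := hq.exists_hasWeight hc.1
    obtain ⟨S2, hS2, hw2⟩ := hq.exists_hasWeight (hy2.trans_le (min_le_left _ _)).le
    exact ⟨S1 + S + S2, by positivity, hq.hasWeight_add (hq.hasWeight_add hw1 hw) hw2⟩

end IsProfile

end
end ProudmanJohnson

/-! ### Growth of the power integrals -/

namespace ProudmanJohnson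
noncomputable section

/-- Integrals of powers of the regularized profile. -/
def powInt (q : ℝ → ℝ) (r e : ℝ) : ℝ := ∫ a in (0 : ℝ)..1, reg q e a ^ (-r)

/-- The integral of `(1 + s²)^(-r)` over the half line. -/
def halfInt (r : ℝ) : ℝ := ∫ s in Ioi (0 : ℝ), (1 + s ^ 2) ^ (-r)

theorem integrableOn_halfInt {r : ℝ} (hr : 1 / 2 < r) :
    IntegrableOn (fun s : ℝ => (1 + s ^ 2) ^ (-r)) (Ioi 0) := by
  simpa using IsProfile.integrableOn_kernel hr one_pos

theorem halfInt_pos {r : ℝ} (hr : 1 / 2 < r) : 0 < halfInt r := by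
  unfold halfInt
  rw [setIntegral_pos_iff_support_of_nonneg_ae _ (integrableOn_halfInt hr)]
  · have : Function.support (fun s : ℝ => (1 + s ^ 2) ^ (-r)) ∩ Ioi 0 = Ioi 0 := by
      refine inter_eq_right.2 fun s _ => ?_
      have : 0 < (1 + s ^ 2) ^ (-r) := by positivity
      exact this.ne'
    rw [this]; simp
  · exact Eventually.of_forall fun s => by simp only [Pi.zero_apply]; positivity

/-- Integrate the derivative of s(1+s²)^(−r) over the half line; the boundary terms vanish because r
> 1/2. -/
theorem halfInt_add_one {r : ℝ} (hr : 1 / 2 < r) :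
    halfInt (r + 1) = halfInt r * ((r - 1 / 2) / r) := by
  have hr0 : r ≠ 0 := by linarith
  have h1 := integrableOn_halfInt hr
  have h2 := integrableOn_halfInt (r := r + 1) (by linarith)
  have hd : ∀ s ∈ Ioi (0 : ℝ), HasDerivAt (fun s : ℝ => s * (1 + s ^ 2) ^ (-r))
      ((1 - 2 * r) * (1 + s ^ 2) ^ (-r) + 2 * r * (1 + s ^ 2) ^ (-(r + 1))) s := by
    intro s _
    have hs : 0 < 1 + s ^ 2 := by positivity
    have h3 : HasDerivAt (fun s : ℝ => 1 + s ^ 2) (2 * s) s := by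
      simpa using (hasDerivAt_pow 2 s).const_add 1
    refine ((hasDerivAt_id s).fun_mul (h3.rpow_const (p := -r) (Or.inl hs.ne'))).congr_deriv ?_
    rw [show -(r + 1) = -r - 1 by ring, Real.rpow_sub_one hs.ne']
    simp only [id]
    field_simp
    ring
  have hlim : Tendsto (fun s : ℝ => s * (1 + s ^ 2) ^ (-r)) atTop (𝓝 0) := by
    have h4 : Tendsto (fun s : ℝ => s ^ (-(2 * r - 1))) atTop (𝓝 0) :=
      tendsto_rpow_neg_atTop (by linarith)
    refine squeeze_zero' ?_ ?_ h4
    · filter_upwards [eventually_ge_atTop 0] with s hs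
      positivity
    · filter_upwards [eventually_gt_atTop 0] with s hs
      calc s * (1 + s ^ 2) ^ (-r) ≤ s * (s ^ 2) ^ (-r) := by
            refine mul_le_mul_of_nonneg_left ?_ hs.le
            exact Real.rpow_le_rpow_of_nonpos (by positivity) (by linarith) (by linarith)
        _ = s ^ (-(2 * r - 1)) := by
            rw [← Real.rpow_natCast, ← Real.rpow_mul hs.le]
            nth_rw 1 [← Real.rpow_one s]
            rw [← Real.rpow_add hs]
            congr 1
            push_cast
            ring
  have hcont : ContinuousWithinAt (fun s : ℝ => s * (1 + s ^ 2) ^ (-r)) (Ici 0) 0 := by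
    refine Continuous.continuousWithinAt (continuous_id.mul
      (Continuous.rpow_const (by fun_prop) fun s => Or.inl ?_))
    positivity
  have := integral_Ioi_of_hasDerivAt_of_tendsto hcont hd
    ((h1.const_mul _).add (h2.const_mul _)) hlim
  rw [integral_add (h1.const_mul _) (h2.const_mul _), integral_const_mul, integral_const_mul]
    at this
  change (1 - 2 * r) * halfInt r + 2 * r * halfInt (r + 1) = _ at this
  simp only [zero_mul, sub_zero] at this
  field_simp
  linarith

theorem tendsto_rpow_nhdsGT_zero {σ : ℝ} (hσ : 0 < σ) :
    Tendsto (fun e : ℝ => e ^ σ) (𝓝[>] 0) (𝓝 0) := by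
  have := (Real.continuousAt_rpow_const 0 σ (Or.inr hσ.le)).tendsto
  rw [Real.zero_rpow hσ.ne'] at this
  exact this.mono_left nhdsWithin_le_nhds

theorem tendsto_rpow_neg_nhdsGT_zero {σ : ℝ} (hσ : 0 < σ) :
    Tendsto (fun e : ℝ => e ^ (-σ)) (𝓝[>] 0) atTop := by
  have h : Tendsto (fun e : ℝ => e ^ σ) (𝓝[>] 0) (𝓝[>] 0) := tendsto_nhdsWithin_iff.2
    ⟨tendsto_rpow_nhdsGT_zero hσ, by
      filter_upwards [self_mem_nhdsWithin] with e he using Real.rpow_pos_of_pos he _⟩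
  refine (tendsto_inv_nhdsGT_zero.comp h).congr' ?_
  filter_upwards [self_mem_nhdsWithin] with e he
  rw [Real.rpow_neg (le_of_lt he)]
  rfl

theorem tendsto_rpow_ratio {b : ℝ} {α : ℝ → ℝ} {A : ℝ} (h : Tendsto α (𝓝[>] 0) (𝓝 A))
    (hA : 0 < A) : Tendsto (fun e => α e ^ b) (𝓝[>] 0) (𝓝 (A ^ b)) :=
  h.rpow_const (Or.inl hA.ne')

variable {q : ℝ → ℝ}

namespace IsProfile

theorem exists_reg_le (hq : IsProfile q) :
    ∃ B ≥ 1, ∀ e ∈ Icc (0 : ℝ) 1, ∀ a ∈ Icc (0 : ℝ) 1, reg q e a ≤ B := by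
  obtain ⟨C, hC⟩ := (isCompact_Icc (a := (0 : ℝ)) (b := 1)).exists_bound_of_continuousOn
    hq.cont.continuousOn
  have hC0 : 0 ≤ C := (norm_nonneg _).trans (hC 0 (by simp))
  refine ⟨1 + C, by linarith, fun e he a ha => ?_⟩
  have h1 := (le_abs_self _).trans (hC a ha)
  have h2 := hq.nonneg a
  unfold reg
  nlinarith [mul_nonneg he.1 h2, he.2]

theorem continuous_reg_rpow (hq : IsProfile q) (r : ℝ) {e : ℝ} (he : e ∈ Ioo (0 : ℝ) 1) :
    Continuous fun a => reg q e a ^ r :=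
  (hq.continuous_reg e).rpow_const fun a => Or.inl (hq.reg_pos he a).ne'

theorem powInt_pos (hq : IsProfile q) (r : ℝ) {e : ℝ} (he : e ∈ Ioo (0 : ℝ) 1) :
    0 < powInt q r e :=
  intervalIntegral.intervalIntegral_pos_of_pos
    ((hq.continuous_reg_rpow _ he).intervalIntegrable _ _)
    (fun a => Real.rpow_pos_of_pos (hq.reg_pos he a) _) one_pos

theorem ratio_rpow (hq : IsProfile q) (r : ℝ) {e : ℝ} (he : e ∈ Ioo (0 : ℝ) 1) (a : ℝ) :
    (e / reg q e a) ^ r = e ^ r * reg q e a ^ (-r) := by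
  rw [Real.div_rpow he.1.le (hq.reg_pos he a).le, Real.rpow_neg (hq.reg_pos he a).le]
  rfl

theorem integral_ratio_rpow (hq : IsProfile q) (r : ℝ) {e : ℝ} (he : e ∈ Ioo (0 : ℝ) 1) :
    (√e)⁻¹ * ∫ a in (0 : ℝ)..1, (e / reg q e a) ^ r = e ^ (r - 1 / 2) * powInt q r e := by
  rw [intervalIntegral.integral_congr fun a _ => hq.ratio_rpow r he a,
    intervalIntegral.integral_const_mul, Real.rpow_sub he.1, ← Real.sqrt_eq_rpow, powInt]
  ring

theorem isTestFamily_rpow {r : ℝ} (hr : 1 / 2 < r) :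
    IsTestFamily r 1 (fun _ z => z ^ r) fun z => z ^ r := by
  refine ⟨hr, Eventually.of_forall fun e => ?_, Eventually.of_forall fun e z hz => ?_, ?_⟩
  · exact continuousOn_id.rpow_const fun z hz => Or.inl hz.1.ne'
  · rw [one_mul, abs_of_nonneg (Real.rpow_nonneg hz.1.le _)]
  · exact fun z0 hz0 z _ hlim => hlim.rpow_const (Or.inl hz0.1.ne')

theorem tendsto_powInt {S : ℝ} (hq : IsProfile q) (hS : HasWeight q 0 1 S) {r : ℝ}
    (hr : 1 / 2 < r) :
    Tendsto (fun e => e ^ (r - 1 / 2) * powInt q r e) (𝓝[>] 0) (𝓝 (S * halfInt r)) := by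
  have h := hS r 1 _ _ (isTestFamily_rpow hr)
  have h2 : ∫ s in Ioi (0 : ℝ), (1 / (1 + s ^ 2)) ^ r = halfInt r := by
    refine setIntegral_congr_fun measurableSet_Ioi fun s _ => ?_
    have : (0 : ℝ) ≤ 1 + s ^ 2 := by positivity
    simp only [one_div, Real.inv_rpow this, Real.rpow_neg this]
  rw [h2] at h
  refine h.congr' ?_
  filter_upwards [eventually_mem_Ioo one_pos] with e he using hq.integral_ratio_rpow r he

theorem powInt_le (hq : IsProfile q) {r r' : ℝ} (h : r ≤ r') :
    ∃ C > 0, ∀ e ∈ Ioo (0 : ℝ) 1, powInt q r e ≤ C * powInt q r' e := by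
  obtain ⟨B, hB, hle⟩ := hq.exists_reg_le
  refine ⟨B ^ (r' - r), by positivity, fun e he => ?_⟩
  unfold powInt
  rw [← intervalIntegral.integral_const_mul]
  refine intervalIntegral.integral_mono_on zero_le_one
    ((hq.continuous_reg_rpow _ he).intervalIntegrable _ _)
    (((hq.continuous_reg_rpow _ he).intervalIntegrable _ _).const_mul _) fun a ha => ?_
  have hpos := hq.reg_pos he a
  rw [show -r = (r' - r) + -r' by ring, Real.rpow_add hpos]
  refine mul_le_mul_of_nonneg_right ?_ (Real.rpow_nonneg hpos.le _)
  exact Real.rpow_le_rpow hpos.le (hle e (Ioo_subset_Icc_self he) a ha) (by linarith)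

/-- An upper growth bound without restriction on `r`, which also covers the borderline exponent 1/2:
compare with some r' > 1/2 slightly beyond `r`, whose exact order is known. -/
theorem tendsto_rpow_mul_powInt {S : ℝ} (hq : IsProfile q) (hS : HasWeight q 0 1 S) {r σ : ℝ}
    (hσ : 0 < σ) (hr : r - 1 / 2 < σ) :
    Tendsto (fun e => e ^ σ * powInt q r e) (𝓝[>] 0) (𝓝 0) := by
  obtain ⟨r', h1, h2⟩ := exists_between (show max r (1 / 2) < σ + 1 / 2 from
    max_lt (by linarith) (by linarith))
  obtain ⟨C, hC, hle⟩ := hq.powInt_le ((le_max_left _ _).trans h1.le)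
  have h3 := hq.tendsto_powInt hS ((le_max_right _ _).trans_lt h1)
  have h4 := ((tendsto_rpow_nhdsGT_zero (σ := σ - (r' - 1 / 2)) (by linarith)).mul h3).const_mul C
  rw [zero_mul, mul_zero] at h4
  refine squeeze_zero' ?_ ?_ h4
  · filter_upwards [eventually_mem_Ioo one_pos] with e he
    exact mul_nonneg (Real.rpow_nonneg he.1.le _) (hq.powInt_pos _ he).le
  · filter_upwards [eventually_mem_Ioo one_pos] with e he
    rw [← mul_assoc (e ^ _), ← Real.rpow_add he.1, sub_add_cancel, mul_left_comm]
    exact mul_le_mul_of_nonneg_left (hle e he) (Real.rpow_nonneg he.1.le _)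

theorem tendsto_powInt_atTop_of_half_lt {S : ℝ} (hq : IsProfile q) (hS0 : 0 < S)
    (hS : HasWeight q 0 1 S) {r : ℝ} (hr : 1 / 2 < r) :
    Tendsto (powInt q r) (𝓝[>] 0) atTop := by
  have h := (tendsto_rpow_neg_nhdsGT_zero (σ := r - 1 / 2) (by linarith)).atTop_mul_pos
    (mul_pos hS0 (halfInt_pos hr)) (hq.tendsto_powInt hS hr)
  refine h.congr' ?_
  filter_upwards [self_mem_nhdsWithin] with e he
  have he : 0 < e := he
  rw [← mul_assoc, ← Real.rpow_add he]
  simp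

/-- The ratio `e / reg q e` is at most 1, so the scaled integral of its square root dominates that
of its r-th power for every r > 1/2. The latter has limit `S * halfInt r`, which is arbitrarily
large. -/
theorem tendsto_powInt_half {S : ℝ} (hq : IsProfile q) (hS0 : 0 < S)
    (hS : HasWeight q 0 1 S) : Tendsto (powInt q (1 / 2)) (𝓝[>] 0) atTop := by
  refine tendsto_atTop.2 fun M => ?_
  -- `halfInt r` blows up as `r` decreases to `1 / 2`
  have h3 : 0 < halfInt (3 / 2) := halfInt_pos (by norm_num)
  have hlow : ∀ r ∈ Ioo (1 / 2 : ℝ) 1, halfInt 2 * r / (r - 1 / 2) ≤ halfInt r := by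
    intro r hr
    have h4 := halfInt_add_one hr.1
    have h5 : halfInt 2 ≤ halfInt (r + 1) := by
      refine setIntegral_mono_on (integrableOn_halfInt (by norm_num))
        (integrableOn_halfInt (by linarith [hr.1])) measurableSet_Ioi fun s _ => ?_
      exact Real.rpow_le_rpow_of_exponent_le (by nlinarith [sq_nonneg s]) (by linarith [hr.2])
    have h6 : 0 < r - 1 / 2 := by linarith [hr.1]
    have h7 : 0 < r := by linarith [hr.1]
    rw [h4] at h5
    rw [div_le_iff₀ h6]
    calc halfInt 2 * r ≤ halfInt r * ((r - 1 / 2) / r) * r := by gcongr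
      _ = _ := by field_simp
  have h2 : 0 < halfInt 2 := halfInt_pos (by norm_num)
  obtain ⟨r, hr, hrM⟩ : ∃ r ∈ Ioo (1 / 2 : ℝ) 1, M < S * halfInt r := by
    have hlim : Tendsto (fun δ : ℝ => S * (halfInt 2 * (1 / 2)) * δ⁻¹) (𝓝[>] 0) atTop :=
      tendsto_inv_nhdsGT_zero.const_mul_atTop (by positivity)
    obtain ⟨δ, hδ, hδ2⟩ := ((hlim.eventually_gt_atTop M).and
      (eventually_mem_Ioo (half_pos one_pos))).exists
    have hr : 1 / 2 + δ ∈ Ioo (1 / 2 : ℝ) 1 := ⟨by linarith [hδ2.1], by linarith [hδ2.2]⟩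
    refine ⟨_, hr, hδ.trans_le ?_⟩
    rw [mul_assoc]
    refine mul_le_mul_of_nonneg_left (le_trans ?_ (hlow _ hr)) hS0.le
    have := hδ2.1
    rw [add_sub_cancel_left, le_div_iff₀ this, inv_mul_cancel_right₀ this.ne']
    exact mul_le_mul_of_nonneg_left (by linarith) h2.le
  filter_upwards [(hq.tendsto_powInt hS hr.1).eventually (lt_mem_nhds hrM),
    eventually_mem_Ioo one_pos] with e he he1
  refine he.le.trans ?_
  have hsplit := hq.integral_ratio_rpow (1 / 2) he1
  rw [sub_self, Real.rpow_zero, one_mul] at hsplit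
  rw [← hsplit, ← hq.integral_ratio_rpow r he1]
  have hc := hq.continuous_ratio he1
  have hc' : ∀ r : ℝ, Continuous fun a => (e / reg q e a) ^ r := fun r =>
    hc.rpow_const fun a => Or.inl (hq.ratio_mem he1 a).1.ne'
  refine mul_le_mul_of_nonneg_left ?_ (by positivity)
  refine intervalIntegral.integral_mono_on zero_le_one ((hc' _).intervalIntegrable _ _)
    ((hc' _).intervalIntegrable _ _) fun a _ => ?_
  exact Real.rpow_le_rpow_of_exponent_ge (hq.ratio_mem he1 a).1 (hq.ratio_mem he1 a).2 hr.1.le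

end IsProfile

theorem intervalIntegrable_abs_rpow {s : ℝ} (hs : -1 < s) (x y : ℝ) :
    IntervalIntegrable (fun x : ℝ => |x| ^ s) volume x y := by
  have h0 : ∀ c : ℝ, 0 ≤ c → IntervalIntegrable (fun x : ℝ => |x| ^ s) volume 0 c := by
    intro c hc
    refine (intervalIntegral.intervalIntegrable_rpow' (a := 0) (b := c) hs).congr fun x hx => ?_
    rw [uIoc_of_le hc] at hx
    simp only [abs_of_pos hx.1]
  have h1 : ∀ c : ℝ, IntervalIntegrable (fun x : ℝ => |x| ^ s) volume 0 c := by
    intro c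
    rcases le_total 0 c with hc | hc
    · exact h0 c hc
    · rw [IntervalIntegrable.iff_comp_neg, neg_zero]
      simpa using h0 (-c) (by linarith)
  exact (h1 x).symm.trans (h1 y)

namespace IsProfile

/-- Near a zero q is at least a multiple of (x − c)², and |x − c|^(−2r) is integrable because 2r <
1. -/
theorem integrableOn_rpow_neg (hq : IsProfile q) {r : ℝ} (hr0 : 0 < r) (hr : r < 1 / 2) :
    IntegrableOn (fun a => q a ^ (-r)) (Icc 0 1) := by
  have hmeas : Measurable fun a => q a ^ (-r) := hq.cont.measurable.pow_const _
  refine LocallyIntegrableOn.integrableOn_isCompact (fun c _ => ?_) isCompact_Icc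
  suffices h : IntegrableAtFilter (fun a => q a ^ (-r)) (𝓝 c) volume from
    h.filter_mono nhdsWithin_le_nhds
  by_cases hc : q c = 0
  · obtain ⟨κ, hκ, hlim⟩ := hq.nondeg c hc
    have hlow : ∀ᶠ x in 𝓝 c, x ∈ ({c}ᶜ : Set ℝ) → κ / 2 * (x - c) ^ 2 ≤ q x := by
      refine eventually_nhdsWithin_iff.1 ?_
      filter_upwards [hlim.eventually (lt_mem_nhds (half_lt_self hκ)), self_mem_nhdsWithin]
        with x hx hxc
      have : 0 < (x - c) ^ 2 := by have := sub_ne_zero.2 hxc; positivity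
      exact ((lt_div_iff₀ this).1 hx).le
    obtain ⟨δ, hδ, hball⟩ := Metric.eventually_nhds_iff_ball.1 hlow
    refine ⟨Metric.ball c δ, Metric.ball_mem_nhds c hδ, ?_⟩
    have hint : IntegrableOn (fun x => (κ / 2) ^ (-r) * |x - c| ^ (-(2 * r)))
        (Metric.ball c δ) := by
      have h1 := ((intervalIntegrable_abs_rpow (s := -(2 * r)) (by linarith) (-δ) δ).comp_sub_right
        c).const_mul ((κ / 2) ^ (-r))
      rw [intervalIntegrable_iff_integrableOn_Ioc_of_le (by linarith)] at h1
      refine h1.mono_set fun x hx => ?_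
      rw [Real.ball_eq_Ioo] at hx
      exact ⟨by linarith [hx.1], by linarith [hx.2]⟩
    refine Integrable.mono' hint hmeas.aestronglyMeasurable ?_
    have hne : ∀ᵐ x ∂(volume.restrict (Metric.ball c δ)), x ≠ c :=
      ae_restrict_of_ae (Measure.ae_ne volume c)
    filter_upwards [hne, ae_restrict_mem Metric.isOpen_ball.measurableSet] with x hx hxb
    have h2 := hball x hxb hx
    have h3 : 0 < |x - c| := abs_pos.2 (sub_ne_zero.2 hx)
    have h4 : 0 < κ / 2 * (x - c) ^ 2 := by rw [← sq_abs]; positivity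
    rw [Real.norm_of_nonneg (Real.rpow_nonneg (hq.nonneg x) _)]
    calc q x ^ (-r) ≤ (κ / 2 * (x - c) ^ 2) ^ (-r) :=
          Real.rpow_le_rpow_of_nonpos h4 h2 (by linarith)
      _ = _ := by
          rw [← sq_abs, Real.mul_rpow (by positivity) (by positivity), ← Real.rpow_natCast,
            ← Real.rpow_mul h3.le]
          congr 2
          push_cast; ring
  · have hcont : ContinuousAt (fun a => q a ^ (-r)) c := hq.cont.continuousAt.rpow_const (Or.inl hc)
    exact (volume.finiteAt_nhds c).integrableAtFilter_of_tendsto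
      hmeas.stronglyMeasurable.stronglyMeasurableAtFilter hcont

/-- Dominated convergence for functions of the regularized profile. -/
theorem tendsto_integral_reg (hq : IsProfile q)
    (hfin : {a ∈ Icc (0 : ℝ) 1 | q a = 0}.Finite) {r C : ℝ} (hr0 : 0 < r) (hr : r < 1 / 2)
    {G : ℝ → ℝ → ℝ} {G0 : ℝ → ℝ} {B : ℝ} (hC : 0 ≤ C)
    (hB : ∀ e ∈ Icc (0 : ℝ) 1, ∀ a ∈ Icc (0 : ℝ) 1, reg q e a ≤ B)
    (hcont : ∀ᶠ e in 𝓝[>] (0 : ℝ), ContinuousOn (G e) (Ioi 0))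
    (hbound : ∀ᶠ e in 𝓝[>] (0 : ℝ), ∀ z ∈ Ioc 0 B, |G e z| ≤ C * (1 + z ^ (-r)))
    (hconv : ∀ z0 > 0, ∀ z : ℝ → ℝ, Tendsto z (𝓝[>] 0) (𝓝 z0) →
      Tendsto (fun e => G e (z e)) (𝓝[>] 0) (𝓝 (G0 z0))) :
    Tendsto (fun e => ∫ a in (0 : ℝ)..1, G e (reg q e a)) (𝓝[>] 0)
      (𝓝 (∫ a in (0 : ℝ)..1, G0 (q a))) := by
  have hint := hq.integrableOn_rpow_neg hr0 hr
  have hpos : ∀ᵐ a, a ∈ uIoc (0 : ℝ) 1 → 0 < q a := by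
    filter_upwards [measure_eq_zero_iff_ae_notMem.1 (hfin.measure_zero volume)] with a ha ha'
    rw [uIoc_of_le zero_le_one] at ha'
    exact (hq.nonneg a).lt_of_ne' fun h0 => ha ⟨Ioc_subset_Icc_self ha', h0⟩
  refine intervalIntegral.tendsto_integral_filter_of_dominated_convergence
    (fun a => C * (1 + (1 / 2) ^ (-r) * q a ^ (-r))) ?_ ?_ ?_ ?_
  · filter_upwards [hcont, eventually_mem_Ioo one_pos] with e hc he
    exact (hc.comp_continuous (hq.continuous_reg e) (hq.reg_pos he)).aestronglyMeasurable
  · filter_upwards [hbound, eventually_mem_Ioo (half_pos one_pos)] with e hb he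
    have he1 : e ∈ Ioo (0 : ℝ) 1 := ⟨he.1, he.2.trans (by norm_num)⟩
    filter_upwards [hpos] with a ha ha'
    have h1 := ha ha'
    rw [uIoc_of_le zero_le_one] at ha'
    refine (hb _ ⟨hq.reg_pos he1 a, hB e (Ioo_subset_Icc_self he1) a
      (Ioc_subset_Icc_self ha')⟩).trans ?_
    have h2 := hq.reg_lower he le_rfl (a := a)
    rw [← Real.mul_rpow (by norm_num) h1.le]
    have h3 : reg q e a ^ (-r) ≤ (1 / 2 * q a) ^ (-r) :=
      Real.rpow_le_rpow_of_nonpos (by positivity) (by linarith [he.1]) (by linarith)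
    gcongr
  · rw [intervalIntegrable_iff_integrableOn_Icc_of_le zero_le_one]
    exact ((integrableOn_const (by simp)).add (hint.const_mul _)).const_mul _
  · filter_upwards [hpos] with a ha ha'
    refine hconv (q a) (ha ha') _ ?_
    have hid : Tendsto (fun e : ℝ => e) (𝓝[>] 0) (𝓝 0) := tendsto_id.mono_left nhdsWithin_le_nhds
    have := hid.add ((hid.const_sub 1).mul_const (q a))
    simpa [reg] using this

theorem tendsto_powInt_of_lt_half (hq : IsProfile q)
    (hfin : {a ∈ Icc (0 : ℝ) 1 | q a = 0}.Finite) {r : ℝ} (hr : r < 1 / 2) :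
    ∃ A > 0, Tendsto (powInt q r) (𝓝[>] 0) (𝓝 A) := by
  obtain ⟨B, hB1, hB⟩ := hq.exists_reg_le
  -- Since `r` may be negative, domination uses a positive exponent between it and 1/2; the surplus
  -- power is bounded because `reg` is.
  obtain ⟨r', h1, h2⟩ := exists_between (show max r 0 < 1 / 2 from max_lt hr (by norm_num))
  have hr' : 0 < r' := (le_max_right _ _).trans_lt h1
  have hrr' : r ≤ r' := (le_max_left _ _).trans h1.le
  have hlim := hq.tendsto_integral_reg hfin (G := fun _ z => z ^ (-r)) (G0 := fun z => z ^ (-r))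
    hr' h2 (C := B ^ (r' - r)) (by positivity) hB
    (Eventually.of_forall fun e => continuousOn_id.rpow_const fun z hz => Or.inl (ne_of_gt hz))
    (Eventually.of_forall fun e z hz => ?_)
    fun z0 hz0 z hz => hz.rpow_const (Or.inl (ne_of_gt hz0))
  · refine ⟨_, ?_, hlim⟩
    have hint := (intervalIntegrable_iff_integrableOn_Icc_of_le zero_le_one).2
      (hq.integrableOn_rpow_neg hr' h2)
    have hmeas : Measurable fun a => q a ^ (-r) := hq.cont.measurable.pow_const _
    have hpos : ∀ᵐ a ∂volume.restrict (Ioc (0 : ℝ) 1), 0 < q a := by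
      rw [ae_restrict_iff' measurableSet_Ioc]
      filter_upwards [measure_eq_zero_iff_ae_notMem.1 (hfin.measure_zero volume)] with a ha ha'
      exact (hq.nonneg a).lt_of_ne' fun h0 => ha ⟨Ioc_subset_Icc_self ha', h0⟩
    rw [intervalIntegral.integral_of_le zero_le_one]
    have hi : IntegrableOn (fun a => q a ^ (-r)) (Ioc 0 1) := by
      rw [intervalIntegrable_iff_integrableOn_Ioc_of_le zero_le_one] at hint
      refine Integrable.mono' (hint.const_mul (B ^ (r' - r))) hmeas.aestronglyMeasurable ?_
      filter_upwards [hpos, ae_restrict_mem measurableSet_Ioc] with a ha ha'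
      rw [Real.norm_of_nonneg (Real.rpow_nonneg ha.le _), show -r = (r' - r) + -r' by ring,
        Real.rpow_add ha]
      refine mul_le_mul_of_nonneg_right ?_ (Real.rpow_nonneg ha.le _)
      refine Real.rpow_le_rpow ha.le ?_ (by linarith)
      have := hB 0 (by simp) a (Ioc_subset_Icc_self ha')
      simpa [reg] using this
    refine (integral_pos_iff_support_of_nonneg_ae ?_ hi).2 ?_
    · filter_upwards [hpos] with a ha
      exact Real.rpow_nonneg ha.le _
    · have : (Function.support fun a => q a ^ (-r)) =ᵐ[volume.restrict (Ioc (0 : ℝ) 1)] univ := by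
        refine eventuallyEq_univ.2 ?_
        filter_upwards [hpos] with a ha
        exact (Real.rpow_pos_of_pos ha _).ne'
      rw [measure_congr this]
      simp
  · rw [abs_of_nonneg (Real.rpow_nonneg hz.1.le _), show -r = (r' - r) + -r' by ring,
      Real.rpow_add hz.1]
    have h3 : z ^ (r' - r) ≤ B ^ (r' - r) := Real.rpow_le_rpow hz.1.le hz.2 (by linarith)
    have h4 : 0 ≤ z ^ (-r') := Real.rpow_nonneg hz.1.le _
    have h5 : 0 ≤ B ^ (r' - r) := by positivity
    have h6 : (0 : ℝ) ≤ z ^ (-r') := h4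
    calc z ^ (r' - r) * z ^ (-r') ≤ B ^ (r' - r) * z ^ (-r') := by gcongr
      _ ≤ _ := by gcongr; linarith

end IsProfile

end
end ProudmanJohnson

/-! ### Moments of the regularized profile -/

namespace ProudmanJohnson
noncomputable section

/-- A profile with finitely many zeros in the period and with positive weight. -/
structure IsWeighted (q : ℝ → ℝ) (S : ℝ) : Prop extends IsProfile q where
  finite : {a ∈ Icc (0 : ℝ) 1 | q a = 0}.Finite
  pos : 0 < S
  weight : HasWeight q 0 1 S

/-- The mean of `1 / reg` with respect to the weight `reg ^ (-b)`. -/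
def mean (q : ℝ → ℝ) (b e : ℝ) : ℝ := powInt q (b + 1) e / powInt q b e

/-- Central moments of `1 / reg`, not normalized. -/
def devInt (q : ℝ → ℝ) (b p e : ℝ) : ℝ :=
  ∫ a in (0 : ℝ)..1, |(reg q e a)⁻¹ - mean q b e| ^ p * reg q e a ^ (-b)

/-- The `p`-th power of the `L^p` norm of the velocity gradient, up to a bounded factor. -/
def devMoment (lam : ℝ) (q : ℝ → ℝ) (p e : ℝ) : ℝ :=
  powInt q (1 / lam) e ^ (-(2 * lam * p + 1)) * devInt q (1 / lam) p e

/-- The third moment of the velocity gradient, up to a bounded factor. -/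
def cubeMoment (lam : ℝ) (q : ℝ → ℝ) (e : ℝ) : ℝ :=
  powInt q (1 / lam) e ^ (-(6 * lam)) *
    (powInt q (1 / lam + 3) e / powInt q (1 / lam) e
      - 3 * (powInt q (1 / lam + 2) e / powInt q (1 / lam) e) *
        (powInt q (1 / lam + 1) e / powInt q (1 / lam) e)
      + 2 * (powInt q (1 / lam + 1) e / powInt q (1 / lam) e) ^ 3)

variable {q : ℝ → ℝ} {S lam p b : ℝ}

theorem add_rpow_le_mul {x y : ℝ} (hx : 0 ≤ x) (hy : 0 ≤ y) (hp : 1 ≤ p) :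
    (x + y) ^ p ≤ 2 ^ (p - 1) * (x ^ p + y ^ p) := by
  lift x to NNReal using hx
  lift y to NNReal using hy
  exact_mod_cast NNReal.rpow_add_le_mul_rpow_add_rpow x y hp

namespace IsWeighted

theorem ratio_tendsto (h : IsWeighted q S) (hb : 1 / 2 < b) {k : ℝ} (hk : 0 ≤ k) :
    Tendsto (fun e => e ^ k * (powInt q (b + k) e / powInt q b e)) (𝓝[>] 0)
      (𝓝 (halfInt (b + k) / halfInt b)) := by
  have h1 := h.tendsto_powInt h.weight (r := b + k) (by linarith)
  have h2 := h.tendsto_powInt h.weight hb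
  have h0 := halfInt_pos hb
  have := h1.div h2 (mul_pos h.pos h0).ne'
  rw [mul_div_mul_left _ _ h.pos.ne'] at this
  refine this.congr' ?_
  filter_upwards [eventually_mem_Ioo one_pos] with e he
  have h3 := Real.rpow_pos_of_pos he.1 (b - 1 / 2)
  rw [Pi.div_apply, show b + k - 1 / 2 = k + (b - 1 / 2) by ring, Real.rpow_add he.1,
    mul_comm (e ^ k), mul_assoc, mul_div_mul_left _ _ h3.ne', mul_div_assoc]

theorem halfInt_ratio_one (hb : 1 / 2 < b) : halfInt (b + 1) / halfInt b = (b - 1 / 2) / b := by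
  have := (halfInt_pos hb).ne'
  rw [halfInt_add_one hb]; field_simp

theorem powInt_rpow_eq (h : IsWeighted q S) (r κ : ℝ) {e : ℝ} (he : e ∈ Ioo (0 : ℝ) 1) :
    powInt q r e ^ κ = e ^ (-(r - 1 / 2) * κ) * (e ^ (r - 1 / 2) * powInt q r e) ^ κ := by
  have h1 := Real.rpow_nonneg he.1.le (r - 1 / 2)
  rw [Real.mul_rpow h1 (h.powInt_pos r he).le, ← mul_assoc, ← Real.rpow_mul he.1.le,
    ← Real.rpow_add he.1]
  rw [show -(r - 1 / 2) * κ + (r - 1 / 2) * κ = 0 by ring, Real.rpow_zero, one_mul]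

theorem mean_mul_tendsto (h : IsWeighted q S) (hb : 1 / 2 < b) :
    Tendsto (fun e => e * mean q b e) (𝓝[>] 0) (𝓝 ((b - 1 / 2) / b)) := by
  have := h.ratio_tendsto hb zero_le_one
  rw [halfInt_ratio_one hb] at this
  simpa [mean] using this

/-- The integrand depends on `e` through the mean. Since e times the mean tends to (b − 1/2)/b in
(0, 1), eventually both terms of the difference lie in [0, 1] and the bound with constant 1 holds.
-/
theorem isTestFamily_dev (h : IsWeighted q S) (hb : 1 / 2 < b) (hp : 0 < p) :
    IsTestFamily b 1 (fun e z => |z - e * mean q b e| ^ p * z ^ b)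
      fun z => |z - (b - 1 / 2) / b| ^ p * z ^ b := by
  have hb0 : 0 < b := by linarith
  have hm := h.mean_mul_tendsto hb
  have h1 : (b - 1 / 2) / b < 1 := by rw [div_lt_one hb0]; linarith
  have h2 : 0 < (b - 1 / 2) / b := div_pos (by linarith) hb0
  refine ⟨hb, Eventually.of_forall fun e => ?_, ?_, fun z0 hz0 z _ hz => ?_⟩
  · refine ContinuousOn.mul ?_ (continuousOn_id.rpow_const fun z hz => Or.inl hz.1.ne')
    exact ContinuousOn.rpow_const (by fun_prop) fun z _ => Or.inr hp.le
  · filter_upwards [hm.eventually (gt_mem_nhds h1), hm.eventually (lt_mem_nhds h2)]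
      with e he1 he2 z hz
    have hzb := Real.rpow_nonneg hz.1.le b
    rw [abs_mul, abs_of_nonneg (Real.rpow_nonneg (abs_nonneg _) p), abs_of_nonneg hzb]
    refine mul_le_mul_of_nonneg_right (Real.rpow_le_one (abs_nonneg _) ?_ hp.le) hzb
    rw [abs_le]
    constructor <;> linarith [hz.1, hz.2]
  · exact (((hz.sub hm).abs).rpow_const (Or.inr hp.le)).mul (hz.rpow_const (Or.inl hz0.1.ne'))

theorem devIntegral_pos (hb : 1 / 2 < b) (hp : 0 < p) :
    0 < ∫ s in Ioi (0 : ℝ), |1 / (1 + s ^ 2) - (b - 1 / 2) / b| ^ p * (1 / (1 + s ^ 2)) ^ b := by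
  have hb0 : 0 < b := by linarith
  have h1 : (b - 1 / 2) / b < 1 := by rw [div_lt_one hb0]; linarith
  have h2 : 0 < (b - 1 / 2) / b := div_pos (by linarith) hb0
  set m := (b - 1 / 2) / b
  have hz : ∀ s : ℝ, 0 < 1 / (1 + s ^ 2) := fun s => by positivity
  have hz1 : ∀ s : ℝ, 1 / (1 + s ^ 2) ≤ 1 := fun s => by
    rw [div_le_one (by positivity)]; nlinarith [sq_nonneg s]
  have hzc : Continuous fun s : ℝ => 1 / (1 + s ^ 2) :=
    continuous_const.div (by fun_prop) fun s => by positivity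
  have hcont : Continuous fun s : ℝ => |1 / (1 + s ^ 2) - m| ^ p * (1 / (1 + s ^ 2)) ^ b :=
    ((hzc.sub continuous_const).abs.rpow_const fun s => Or.inr hp.le).mul
      (hzc.rpow_const fun s => Or.inl (hz s).ne')
  have hnn : ∀ s : ℝ, 0 ≤ |1 / (1 + s ^ 2) - m| ^ p * (1 / (1 + s ^ 2)) ^ b := fun s =>
    mul_nonneg (Real.rpow_nonneg (abs_nonneg _) _) (Real.rpow_nonneg (hz s).le _)
  have hint : IntegrableOn (fun s : ℝ => |1 / (1 + s ^ 2) - m| ^ p * (1 / (1 + s ^ 2)) ^ b)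
      (Ioi 0) := by
    refine Integrable.mono' (integrableOn_halfInt hb) hcont.aestronglyMeasurable
      (Eventually.of_forall fun s => ?_)
    rw [Real.norm_of_nonneg (hnn s)]
    have h3 : (1 / (1 + s ^ 2)) ^ b = (1 + s ^ 2) ^ (-b) := by
      have : (0 : ℝ) ≤ 1 + s ^ 2 := by positivity
      rw [one_div, Real.inv_rpow this, Real.rpow_neg this]
    rw [h3]
    refine mul_le_of_le_one_left (by positivity) (Real.rpow_le_one (abs_nonneg _) ?_ hp.le)
    rw [abs_le]
    constructor <;> linarith [hz s, hz1 s]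
  rw [setIntegral_pos_iff_support_of_nonneg_ae (Eventually.of_forall hnn) hint]
  -- the integrand is positive near `0`
  have hev : ∀ᶠ s : ℝ in 𝓝 0, m < 1 / (1 + s ^ 2) := by
    apply hzc.continuousAt.eventually_const_lt
    simpa using h1
  obtain ⟨δ, hδ, hball⟩ := Metric.eventually_nhds_iff_ball.1 hev
  have hsub : Ioo 0 δ ⊆ Function.support
      (fun s : ℝ => |1 / (1 + s ^ 2) - m| ^ p * (1 / (1 + s ^ 2)) ^ b) ∩ Ioi 0 := by
    intro s hs
    have h4 := hball s (by rw [Real.ball_eq_Ioo]; constructor <;> linarith [hs.1, hs.2])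
    have h5 : 0 < |1 / (1 + s ^ 2) - m| := abs_pos.2 (sub_pos.2 h4).ne'
    exact ⟨(mul_pos (Real.rpow_pos_of_pos h5 _) (Real.rpow_pos_of_pos (hz s) _)).ne', hs.1⟩
  refine lt_of_lt_of_le ?_ (measure_mono hsub)
  simp [hδ]

theorem devInt_eq (h : IsWeighted q S) (b p : ℝ) {e : ℝ} (he : e ∈ Ioo (0 : ℝ) 1) :
    devInt q b p e = e ^ (-(p + b)) *
      ∫ a in (0 : ℝ)..1, |e / reg q e a - e * mean q b e| ^ p * (e / reg q e a) ^ b := by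
  unfold devInt
  rw [← intervalIntegral.integral_const_mul]
  refine intervalIntegral.integral_congr fun a _ => ?_
  rw [h.ratio_rpow b he, div_eq_mul_inv, ← mul_sub, abs_mul, abs_of_pos he.1,
    Real.mul_rpow he.1.le (abs_nonneg _), neg_add, Real.rpow_add he.1, Real.rpow_neg he.1.le p,
    Real.rpow_neg he.1.le b]
  have h1 := (Real.rpow_pos_of_pos he.1 p).ne'
  have h2 := (Real.rpow_pos_of_pos he.1 b).ne'
  field_simp

/-- Exact order of the `L^p` norms for `0 < lam < 2`. -/
theorem exists_tendsto_devMoment (h : IsWeighted q S) (hl : 0 < lam) (hl2 : lam < 2)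
    (hp : 0 < p) :
    ∃ A > 0, Tendsto (fun e => e ^ (-(p * (1 - lam))) * devMoment lam q p e) (𝓝[>] 0) (𝓝 A) := by
  set b := 1 / lam with hbdef
  have hb : 1 / 2 < b := by rw [hbdef]; exact one_div_lt_one_div_of_lt hl hl2
  have hlb : lam * b = 1 := by rw [hbdef]; field_simp
  have h1 := h.weight b 1 _ _ (h.isTestFamily_dev hb hp)
  have h2 := tendsto_rpow_ratio (b := -(2 * lam * p + 1)) (h.tendsto_powInt h.weight hb)
    (mul_pos h.pos (halfInt_pos hb))
  refine ⟨_, ?_, (h2.mul h1).congr' ?_⟩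
  · have := halfInt_pos hb
    have := devIntegral_pos hb hp
    have := h.pos
    positivity
  · filter_upwards [eventually_mem_Ioo one_pos] with e he
    rw [devMoment, ← hbdef, h.powInt_rpow_eq b _ he, h.devInt_eq b p he, Real.sqrt_eq_rpow,
      ← Real.rpow_neg he.1.le]
    set X := (e ^ (b - 1 / 2) * powInt q b e) ^ (-(2 * lam * p + 1))
    set Y := ∫ a in (0 : ℝ)..1, |e / reg q e a - e * mean q b e| ^ p * (e / reg q e a) ^ b
    -- The exponents add up to −1/2 because λb = 1; this is the factor 1/√e in `HasWeight`.
    have h3 : e ^ (-(p * (1 - lam))) * e ^ (-(b - 1 / 2) * -(2 * lam * p + 1)) * e ^ (-(p + b)) =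
        e ^ (-(1 / 2) : ℝ) := by
      rw [← Real.rpow_add he.1, ← Real.rpow_add he.1]
      congr 1
      linear_combination 2 * p * hlb
    rw [← h3]
    ring

/-- Exact order of the third moment for `1 < lam < 2`. -/
theorem tendsto_cubeMoment_of_lt_two (h : IsWeighted q S) (hl : 1 < lam) (hl2 : lam < 2) :
    Tendsto (cubeMoment lam q) (𝓝[>] 0) atTop := by
  have hl0 : 0 < lam := by linarith
  set b := 1 / lam with hbdef
  have hb : 1 / 2 < b := by rw [hbdef]; exact one_div_lt_one_div_of_lt hl0 hl2
  have hb1 : b < 1 := by rw [hbdef, div_lt_one hl0]; exact hl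
  have hb0 : 0 < b := by linarith
  have hlb : lam * b = 1 := by rw [hbdef]; field_simp
  have h1 := h.ratio_tendsto hb zero_le_one
  have h2 := h.ratio_tendsto hb zero_le_two
  have h3 := h.ratio_tendsto hb zero_le_three
  have e1 : halfInt (b + 1) / halfInt b = (b - 1 / 2) / b := halfInt_ratio_one hb
  have e2 : halfInt (b + 2) / halfInt b = (b - 1 / 2) / b * ((b + 1 / 2) / (b + 1)) := by
    have := (halfInt_pos hb).ne'
    rw [show b + 2 = b + 1 + 1 by ring, halfInt_add_one (by linarith), halfInt_add_one hb]
    field_simp; ring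
  have e3 : halfInt (b + 3) / halfInt b =
      (b - 1 / 2) / b * ((b + 1 / 2) / (b + 1)) * ((b + 3 / 2) / (b + 2)) := by
    have := (halfInt_pos hb).ne'
    rw [show b + 3 = b + 1 + 1 + 1 by ring, halfInt_add_one (by linarith),
      halfInt_add_one (by linarith), halfInt_add_one hb]
    field_simp; ring
  rw [e1] at h1
  rw [e2] at h2
  rw [e3] at h3
  have hbr := (h3.sub ((h2.const_mul 3).mul h1)).add ((h1.pow 3).const_mul 2)
  -- The limiting third central moment in closed form; it is positive because 1/2 < b < 1, that is 1
  -- < λ < 2.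
  have hval : (b - 1 / 2) / b * ((b + 1 / 2) / (b + 1)) * ((b + 3 / 2) / (b + 2)) -
      3 * ((b - 1 / 2) / b * ((b + 1 / 2) / (b + 1))) * ((b - 1 / 2) / b) +
      2 * ((b - 1 / 2) / b) ^ 3 = (b - 1 / 2) * (1 - b) / (b ^ 3 * (b + 1) * (b + 2)) := by
    field_simp; ring
  rw [hval] at hbr
  have hα := tendsto_rpow_ratio (b := -(6 * lam)) (h.tendsto_powInt h.weight hb)
    (mul_pos h.pos (halfInt_pos hb))
  have hprod := hα.mul hbr
  have hposlim : 0 < (S * halfInt b) ^ (-(6 * lam)) *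
      ((b - 1 / 2) * (1 - b) / (b ^ 3 * (b + 1) * (b + 2))) := by
    have := halfInt_pos hb
    have := h.pos
    have : 0 < b - 1 / 2 := by linarith
    have : 0 < 1 - b := by linarith
    positivity
  have hfin := (tendsto_rpow_neg_nhdsGT_zero (σ := 3 * (lam - 1)) (by linarith)).atTop_mul_pos
    hposlim hprod
  refine hfin.congr' ?_
  filter_upwards [eventually_mem_Ioo one_pos] with e he
  rw [cubeMoment, ← hbdef, h.powInt_rpow_eq b _ he]
  simp only [Real.rpow_one]
  have e2' : e ^ (2 : ℝ) = e ^ 2 := Real.rpow_ofNat e 2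
  have e3' : e ^ (3 : ℝ) = e ^ 3 := Real.rpow_ofNat e 3
  rw [e2', e3']
  have h4 : e ^ (-(b - 1 / 2) * -(6 * lam)) = e ^ (-(3 * (lam - 1))) * e ^ 3 := by
    rw [← e3', ← Real.rpow_add he.1]
    congr 1
    linear_combination 6 * hlb
  rw [h4]
  ring

/-- Lower-order integrals do not compensate the divergence of those of higher order. -/
theorem tendsto_rpow_mul_powInt_atTop (h : IsWeighted q S) (hb : b ≤ 1 / 2) {r κ : ℝ}
    (hr : 1 / 2 < r) (hκ : 0 < κ) :
    Tendsto (fun e => powInt q b e ^ (-κ) * powInt q r e) (𝓝[>] 0) atTop := by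
  -- With this choice the power κ of e^(−σ) costs only half of the order r − 1/2 with which `powInt
  -- q r` diverges.
  set σ := (r - 1 / 2) / (2 * κ) with hσdef
  have hσ : 0 < σ := div_pos (by linarith) (by linarith)
  have h1 := h.tendsto_rpow_mul_powInt h.weight (r := b) hσ (by linarith)
  have h2 : Tendsto (fun e => (e ^ σ * powInt q b e) ^ (-κ)) (𝓝[>] 0) atTop := by
    refine (tendsto_rpow_neg_nhdsGT_zero hκ).comp (tendsto_nhdsWithin_iff.2 ⟨h1, ?_⟩)
    filter_upwards [eventually_mem_Ioo one_pos] with e he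
    exact mul_pos (Real.rpow_pos_of_pos he.1 _) (h.powInt_pos _ he)
  have h3 := (tendsto_rpow_neg_nhdsGT_zero (σ := (r - 1 / 2) / 2) (by linarith)).atTop_mul_pos
    (mul_pos h.pos (halfInt_pos hr)) (h.tendsto_powInt h.weight hr)
  refine (h2.atTop_mul_atTop₀ h3).congr' ?_
  filter_upwards [eventually_mem_Ioo one_pos] with e he
  have h4 : σ * -κ + -((r - 1 / 2) / 2) + (r - 1 / 2) = 0 := by
    rw [hσdef]; field_simp; ring
  have h5 : e ^ (σ * -κ) * e ^ (-((r - 1 / 2) / 2)) * e ^ (r - 1 / 2) = 1 := by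
    rw [← Real.rpow_add he.1, ← Real.rpow_add he.1, h4, Real.rpow_zero]
  rw [Real.mul_rpow (Real.rpow_nonneg he.1.le _) (h.powInt_pos _ he).le, ← Real.rpow_mul he.1.le]
  linear_combination (powInt q b e ^ (-κ) * powInt q r e) * h5

theorem continuous_dev (h : IsWeighted q S) (b : ℝ) (hp : 0 < p) (m : ℝ) {e : ℝ}
    (he : e ∈ Ioo (0 : ℝ) 1) :
    Continuous fun a => |(reg q e a)⁻¹ - m| ^ p * reg q e a ^ (-b) :=
  ((((h.continuous_reg e).inv₀ fun a => (h.reg_pos he a).ne').sub continuous_const).abs.rpow_const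
    fun _ => Or.inr hp.le).mul (h.continuous_reg_rpow _ he)

/-- An interval on which the profile is bounded below. -/
theorem exists_interval (h : IsWeighted q S) :
    ∃ x y c : ℝ, 0 ≤ x ∧ x < y ∧ y ≤ 1 ∧ 0 < c ∧ ∀ a ∈ Icc x y, c ≤ q a := by
  obtain ⟨a0, ha0, hq0⟩ : ∃ a ∈ Ioo (0 : ℝ) 1, 0 < q a := by
    by_contra hcon
    push Not at hcon
    refine (Ioo_infinite (zero_lt_one' ℝ)) (h.finite.subset fun a ha => ?_)
    exact ⟨Ioo_subset_Icc_self ha, le_antisymm (hcon a ha) (h.nonneg a)⟩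
  have hev : ∀ᶠ a in 𝓝 a0, q a0 / 2 < q a ∧ a ∈ Ioo (0 : ℝ) 1 :=
    (h.cont.continuousAt.eventually_const_lt (half_lt_self hq0)).and (Ioo_mem_nhds ha0.1 ha0.2)
  obtain ⟨δ, hδ, hball⟩ := Metric.nhds_basis_closedBall.mem_iff.1 hev
  rw [Real.closedBall_eq_Icc] at hball
  refine ⟨a0 - δ, a0 + δ, q a0 / 2, ?_, by linarith, ?_, by linarith, fun a ha => (hball ha).1.le⟩
  · exact (hball ⟨le_rfl, by linarith⟩).2.1.le
  · exact (hball ⟨by linarith, le_rfl⟩).2.2.le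

/-- The mean diverges while 1/reg stays bounded on an interval away from the zeros. There the
deviation is at least half the mean, which already makes the moment infinite. -/
theorem tendsto_devMoment_of_two_le (h : IsWeighted q S) (hl : 2 ≤ lam) (hp : 1 ≤ p) :
    Tendsto (devMoment lam q p) (𝓝[>] 0) atTop := by
  have hl0 : 0 < lam := by linarith
  have hp0 : 0 < p := by linarith
  set b := 1 / lam with hbdef
  have hb : b ≤ 1 / 2 := one_div_le_one_div_of_le two_pos hl
  have hb0 : 0 < b := by positivity
  obtain ⟨B, hB1, hB⟩ := h.exists_reg_le
  obtain ⟨x, y, c, hx, hxy, hy, hc, hqc⟩ := h.exists_interval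
  have hmean : Tendsto (mean q b) (𝓝[>] 0) atTop := by
    have := h.tendsto_rpow_mul_powInt_atTop hb (r := b + 1) (κ := 1) (by linarith) one_pos
    refine this.congr' ?_
    filter_upwards [eventually_mem_Ioo one_pos] with e he
    rw [Real.rpow_neg_one, mean, div_eq_inv_mul]
  -- The exponent is chosen so that the p-th power of this expression is I_b^(−(2λp+1)) times the
  -- p-th power of the mean.
  have hbig := h.tendsto_rpow_mul_powInt_atTop hb (r := b + 1) (κ := 2 * lam + 1 + 1 / p)
    (by linarith) (by positivity)
  have hpow := ((tendsto_rpow_atTop hp0).comp hbig).const_mul_atTop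
    (show 0 < (y - x) * B ^ (-b) * (1 / 2) ^ p by
      have := sub_pos.2 hxy; positivity)
  refine tendsto_atTop_mono' _ ?_ hpow
  filter_upwards [eventually_mem_Ioo (half_pos one_pos), hmean.eventually_ge_atTop (2 * (2 / c))]
    with e he hm
  have he1 : e ∈ Ioo (0 : ℝ) 1 := ⟨he.1, he.2.trans (by norm_num)⟩
  have hI := h.powInt_pos b he1
  have hm0 : 0 ≤ mean q b e := le_trans (by positivity) hm
  have hdev : (y - x) * ((1 / 2 * mean q b e) ^ p * B ^ (-b)) ≤ devInt q b p e := by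
    have hcont := h.continuous_dev b hp0 (mean q b e) he1
    have h1 : ∫ _ in x..y, (1 / 2 * mean q b e) ^ p * B ^ (-b) ≤
        ∫ a in x..y, |(reg q e a)⁻¹ - mean q b e| ^ p * reg q e a ^ (-b) := by
      refine intervalIntegral.integral_mono_on hxy.le intervalIntegrable_const
        (hcont.intervalIntegrable _ _) fun a ha => ?_
      have hpos := h.reg_pos he1 a
      have h2 : reg q e a ^ (-b) ≥ B ^ (-b) := Real.rpow_le_rpow_of_nonpos hpos
        (hB e (Ioo_subset_Icc_self he1) a ⟨hx.trans ha.1, ha.2.trans hy⟩) (by linarith)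
      have h3 : (reg q e a)⁻¹ ≤ 2 / c := by
        rw [inv_le_comm₀ hpos (by positivity), inv_div]
        linarith [h.reg_lower he (hqc a ha), he.1]
      have h4 : 1 / 2 * mean q b e ≤ |(reg q e a)⁻¹ - mean q b e| := by
        rw [abs_sub_comm]
        exact le_trans (by linarith) (le_abs_self _)
      gcongr
    rw [intervalIntegral.integral_const, smul_eq_mul] at h1
    refine h1.trans ?_
    refine intervalIntegral.integral_mono_interval hx hxy.le hy ?_ (hcont.intervalIntegrable _ _)
    exact Eventually.of_forall fun a => mul_nonneg (Real.rpow_nonneg (abs_nonneg _) _)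
      (Real.rpow_nonneg (h.reg_pos he1 a).le _)
  rw [devMoment, ← hbdef]
  refine le_trans (le_of_eq ?_) (mul_le_mul_of_nonneg_left hdev (Real.rpow_nonneg hI.le _))
  have h5 : powInt q b e ^ (-(2 * lam + 1 + 1 / p)) * powInt q (b + 1) e =
      powInt q b e ^ (-(2 * lam + 1 / p)) * mean q b e := by
    rw [mean, show -(2 * lam + 1 + 1 / p) = -(2 * lam + 1 / p) - 1 by ring,
      Real.rpow_sub_one hI.ne']
    field_simp
  rw [Function.comp, h5, Real.mul_rpow (Real.rpow_nonneg hI.le _) hm0,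
    Real.mul_rpow (by norm_num) hm0, ← Real.rpow_mul hI.le]
  rw [show -(2 * lam + 1 / p) * p = -(2 * lam * p + 1) by field_simp]
  ring

/-- The main term of the third moment dominates. -/
theorem tendsto_cube_ratio (h : IsWeighted q S) (hb : b ≤ 1 / 2) (hb3 : 1 / 2 ≤ b + 3) :
    Tendsto (fun e => powInt q (b + 2) e * powInt q (b + 1) e /
      (powInt q b e * powInt q (b + 3) e)) (𝓝[>] 0) (𝓝 0) := by
  rcases hb3.eq_or_lt with h3 | h3
  · -- the borderline case, in which only the main term diverges
    obtain ⟨A2, -, h2⟩ := h.tendsto_powInt_of_lt_half h.finite (r := b + 2) (by linarith)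
    obtain ⟨A1, -, h1⟩ := h.tendsto_powInt_of_lt_half h.finite (r := b + 1) (by linarith)
    obtain ⟨A0, hA0, h0⟩ := h.tendsto_powInt_of_lt_half h.finite (r := b) (by linarith)
    rw [← h3]
    exact (h2.mul h1).div_atTop (h0.pos_mul_atTop hA0 (h.tendsto_powInt_half h.pos h.weight))
  · have hmain := h.tendsto_powInt h.weight h3
    have hlim3 : 0 < S * halfInt (b + 3) := mul_pos h.pos (halfInt_pos h3)
    -- For b = 1/2 numerator and main term carry the same power of `e`, and only the slow divergence
    -- of `powInt q (1 / 2)` decides. For b < 1/2 there is a strict gap between the powers.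
    rcases hb.eq_or_lt with hb | hb
    · have h2 := h.tendsto_powInt h.weight (r := b + 2) (by linarith)
      have h1 := h.tendsto_powInt h.weight (r := b + 1) (by linarith)
      have h0 := h.tendsto_powInt_half h.pos h.weight
      rw [← hb] at h0
      refine ((h2.mul h1).div_atTop (h0.atTop_mul_pos hlim3 hmain)).congr' ?_
      filter_upwards [eventually_mem_Ioo one_pos] with e he
      have hs : e ^ (b + 2 - 1 / 2) * e ^ (b + 1 - 1 / 2) = e ^ (b + 3 - 1 / 2) := by
        rw [← Real.rpow_add he.1]; congr 1; linarith
      have hne := (Real.rpow_pos_of_pos he.1 (b + 3 - 1 / 2)).ne'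
      rw [mul_mul_mul_comm, hs, mul_left_comm (powInt q b e), mul_div_mul_left _ _ hne]
    · obtain ⟨A0, hA0, h0⟩ := h.tendsto_powInt_of_lt_half h.finite hb
      -- The order b + 5/2 of the main term is split into two exponents, each exceeding the growth
      -- order of one factor of the numerator. The window is nonempty because −5/2 < b < 1/2.
      obtain ⟨σ1, hσ1, hσ1'⟩ := exists_between
        (show max 0 (b + 1 / 2) < b + 5 / 2 - max 0 (b + 3 / 2) by
          rcases max_cases 0 (b + 1 / 2) with h1 | h1 <;>
          rcases max_cases 0 (b + 3 / 2) with h2 | h2 <;> linarith [h1.1, h2.1])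
      have m1 := le_max_left 0 (b + 1 / 2)
      have m2 := le_max_right 0 (b + 1 / 2)
      have m3 := le_max_left 0 (b + 3 / 2)
      have m4 := le_max_right 0 (b + 3 / 2)
      have h1 := h.tendsto_rpow_mul_powInt h.weight (r := b + 1) (σ := σ1) (by linarith)
        (by linarith)
      have h2 := h.tendsto_rpow_mul_powInt h.weight (r := b + 2) (σ := b + 5 / 2 - σ1)
        (by linarith) (by linarith)
      have := (h2.mul h1).div (h0.mul hmain) (mul_pos hA0 hlim3).ne'
      rw [zero_mul, zero_div] at this
      refine this.congr' ?_
      filter_upwards [eventually_mem_Ioo one_pos] with e he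
      have hs : e ^ (b + 5 / 2 - σ1) * e ^ σ1 = e ^ (b + 3 - 1 / 2) := by
        rw [← Real.rpow_add he.1]; congr 1; linarith
      have hne := (Real.rpow_pos_of_pos he.1 (b + 3 - 1 / 2)).ne'
      rw [Pi.div_apply]
      rw [mul_mul_mul_comm, hs, mul_left_comm (powInt q b e), mul_div_mul_left _ _ hne]

/-- Of the three terms of the central moment only the middle one is negative. Once the ratio is
below 1/6, three times it is at most half of the main term. -/
theorem tendsto_cubeMoment_aux (h : IsWeighted q S) (hb : 1 / lam ≤ 1 / 2)
    (hb3 : 1 / 2 ≤ 1 / lam + 3)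
    (hmain : Tendsto (fun e => powInt q (1 / lam) e ^ (-(6 * lam + 1)) * powInt q (1 / lam + 3) e)
      (𝓝[>] 0) atTop) : Tendsto (cubeMoment lam q) (𝓝[>] 0) atTop := by
  set b := 1 / lam with hbdef
  have hr := h.tendsto_cube_ratio hb hb3
  refine tendsto_atTop_mono' _ ?_ (hmain.const_mul_atTop (show (0 : ℝ) < 1 / 2 by norm_num))
  filter_upwards [eventually_mem_Ioo one_pos,
    hr.eventually (gt_mem_nhds (show (0 : ℝ) < 1 / 6 by norm_num))] with e he hre
  have i0 := h.powInt_pos b he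
  have i1 := h.powInt_pos (b + 1) he
  have i2 := h.powInt_pos (b + 2) he
  have i3 := h.powInt_pos (b + 3) he
  rw [cubeMoment, ← hbdef, show -(6 * lam + 1) = -(6 * lam) - 1 by ring,
    Real.rpow_sub_one i0.ne']
  have hP := Real.rpow_pos_of_pos i0 (-(6 * lam))
  rw [show 1 / 2 * (powInt q b e ^ (-(6 * lam)) / powInt q b e * powInt q (b + 3) e) =
    powInt q b e ^ (-(6 * lam)) * (1 / 2 * (powInt q (b + 3) e / powInt q b e)) by ring]
  refine mul_le_mul_of_nonneg_left ?_ hP.le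
  rw [div_lt_iff₀ (by positivity)] at hre
  have h1 : 0 ≤ 2 * (powInt q (b + 1) e / powInt q b e) ^ 3 := by positivity
  have h2 : 3 * (powInt q (b + 2) e / powInt q b e) * (powInt q (b + 1) e / powInt q b e) ≤
      1 / 2 * (powInt q (b + 3) e / powInt q b e) := by
    rw [mul_assoc, div_mul_div_comm, mul_div_assoc', mul_div_assoc', div_le_div_iff₀
      (by positivity) i0]
    nlinarith [mul_lt_mul_of_pos_right hre i0]
  linarith

theorem tendsto_cubeMoment_of_two_le (h : IsWeighted q S) (hl : 2 ≤ lam) :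
    Tendsto (cubeMoment lam q) (𝓝[>] 0) atTop := by
  have hl0 : 0 < lam := by linarith
  have hb : 1 / lam ≤ 1 / 2 := one_div_le_one_div_of_le two_pos hl
  have hb0 : 0 < 1 / lam := by positivity
  exact h.tendsto_cubeMoment_aux hb (by linarith)
    (h.tendsto_rpow_mul_powInt_atTop hb (by linarith) (by linarith))

theorem tendsto_powInt_atTop (h : IsWeighted q S) {r : ℝ} (hr : 1 / 2 ≤ r) :
    Tendsto (powInt q r) (𝓝[>] 0) atTop := by
  rcases hr.eq_or_lt with rfl | hr
  · exact h.tendsto_powInt_half h.pos h.weight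
  · exact h.tendsto_powInt_atTop_of_half_lt h.pos h.weight hr

theorem tendsto_cubeMoment_of_neg (h : IsWeighted q S) (hl : lam < 0)
    (hb3 : 1 / 2 ≤ 1 / lam + 3) : Tendsto (cubeMoment lam q) (𝓝[>] 0) atTop := by
  have hb : 1 / lam < 0 := one_div_neg.2 hl
  obtain ⟨A, hA, h0⟩ := h.tendsto_powInt_of_lt_half h.finite (r := 1 / lam) (by linarith)
  exact h.tendsto_cubeMoment_aux (by linarith) hb3
    ((tendsto_rpow_ratio h0 hA).pos_mul_atTop (Real.rpow_pos_of_pos hA _)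
      (h.tendsto_powInt_atTop hb3))

/-- For λ < 0 the weight has a finite total, so the p-th moment of 1/reg alone is `powInt q (p +
b)`, which diverges. Centring does not help, since the p-th power of the mean is of lower order. -/
theorem tendsto_devMoment_of_neg (h : IsWeighted q S) (hl : lam < 0) (hp : 1 < p)
    (hpb : 1 / 2 ≤ p + 1 / lam) : Tendsto (devMoment lam q p) (𝓝[>] 0) atTop := by
  have hp0 : 0 < p := by linarith
  set b := 1 / lam with hbdef
  have hb : b < 0 := one_div_neg.2 hl
  obtain ⟨A, hA, h0⟩ := h.tendsto_powInt_of_lt_half h.finite (r := b) (by linarith)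
  have htop := h.tendsto_powInt_atTop hpb
  have hratio : Tendsto (fun e => powInt q (b + 1) e ^ p / powInt q (p + b) e) (𝓝[>] 0) (𝓝 0) := by
    rcases hpb.eq_or_lt with h1 | h1
    · obtain ⟨A1, hA1, h2⟩ := h.tendsto_powInt_of_lt_half h.finite (r := b + 1) (by linarith)
      exact (h2.rpow_const (Or.inl hA1.ne')).div_atTop htop
    · have hσ : 0 < (p + b - 1 / 2) / p := div_pos (by linarith) hp0
      -- After clearing denominators this is (p − 1)b < (p − 1)/2, true since b < 0 and p > 1.
      have hσ' : b + 1 - 1 / 2 < (p + b - 1 / 2) / p := by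
        rw [lt_div_iff₀ hp0]; nlinarith
      have h2 := (h.tendsto_rpow_mul_powInt h.weight hσ hσ').rpow_const (p := p) (Or.inr hp0.le)
      rw [Real.zero_rpow hp0.ne'] at h2
      have h3 := h2.div (h.tendsto_powInt h.weight h1) (mul_pos h.pos (halfInt_pos h1)).ne'
      rw [zero_div] at h3
      refine h3.congr' ?_
      filter_upwards [eventually_mem_Ioo one_pos] with e he
      have hne := (Real.rpow_pos_of_pos he.1 (p + b - 1 / 2)).ne'
      rw [Pi.div_apply, Real.mul_rpow (Real.rpow_nonneg he.1.le _) (h.powInt_pos _ he).le,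
        ← Real.rpow_mul he.1.le, div_mul_cancel₀ _ hp0.ne', mul_div_mul_left _ _ hne]
  -- the triangle inequality
  have hlow : ∀ᶠ e in 𝓝[>] (0 : ℝ), powInt q (p + b) e *
      (2 ^ (1 - p) - powInt q (b + 1) e ^ p / powInt q (p + b) e * powInt q b e ^ (1 - p)) ≤
      devInt q b p e := by
    filter_upwards [eventually_mem_Ioo one_pos] with e he
    have i0 := h.powInt_pos b he
    have i1 := h.powInt_pos (b + 1) he
    have ip := h.powInt_pos (p + b) he
    have hm : 0 < mean q b e := div_pos i1 i0
    have hcont := h.continuous_dev b hp0 (mean q b e) he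
    have h1 : ∫ a in (0 : ℝ)..1, (2 ^ (1 - p) * reg q e a ^ (-(p + b)) -
        mean q b e ^ p * reg q e a ^ (-b)) ≤ devInt q b p e := by
      refine intervalIntegral.integral_mono_on zero_le_one
        (((h.continuous_reg_rpow _ he).const_mul _).sub
          ((h.continuous_reg_rpow _ he).const_mul _) |>.intervalIntegrable _ _)
        (hcont.intervalIntegrable _ _) fun a _ => ?_
      have hD := h.reg_pos he a
      have h2 : (reg q e a)⁻¹ ^ p ≤
          2 ^ (p - 1) * (|(reg q e a)⁻¹ - mean q b e| ^ p + mean q b e ^ p) := by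
        refine le_trans (Real.rpow_le_rpow (by positivity) ?_ hp0.le)
          (add_rpow_le_mul (abs_nonneg _) hm.le hp.le)
        linarith [le_abs_self ((reg q e a)⁻¹ - mean q b e)]
      have h3 : (2 : ℝ) ^ (1 - p) * 2 ^ (p - 1) = 1 := by
        rw [← Real.rpow_add two_pos]; simp
      have h4 : 2 ^ (1 - p) * (reg q e a)⁻¹ ^ p - mean q b e ^ p ≤
          |(reg q e a)⁻¹ - mean q b e| ^ p := by
        have := mul_le_mul_of_nonneg_left h2 (Real.rpow_nonneg zero_le_two (1 - p))
        rw [← mul_assoc, h3, one_mul] at this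
        linarith
      have h5 : reg q e a ^ (-(p + b)) = (reg q e a)⁻¹ ^ p * reg q e a ^ (-b) := by
        rw [Real.inv_rpow hD.le, ← Real.rpow_neg hD.le, ← Real.rpow_add hD]; ring_nf
      rw [h5, ← mul_assoc, ← sub_mul]
      exact mul_le_mul_of_nonneg_right h4 (Real.rpow_nonneg hD.le _)
    rw [intervalIntegral.integral_sub
      (((h.continuous_reg_rpow _ he).intervalIntegrable _ _).const_mul _)
      (((h.continuous_reg_rpow _ he).intervalIntegrable _ _).const_mul _),
      intervalIntegral.integral_const_mul, intervalIntegral.integral_const_mul] at h1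
    refine le_trans (le_of_eq ?_) h1
    change _ = 2 ^ (1 - p) * powInt q (p + b) e - mean q b e ^ p * powInt q b e
    rw [mean, Real.div_rpow i1.le i0.le, Real.rpow_sub i0, Real.rpow_one]
    field_simp
  have hbr : Tendsto (fun e => (2 : ℝ) ^ (1 - p) -
      powInt q (b + 1) e ^ p / powInt q (p + b) e * powInt q b e ^ (1 - p)) (𝓝[>] 0)
      (𝓝 (2 ^ (1 - p))) := by
    simpa using (hratio.mul (tendsto_rpow_ratio (b := 1 - p) h0 hA)).const_sub (2 ^ (1 - p))
  have hdev := tendsto_atTop_mono' _ hlow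
    (htop.atTop_mul_pos (Real.rpow_pos_of_pos two_pos _) hbr)
  exact (tendsto_rpow_ratio h0 hA).pos_mul_atTop (Real.rpow_pos_of_pos hA _) hdev

/-- The mean converges and |1/z − mean|^p z^(−b) is bounded by powers of z no worse than an
integrable one, so dominated convergence applies to the whole integral. -/
theorem exists_tendsto_devMoment_of_neg (h : IsWeighted q S) (hl : lam < 0) (hp : 1 ≤ p)
    (hpb : p + 1 / lam < 1 / 2) : ∃ L, Tendsto (devMoment lam q p) (𝓝[>] 0) (𝓝 L) := by
  have hp0 : 0 < p := by linarith
  set b := 1 / lam with hbdef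
  have hb : b < 0 := one_div_neg.2 hl
  obtain ⟨A, hA, h0⟩ := h.tendsto_powInt_of_lt_half h.finite (r := b) (by linarith)
  obtain ⟨A1, hA1, h1⟩ := h.tendsto_powInt_of_lt_half h.finite (r := b + 1) (by linarith)
  have hm : Tendsto (mean q b) (𝓝[>] 0) (𝓝 (A1 / A)) := h1.div h0 hA.ne'
  obtain ⟨B, hB1, hB⟩ := h.exists_reg_le
  obtain ⟨r, hr1, hr2⟩ := exists_between (show max (p + b) 0 < 1 / 2 from max_lt hpb (by norm_num))
  have hr0 : 0 < r := (le_max_right _ _).trans_lt hr1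
  have hrp : p + b < r := (le_max_left _ _).trans_lt hr1
  set M := A1 / A + 1 with hM
  have hM0 : 0 < M := by positivity
  have hpow : ∀ s ≤ r, ∀ z ∈ Ioc 0 B, z ^ (-s) ≤ B ^ (r - s) * (1 + z ^ (-r)) := by
    intro s hs z hz
    rw [show -s = (r - s) + -r by ring, Real.rpow_add hz.1]
    have h2 : 0 ≤ z ^ (-r) := Real.rpow_nonneg hz.1.le _
    have h3 : z ^ (r - s) ≤ B ^ (r - s) := Real.rpow_le_rpow hz.1.le hz.2 (by linarith)
    calc z ^ (r - s) * z ^ (-r) ≤ B ^ (r - s) * z ^ (-r) := by gcongr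
      _ ≤ _ := by gcongr; linarith
  have hdev := h.tendsto_integral_reg h.finite hr0 hr2 (B := B)
    (C := 2 ^ (p - 1) * (B ^ (r - (p + b)) + M ^ p * B ^ (r - b)))
    (G := fun e z => |z⁻¹ - mean q b e| ^ p * z ^ (-b))
    (G0 := fun z => |z⁻¹ - A1 / A| ^ p * z ^ (-b)) (by positivity) hB ?_ ?_ ?_
  · exact ⟨_, (tendsto_rpow_ratio h0 hA).mul hdev⟩
  · refine Eventually.of_forall fun e => ContinuousOn.mul ?_
      (continuousOn_id.rpow_const fun z hz => Or.inl (ne_of_gt hz))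
    refine ContinuousOn.rpow_const ?_ fun z _ => Or.inr hp0.le
    exact ((continuousOn_id.inv₀ fun z hz => (ne_of_gt hz)).sub continuousOn_const).abs
  · filter_upwards [eventually_mem_Ioo one_pos, hm.eventually (gt_mem_nhds (lt_add_one _))]
      with e he hme z hz
    have hm0 : 0 < mean q b e := div_pos (h.powInt_pos _ he) (h.powInt_pos _ he)
    have hzb := Real.rpow_nonneg hz.1.le (-b)
    rw [abs_mul, abs_of_nonneg (Real.rpow_nonneg (abs_nonneg _) p), abs_of_nonneg hzb]
    have hz0 := hz.1
    have h2 : |z⁻¹ - mean q b e| ^ p ≤ 2 ^ (p - 1) * (z⁻¹ ^ p + M ^ p) := by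
      refine le_trans (Real.rpow_le_rpow (abs_nonneg _) ?_ hp0.le)
        (add_rpow_le_mul (by positivity) hM0.le hp)
      rw [abs_le]
      have : 0 < z⁻¹ := by positivity
      constructor <;> linarith
    have h5 : z⁻¹ ^ p * z ^ (-b) = z ^ (-(p + b)) := by
      rw [Real.inv_rpow hz0.le, ← Real.rpow_neg hz0.le, ← Real.rpow_add hz0]; ring_nf
    calc |z⁻¹ - mean q b e| ^ p * z ^ (-b) ≤ 2 ^ (p - 1) * (z⁻¹ ^ p + M ^ p) * z ^ (-b) := by
          gcongr
      _ = 2 ^ (p - 1) * (z ^ (-(p + b)) + M ^ p * z ^ (-b)) := by rw [← h5]; ring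
      _ ≤ 2 ^ (p - 1) * (B ^ (r - (p + b)) * (1 + z ^ (-r)) +
          M ^ p * (B ^ (r - b) * (1 + z ^ (-r)))) := by
          gcongr
          · exact hpow _ hrp.le z hz
          · exact hpow _ (by linarith) z hz
      _ = _ := by ring
  · intro z0 hz0 z hz
    have hne : z0 ≠ 0 := ne_of_gt hz0
    exact ((((hz.inv₀ hne).sub hm).abs).rpow_const (Or.inr hp0.le)).mul
      (hz.rpow_const (Or.inl hne))

/-- The density of time is integrable at the end. -/
theorem exists_rpow_bound (h : IsWeighted q S) (hl : lam < 0 ∨ 1 < lam) :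
    ∃ ρ < (1 : ℝ), ∀ᶠ e in 𝓝[>] (0 : ℝ), powInt q (1 / lam) e ^ (2 * lam) ≤ e ^ (-ρ) := by
  rcases hl with hl | hl
  · have hb : 1 / lam < 0 := one_div_neg.2 hl
    obtain ⟨A, hA, h0⟩ := h.tendsto_powInt_of_lt_half h.finite (r := 1 / lam) (by linarith)
    refine ⟨1 / 2, by norm_num, ?_⟩
    have h1 := tendsto_rpow_ratio (b := 2 * lam) h0 hA
    filter_upwards [h1.eventually (gt_mem_nhds (lt_add_one _)),
      (tendsto_rpow_neg_nhdsGT_zero (half_pos one_pos)).eventually_ge_atTop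
        (A ^ (2 * lam) + 1)] with e h2 h3 using h2.le.trans h3
  · have hl0 : 0 < lam := by linarith
    have hlb : lam * (1 / lam) = 1 := by field_simp
    -- The window between 1/λ − 1/2 and 1/(2λ) is open precisely because λ > 1, and it makes the
    -- exponent 2λσ of the time density less than 1.
    obtain ⟨σ, hσ1, hσ2⟩ := exists_between (show max 0 (1 / lam - 1 / 2) < 1 / (2 * lam) by
      refine max_lt (by positivity) ?_
      rw [lt_div_iff₀ (by positivity)]
      nlinarith)
    have hσ0 := (le_max_left _ _).trans_lt hσ1
    have hσb := (le_max_right _ _).trans_lt hσ1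
    refine ⟨σ * (2 * lam), (lt_div_iff₀ (by positivity)).1 hσ2, ?_⟩
    have h1 := h.tendsto_rpow_mul_powInt h.weight hσ0 hσb
    filter_upwards [h1.eventually (gt_mem_nhds one_pos), eventually_mem_Ioo one_pos] with e h2 he
    have hI := h.powInt_pos (1 / lam) he
    have h3 : powInt q (1 / lam) e ≤ e ^ (-σ) := by
      rw [Real.rpow_neg he.1.le, ← one_div, le_div_iff₀ (Real.rpow_pos_of_pos he.1 _), mul_comm]
      exact h2.le
    calc _ ≤ (e ^ (-σ)) ^ (2 * lam) := Real.rpow_le_rpow hI.le h3 (by positivity)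
      _ = _ := by rw [← Real.rpow_mul he.1.le]; ring_nf

/-- The density of time is not integrable at the end. -/
theorem exists_lower_bound (h : IsWeighted q S) (hl : 0 < lam) (hl1 : lam ≤ 1) :
    ∃ c > 0, ∀ᶠ e in 𝓝[>] (0 : ℝ), c * e⁻¹ ≤ powInt q (1 / lam) e ^ (2 * lam) := by
  have hlb : lam * (1 / lam) = 1 := by field_simp
  have hb : 1 / 2 < 1 / lam := one_div_lt_one_div_of_lt hl (by linarith)
  have hA : 0 < S * halfInt (1 / lam) := mul_pos h.pos (halfInt_pos hb)
  have h1 := tendsto_rpow_ratio (b := 2 * lam) (h.tendsto_powInt h.weight hb) hA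
  have hA2 := Real.rpow_pos_of_pos hA (2 * lam)
  refine ⟨(S * halfInt (1 / lam)) ^ (2 * lam) / 2, by positivity, ?_⟩
  filter_upwards [h1.eventually (lt_mem_nhds (half_lt_self hA2)), eventually_mem_Ioo one_pos]
    with e h2 he
  rw [h.powInt_rpow_eq _ _ he, mul_comm]
  -- The exponent on the right is −(2 − λ), at most −1 because λ ≤ 1.
  have h3 : e⁻¹ ≤ e ^ (-(1 / lam - 1 / 2) * (2 * lam)) := by
    rw [← Real.rpow_neg_one]
    exact Real.rpow_le_rpow_of_exponent_ge he.1 he.2.le (by nlinarith)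
  have h4 := he.1
  have h5 : (0 : ℝ) ≤ e⁻¹ := by positivity
  gcongr

end IsWeighted

end
end ProudmanJohnson

/-! ### From Lagrangian integrals to profile integrals -/

namespace ProudmanJohnson
noncomputable section

/-- The `p`-th absolute moment of the velocity gradient in terms of the parameter. -/
def gradMoment (lam : ℝ) (f : ℝ → ℝ) (p s : ℝ) : ℝ :=
  ∫ a in (0 : ℝ)..1, |grad lam f s a| ^ p * jac lam f s a

variable {lam : ℝ} {f u0 q : ℝ → ℝ} {S e s p : ℝ}

/-- One step of l'Hôpital leaves half a difference quotient of the derivative, so only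
differentiability of `g'` at the point is needed. -/
theorem tendsto_div_sq {g g' : ℝ → ℝ} {a c : ℝ} (h1 : ∀ x, HasDerivAt g (g' x) x)
    (h2 : HasDerivAt g' c a) (hg : g a = 0) (hg' : g' a = 0) :
    Tendsto (fun x => g x / (x - a) ^ 2) (𝓝[≠] a) (𝓝 (c / 2)) := by
  have hd : ∀ x, HasDerivAt (fun x => (x - a) ^ 2) (2 * (x - a)) x := fun x => by
    simpa using ((hasDerivAt_id x).sub_const a).fun_pow 2
  refine HasDerivAt.lhopital_zero_nhdsNE (Eventually.of_forall h1) (Eventually.of_forall hd)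
    ?_ ?_ ?_ ?_
  · filter_upwards [self_mem_nhdsWithin] with x hx
    simpa [sub_eq_zero] using hx
  · simpa [hg] using ((h1 a).continuousAt.tendsto.mono_left nhdsWithin_le_nhds)
  · simpa using ((hd a).continuousAt.tendsto.mono_left nhdsWithin_le_nhds)
  · have h3 := (hasDerivAt_iff_tendsto_slope.1 h2).div_const 2
    refine h3.congr' ?_
    filter_upwards [self_mem_nhdsWithin] with x hx
    rw [slope_def_field, hg', sub_zero, div_div, mul_comm (x - a)]

/-- Points where `lam u0'` is greatest. -/
def IsCritical (lam : ℝ) (f : ℝ → ℝ) (a : ℝ) : Prop := ∀ x, lam * f x ≤ lam * f a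

theorem IsCritical.finite (h0 : IsAdmissible lam u0) (hl : lam ≠ 0) :
    {a ∈ Icc (0 : ℝ) 1 | IsCritical lam (deriv u0) a}.Finite := by
  rcases hl.lt_or_gt with h | h
  · refine (h0.finite_min h).subset fun a ha => ⟨ha.1, fun x _ => ?_⟩
    exact (mul_le_mul_left_of_neg h).1 (ha.2 x)
  · refine (h0.finite_max h).subset fun a ha => ⟨ha.1, fun x _ => ?_⟩
    exact le_of_mul_le_mul_left (ha.2 x) h

theorem IsCritical.iteratedDeriv_ne_zero (h0 : IsAdmissible lam u0) (hl : lam ≠ 0) {a : ℝ}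
    (ha : IsCritical lam (deriv u0) a) : iteratedDeriv 3 u0 a ≠ 0 := by
  rcases hl.lt_or_gt with h | h
  · exact h0.nondegenerate_min h a fun x _ => (mul_le_mul_left_of_neg h).1 (ha x)
  · exact h0.nondegenerate_max h a fun x _ => le_of_mul_le_mul_left (ha x) h

theorem exists_isCritical (hf : Continuous f) (hp : Function.Periodic f 1) :
    ∃ a ∈ Icc (0 : ℝ) 1, IsCritical lam f a := by
  have hc : Continuous fun a => lam * f a := by fun_prop
  obtain ⟨a, ha, hmax⟩ := (isCompact_Icc (a := (0 : ℝ)) (b := 1)).exists_isMaxOn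
    (nonempty_Icc.2 zero_le_one) hc.continuousOn
  refine ⟨a, ha, fun x => ?_⟩
  obtain ⟨b, hb, hab⟩ := hp.exists_mem_Ico₀ one_pos x
  rw [hab]
  exact hmax (Ico_subset_Icc_self hb)

/-- Otherwise λu0 would be antitone and periodic, hence constant, and every point would be critical,
against finiteness. -/
theorem IsCritical.pos (h0 : IsAdmissible lam u0) (hl : lam ≠ 0) {a : ℝ}
    (ha : IsCritical lam (deriv u0) a) : 0 < lam * deriv u0 a := by
  by_contra! hneg
  have hanti : Antitone fun x => lam * u0 x := by
    refine antitone_of_deriv_nonpos (((h0.smooth.differentiable (by simp))).const_mul lam)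
      fun x => ?_
    rw [((hasDerivAt_data h0 x).const_mul lam).deriv]
    exact (ha x).trans hneg
  have h10 : u0 1 = u0 0 := by simpa using h0.periodic 0
  have hconst : ∀ x ∈ Icc (0 : ℝ) 1, u0 x = u0 0 := fun x hx => by
    refine mul_left_cancel₀ hl (le_antisymm (hanti hx.1) ?_)
    simpa [h10] using hanti hx.2
  have hzero : ∀ x ∈ Ioo (0 : ℝ) 1, deriv u0 x = 0 := fun x hx => by
    have : u0 =ᶠ[𝓝 x] fun _ => u0 0 := by
      filter_upwards [Icc_mem_nhds hx.1 hx.2] with y hy using hconst y hy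
    rw [this.deriv_eq, deriv_const]
  have hsub : Ioo (0 : ℝ) 1 ⊆ {a ∈ Icc (0 : ℝ) 1 | IsCritical lam (deriv u0) a} := fun x hx =>
    ⟨Ioo_subset_Icc_self hx, fun y => by
      rw [hzero x hx, mul_zero]; exact (ha y).trans hneg⟩
  exact (Ioo_infinite one_pos) ((IsCritical.finite h0 hl).subset hsub)

/-- The greatest value `M` of `u0'` for `lam > 0`, its least value for `lam < 0`. -/
structure IsExtremum (lam : ℝ) (u0 : ℝ → ℝ) (M S : ℝ) : Prop where
  pos : 0 < lam * M
  le : ∀ a, lam * deriv u0 a ≤ lam * M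
  attained : ∃ a, deriv u0 a = M
  etaStar_eq : etaStar lam u0 = 1 / (lam * M)
  weighted : IsWeighted (fun a => 1 - deriv u0 a / M) S

/-- At a zero of 1 − u0'/M the quadratic coefficient is −u0'''/(2M). It is nonnegative because the
zero is a minimum, and nonzero by the nondegeneracy of the datum. -/
theorem exists_isExtremum (h0 : IsAdmissible lam u0) (hl : lam ≠ 0) :
    ∃ M S, IsExtremum lam u0 M S := by
  have hfc := continuous_deriv_data h0
  obtain ⟨a, ha, hcrit⟩ := exists_isCritical (lam := lam) hfc (periodic_deriv h0.periodic)
  set M := deriv u0 a with hM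
  have hpos : 0 < lam * M := hcrit.pos h0 hl
  have hM0 : M ≠ 0 := right_ne_zero_of_mul hpos.ne'
  have hsm : ContDiff ℝ (⊤ : ℕ∞) (deriv u0) :=
    (contDiff_infty_iff_deriv.1 h0.smooth).2
  have hsm2 : ContDiff ℝ (⊤ : ℕ∞) (deriv (deriv u0)) := (contDiff_infty_iff_deriv.1 hsm).2
  have hnn : ∀ x, 0 ≤ 1 - deriv u0 x / M := fun x => by
    rw [← mul_div_mul_left _ _ hl, sub_nonneg, div_le_one hpos]
    exact hcrit x
  have hzero : ∀ x, 1 - deriv u0 x / M = 0 → deriv u0 x = M := fun x hx => by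
    field_simp at hx; linarith
  have hcr : ∀ x, 1 - deriv u0 x / M = 0 → IsCritical lam (deriv u0) x := fun x hx y => by
    rw [hzero x hx]; exact hcrit y
  have hprof : IsProfile fun x => 1 - deriv u0 x / M := by
    refine ⟨by fun_prop, hnn, fun x hx => ?_⟩
    have h1 : ∀ y, HasDerivAt (fun x => 1 - deriv u0 x / M) (-(deriv (deriv u0) y / M)) y :=
      fun y => (((hsm.differentiable (by simp)) y).hasDerivAt.div_const M).const_sub 1
    have h2 : HasDerivAt (fun y => -(deriv (deriv u0) y / M)) (-(iteratedDeriv 3 u0 x / M)) x := by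
      have : iteratedDeriv 3 u0 x = deriv (deriv (deriv u0)) x := by
        simp [iteratedDeriv_succ, iteratedDeriv_zero]
      rw [this]
      exact (((hsm2.differentiable (by simp)) x).hasDerivAt.div_const M).neg
    have hmin : IsLocalMin (fun x => 1 - deriv u0 x / M) x :=
      Eventually.of_forall fun y => hx.le.trans (hnn y)
    have h3 := tendsto_div_sq h1 h2 hx (hmin.hasDerivAt_eq_zero (h1 x))
    refine ⟨_, lt_of_le_of_ne ?_ ?_, h3⟩
    · exact ge_of_tendsto' h3 fun y => div_nonneg (hnn y) (sq_nonneg _)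
    · have := (hcr x hx).iteratedDeriv_ne_zero h0 hl
      exact (div_ne_zero (neg_ne_zero.2 (div_ne_zero this hM0)) two_ne_zero).symm
  obtain ⟨S, hS, hw⟩ := hprof.exists_hasWeight_pos ha (by simp [hM0, ← hM])
  refine ⟨M, S, hpos, hcrit, ⟨a, rfl⟩, ?_, hprof, ?_, hS, hw⟩
  · unfold etaStar
    split_ifs with h
    · have : IsGreatest (deriv u0 '' Icc 0 1) M := ⟨mem_image_of_mem _ ha, by
        rintro _ ⟨x, -, rfl⟩
        exact le_of_mul_le_mul_left (hcrit x) h⟩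
      rw [this.csSup_eq]
    · have : IsLeast (deriv u0 '' Icc 0 1) M := ⟨mem_image_of_mem _ ha, by
        rintro _ ⟨x, -, rfl⟩
        exact (mul_le_mul_left_of_neg (hl.lt_of_le (not_lt.1 h))).1 (hcrit x)⟩
      rw [this.csInf_eq]
  · exact (IsCritical.finite h0 hl).subset fun x hx => ⟨hx.1, hcr x hx.2⟩

theorem kerInt_zero_eq_powInt (hl : lam ≠ 0) (hD : ∀ a, 1 - lam * s * f a = reg q e a) :
    kerInt lam f 0 s = powInt q (1 / lam) e :=
  intervalIntegral.integral_congr fun a _ => by simp [ker, hl, ← hD]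

/-- This affine relation between f/(1 − λsf) and 1/(1 − λsf) is what turns moments of the gradient
into integrals of pure powers. -/
theorem div_eq_of_one_sub {v R : ℝ} (hl : lam ≠ 0) (hs : s ≠ 0) (h : 1 - lam * s * v = R)
    (hR : R ≠ 0) : v / R = (lam * s)⁻¹ * (R⁻¹ - 1) := by
  have : lam * s * v = 1 - R := by linarith
  field_simp
  linarith

theorem kerInt_integrand_eq (hl : lam ≠ 0) (hs : s ≠ 0) (hD : ∀ a, 1 - lam * s * f a = reg q e a)
    (hq : IsProfile q) (he : e ∈ Ioo (0 : ℝ) 1) (j : ℕ) (a : ℝ) :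
    f a ^ j * ker lam s (f a) / (1 - lam * s * f a) ^ j =
      (lam * s)⁻¹ ^ j * ((reg q e a)⁻¹ - 1) ^ j * reg q e a ^ (-(1 / lam)) := by
  have hR := (hq.reg_pos he a).ne'
  have h1 : f a / reg q e a = (lam * s)⁻¹ * ((reg q e a)⁻¹ - 1) :=
    div_eq_of_one_sub hl hs (hD a) hR
  rw [ker, if_neg hl, hD, mul_div_right_comm, ← div_pow, h1, mul_pow]

theorem reg_inv_mul_rpow (hq : IsProfile q) (he : e ∈ Ioo (0 : ℝ) 1) (r a : ℝ) :
    (reg q e a)⁻¹ * reg q e a ^ (-r) = reg q e a ^ (-(r + 1)) := by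
  have hR := hq.reg_pos he a
  rw [← Real.rpow_neg_one, ← Real.rpow_add hR]; ring_nf

theorem kerInt_one_eq (hl : lam ≠ 0) (hs : s ≠ 0) (hD : ∀ a, 1 - lam * s * f a = reg q e a)
    (hq : IsProfile q) (he : e ∈ Ioo (0 : ℝ) 1) :
    kerInt lam f 1 s = (lam * s)⁻¹ * (powInt q (1 / lam + 1) e - powInt q (1 / lam) e) := by
  have hi := fun r => (hq.continuous_reg_rpow r he).intervalIntegrable (μ := volume) 0 1
  unfold kerInt powInt
  rw [← intervalIntegral.integral_sub (hi _) (hi _), ← intervalIntegral.integral_const_mul]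
  refine intervalIntegral.integral_congr fun a _ => ?_
  simp only [kerInt_integrand_eq hl hs hD hq he, ← reg_inv_mul_rpow hq he]
  ring

theorem kerInt_two_eq (hl : lam ≠ 0) (hs : s ≠ 0) (hD : ∀ a, 1 - lam * s * f a = reg q e a)
    (hq : IsProfile q) (he : e ∈ Ioo (0 : ℝ) 1) :
    kerInt lam f 2 s = (lam * s)⁻¹ ^ 2 * (powInt q (1 / lam + 2) e -
      (2 * powInt q (1 / lam + 1) e - powInt q (1 / lam) e)) := by
  have hi := fun r => (hq.continuous_reg_rpow r he).intervalIntegrable (μ := volume) 0 1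
  unfold kerInt powInt
  rw [← intervalIntegral.integral_const_mul 2, ← intervalIntegral.integral_sub ((hi _).const_mul _)
    (hi _), ← intervalIntegral.integral_sub (hi _) (((hi _).const_mul _).sub (hi _)),
    ← intervalIntegral.integral_const_mul]
  refine intervalIntegral.integral_congr fun a _ => ?_
  simp only [kerInt_integrand_eq hl hs hD hq he, show 1 / lam + 2 = 1 / lam + 1 + 1 by ring,
    ← reg_inv_mul_rpow hq he]
  ring

theorem kerInt_three_eq (hl : lam ≠ 0) (hs : s ≠ 0) (hD : ∀ a, 1 - lam * s * f a = reg q e a)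
    (hq : IsProfile q) (he : e ∈ Ioo (0 : ℝ) 1) :
    kerInt lam f 3 s = (lam * s)⁻¹ ^ 3 * (powInt q (1 / lam + 3) e -
      (3 * powInt q (1 / lam + 2) e - (3 * powInt q (1 / lam + 1) e - powInt q (1 / lam) e))) := by
  have hi := fun r => (hq.continuous_reg_rpow r he).intervalIntegrable (μ := volume) 0 1
  unfold kerInt powInt
  rw [← intervalIntegral.integral_const_mul 3, ← intervalIntegral.integral_const_mul 3,
    ← intervalIntegral.integral_sub ((hi _).const_mul _) (hi _),
    ← intervalIntegral.integral_sub ((hi _).const_mul _) (((hi _).const_mul _).sub (hi _)),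
    ← intervalIntegral.integral_sub (hi _) (((hi _).const_mul _).sub
      (((hi _).const_mul _).sub (hi _))), ← intervalIntegral.integral_const_mul]
  refine intervalIntegral.integral_congr fun a _ => ?_
  simp only [kerInt_integrand_eq hl hs hD hq he, show 1 / lam + 3 = 1 / lam + 1 + 1 + 1 by ring,
    show 1 / lam + 2 = 1 / lam + 1 + 1 by ring, ← reg_inv_mul_rpow hq he]
  ring

/-- Central moments ignore the additive constant in the affine relation; its slope comes out cubed.
-/
theorem cubeOf_eq_cubeMoment (hf : Continuous f) (hl : lam ≠ 0) (hs : s ≠ 0)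
    (hD : ∀ a, 1 - lam * s * f a = reg q e a) (hq : IsProfile q) (he : e ∈ Ioo (0 : ℝ) 1) :
    cubeOf lam f s = (lam * s)⁻¹ ^ 3 * cubeMoment lam q e := by
  have hdom : s ∈ dom lam f := fun a => by rw [hD]; exact hq.reg_pos he a
  have h0 := hq.powInt_pos (1 / lam) he
  rw [cubeOf_eq hf hdom, kerInt_zero_eq_powInt hl hD, kerInt_one_eq hl hs hD hq he,
    kerInt_two_eq hl hs hD hq he, kerInt_three_eq hl hs hD hq he, cubeMoment,
    ← Real.rpow_mul_natCast h0.le,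
    show -(2 * lam) * ((3 : ℕ) : ℝ) = -(6 * lam) by push_cast; ring]
  generalize powInt q (1 / lam) e ^ (-(6 * lam)) = P
  field_simp
  ring

theorem gradMoment_eq_devMoment (hl : lam ≠ 0) (hs : s ≠ 0)
    (hD : ∀ a, 1 - lam * s * f a = reg q e a) (hq : IsProfile q) (he : e ∈ Ioo (0 : ℝ) 1) :
    gradMoment lam f p s = |(lam * s)⁻¹| ^ p * devMoment lam q p e := by
  have h0 := hq.powInt_pos (1 / lam) he
  unfold gradMoment devMoment devInt
  rw [← intervalIntegral.integral_const_mul, ← intervalIntegral.integral_const_mul]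
  refine intervalIntegral.integral_congr fun a _ => ?_
  have hR := (hq.reg_pos he a).ne'
  have h1 : f a / reg q e a = (lam * s)⁻¹ * ((reg q e a)⁻¹ - 1) :=
    div_eq_of_one_sub hl hs (hD a) hR
  have h2 : grad lam f s a = powInt q (1 / lam) e ^ (-(2 * lam)) *
      ((lam * s)⁻¹ * ((reg q e a)⁻¹ - mean q (1 / lam) e)) := by
    rw [grad, kerInt_zero_eq_powInt hl hD, kerInt_one_eq hl hs hD hq he, hD, h1, mean]
    field_simp
    ring
  have h3 : jac lam f s a = reg q e a ^ (-(1 / lam)) / powInt q (1 / lam) e := by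
    rw [jac, kerInt_zero_eq_powInt hl hD, ker, if_neg hl, hD]
  rw [h2, h3, abs_mul, abs_mul, abs_of_pos (Real.rpow_pos_of_pos h0 _),
    Real.mul_rpow (Real.rpow_nonneg h0.le _) (by positivity),
    Real.mul_rpow (abs_nonneg _) (abs_nonneg _), ← Real.rpow_mul h0.le,
    show -(2 * lam * p + 1) = -(2 * lam) * p - 1 by ring, Real.rpow_sub_one h0.ne']
  ring

end
end ProudmanJohnson

/-! ### Limits at the end of the parameter range -/

namespace ProudmanJohnson
noncomputable section

variable {lam : ℝ} {f u0 q : ℝ → ℝ} {M S e s p : ℝ} {T b : EReal} {θ : ℝ → ℝ}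

theorem upTo_coe (x : ℝ) : upTo (x : EReal) = 𝓝[<] x := by simp [upTo]

/-- Describes finite and infinite end times alike, so that the changes of variable need no case
distinction. -/
theorem eventually_upTo (hT : 0 < T) {P : ℝ → Prop} :
    (∀ᶠ t in upTo T, P t) ↔ ∃ c ∈ timeInterval T, ∀ t ∈ timeInterval T, c < t → P t := by
  induction T with
  | bot => simp at hT
  | top =>
    have h1 : ∀ t, t ∈ timeInterval ⊤ ↔ 0 ≤ t := fun t => by simp [timeInterval]
    simp only [upTo, if_true, h1]
    constructor
    · intro h
      obtain ⟨c, hc⟩ := eventually_atTop.1 h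
      exact ⟨max c 0, le_max_right _ _, fun t _ ht => hc t ((le_max_left _ _).trans ht.le)⟩
    · rintro ⟨c, hc, h⟩
      filter_upwards [eventually_gt_atTop c] with t ht using h t (hc.trans ht.le) ht
  | coe r =>
    have hr : 0 < r := EReal.coe_pos.1 hT
    have h1 : ∀ t, t ∈ timeInterval (r : EReal) ↔ 0 ≤ t ∧ t < r := fun t => by simp [timeInterval]
    simp only [upTo_coe, h1]
    constructor
    · intro h
      obtain ⟨l, hl, hlr⟩ := (mem_nhdsLT_iff_exists_Ioo_subset' hr).1 h
      exact ⟨max l 0, ⟨le_max_right _ _, max_lt hl hr⟩, fun t ht hct =>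
        hlr ⟨(le_max_left _ _).trans_lt hct, ht.2⟩⟩
    · rintro ⟨c, hc, h⟩
      filter_upwards [Ioo_mem_nhdsLT hc.2] with t ht using h t ⟨hc.1.trans ht.1.le, ht.2⟩ ht.1

theorem eventually_mem_timeInterval (hT : 0 < T) : ∀ᶠ t in upTo T, t ∈ timeInterval T :=
  (eventually_upTo hT).2 ⟨0, ⟨le_rfl, hT⟩, fun _ ht _ => ht⟩

theorem upTo_neBot (T : EReal) : (upTo T).NeBot := by
  unfold upTo
  split_ifs <;> infer_instance

theorem exists_gt_mem_timeInterval (hs : s ∈ timeInterval b) : ∃ s' ∈ timeInterval b, s < s' := by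
  obtain ⟨x, h1, h2⟩ := EReal.lt_iff_exists_real_btwn.1 hs.2
  exact ⟨x, ⟨hs.1.trans (EReal.coe_lt_coe_iff.1 h1).le, h2⟩, EReal.coe_lt_coe_iff.1 h1⟩

/-- A change of time is a bijection of the intervals, up to the supremum of its values. -/
theorem timeInterval_eq_image (hb : 0 < b) (hc : ContinuousOn θ (timeInterval b))
    (hm : StrictMonoOn θ (timeInterval b)) (h0 : θ 0 = 0) :
    timeInterval (⨆ s ∈ timeInterval b, (θ s : EReal)) = θ '' timeInterval b := by
  have hz : (0 : ℝ) ∈ timeInterval b := ⟨le_rfl, hb⟩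
  ext t
  constructor
  · rintro ⟨ht0, ht⟩
    obtain ⟨s, hs⟩ := lt_iSup_iff.1 ht
    obtain ⟨hsb, hts⟩ := lt_iSup_iff.1 hs
    have hsub : Icc 0 s ⊆ timeInterval b := fun r hr => mem_timeInterval_of_le hsb hr.1 hr.2
    obtain ⟨r, hr, rfl⟩ := intermediate_value_Icc hsb.1 (hc.mono hsub)
      (show t ∈ Icc (θ 0) (θ s) from ⟨h0.le.trans ht0, (EReal.coe_lt_coe_iff.1 hts).le⟩)
    exact ⟨r, hsub hr, rfl⟩
  · rintro ⟨s, hs, rfl⟩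
    obtain ⟨s', hs', hlt⟩ := exists_gt_mem_timeInterval hs
    refine ⟨h0.ge.trans (hm.monotoneOn hz hs hs.1), ?_⟩
    exact (EReal.coe_lt_coe_iff.2 (hm hs hs' hlt)).trans_le
      (le_iSup₂ (f := fun s (_ : s ∈ timeInterval b) => (θ s : EReal)) s' hs')

/-- Transfers limits at the end of the parameter range to limits at the end of the time interval. -/
theorem tendsto_upTo_inverse {ψ : ℝ → ℝ} (hb : 0 < b) (hc : ContinuousOn θ (timeInterval b))
    (hm : StrictMonoOn θ (timeInterval b)) (h0 : θ 0 = 0)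
    (hψ : ∀ s ∈ timeInterval b, ψ (θ s) = s)
    (hT : 0 < ⨆ s ∈ timeInterval b, (θ s : EReal)) :
    Tendsto ψ (upTo (⨆ s ∈ timeInterval b, (θ s : EReal))) (upTo b) := by
  intro P hP
  obtain ⟨c, hc1, hcP⟩ := (eventually_upTo hb).1 hP
  refine (eventually_upTo hT).2 ?_
  rw [timeInterval_eq_image hb hc hm h0]
  refine ⟨θ c, mem_image_of_mem _ hc1, ?_⟩
  rintro _ ⟨s, hs, rfl⟩ hlt
  rw [hψ s hs]
  exact hcP s hs ((hm.lt_iff_lt hc1 hs).1 hlt)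

/-- The end of the range of the parameter. -/
def endParam (lam : ℝ) (u0 : ℝ → ℝ) : EReal := if lam = 0 then ⊤ else (etaStar lam u0 : EReal)

namespace IsExtremum

theorem ne_zero (h : IsExtremum lam u0 M S) : lam ≠ 0 := left_ne_zero_of_mul h.pos.ne'

theorem etaStar_pos (h : IsExtremum lam u0 M S) : 0 < etaStar lam u0 := by
  rw [h.etaStar_eq]; exact one_div_pos.2 h.pos

theorem endParam_eq (h : IsExtremum lam u0 M S) : endParam lam u0 = (etaStar lam u0 : EReal) :=
  if_neg h.ne_zero

theorem lt_etaStar_iff (h : IsExtremum lam u0 M S) : s < etaStar lam u0 ↔ lam * M * s < 1 := by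
  rw [h.etaStar_eq, lt_div_iff₀ h.pos, mul_comm]

theorem mem_dom_iff (h : IsExtremum lam u0 M S) (hs : 0 ≤ s) :
    s ∈ dom lam (deriv u0) ↔ s < etaStar lam u0 := by
  rw [h.lt_etaStar_iff]
  constructor
  · intro hd
    obtain ⟨a, ha⟩ := h.attained
    have := hd a
    rw [ha] at this
    linarith
  · intro hs1 a
    nlinarith [mul_le_mul_of_nonneg_left (h.le a) hs]

theorem one_sub_eq_reg (h : IsExtremum lam u0 M S) (s a : ℝ) :
    1 - lam * s * deriv u0 a = reg (fun a => 1 - deriv u0 a / M) (1 - lam * M * s) a := by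
  have : M ≠ 0 := right_ne_zero_of_mul h.pos.ne'
  unfold reg
  field_simp
  ring

theorem gap_mem (h : IsExtremum lam u0 M S) (hs : s ∈ Ioo 0 (etaStar lam u0)) :
    1 - lam * M * s ∈ Ioo (0 : ℝ) 1 := by
  have h1 := h.lt_etaStar_iff.1 hs.2
  have h2 := mul_pos h.pos hs.1
  constructor <;> linarith

theorem tendsto_gap (h : IsExtremum lam u0 M S) :
    Tendsto (fun s => 1 - lam * M * s) (𝓝[<] etaStar lam u0) (𝓝[>] 0) := by
  refine tendsto_nhdsWithin_iff.2 ⟨?_, ?_⟩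
  · have : Tendsto (fun s => 1 - lam * M * s) (𝓝 (etaStar lam u0))
        (𝓝 (1 - lam * M * etaStar lam u0)) := by
      apply Continuous.tendsto; fun_prop
    rw [h.etaStar_eq, mul_one_div_cancel h.pos.ne', sub_self, ← h.etaStar_eq] at this
    exact this.mono_left nhdsWithin_le_nhds
  · filter_upwards [self_mem_nhdsWithin] with s hs
    have := h.lt_etaStar_iff.1 hs
    simp only [mem_Ioi]; linarith

theorem eventually_mem (h : IsExtremum lam u0 M S) :
    ∀ᶠ s in 𝓝[<] etaStar lam u0, s ∈ Ioo 0 (etaStar lam u0) := Ioo_mem_nhdsLT h.etaStar_pos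

theorem tendsto_factor (h : IsExtremum lam u0 M S) :
    Tendsto (fun s => (lam * s)⁻¹) (𝓝[<] etaStar lam u0) (𝓝 M) := by
  have hl := h.ne_zero
  have he := h.etaStar_pos.ne'
  have hM : M ≠ 0 := right_ne_zero_of_mul h.pos.ne'
  have h1 : (lam * etaStar lam u0)⁻¹ = M := by rw [h.etaStar_eq]; field_simp
  have : ContinuousAt (fun s => (lam * s)⁻¹) (etaStar lam u0) :=
    ContinuousAt.inv₀ (by fun_prop) (mul_ne_zero hl he)
  have h2 := this.tendsto
  rw [h1] at h2
  exact h2.mono_left nhdsWithin_le_nhds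

theorem gradMoment_eventuallyEq (h : IsExtremum lam u0 M S) (p : ℝ) :
    (fun s => |(lam * s)⁻¹| ^ p * devMoment lam (fun a => 1 - deriv u0 a / M) p (1 - lam * M * s))
      =ᶠ[𝓝[<] etaStar lam u0] gradMoment lam (deriv u0) p := by
  filter_upwards [h.eventually_mem] with s hs
  exact (gradMoment_eq_devMoment h.ne_zero hs.1.ne' (h.one_sub_eq_reg s)
    h.weighted.toIsProfile (h.gap_mem hs)).symm

theorem tendsto_factor_rpow (h : IsExtremum lam u0 M S) (p : ℝ) :
    Tendsto (fun s => |(lam * s)⁻¹| ^ p) (𝓝[<] etaStar lam u0) (𝓝 (|M| ^ p)) :=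
  h.tendsto_factor.abs.rpow_const
    (Or.inl (abs_pos.2 (right_ne_zero_of_mul h.pos.ne')).ne')

theorem tendsto_gradMoment_of_nhds (h : IsExtremum lam u0 M S) {L : ℝ}
    (hL : Tendsto (devMoment lam (fun a => 1 - deriv u0 a / M) p) (𝓝[>] 0) (𝓝 L)) :
    ∃ L', Tendsto (gradMoment lam (deriv u0) p) (𝓝[<] etaStar lam u0) (𝓝 L') :=
  ⟨_, ((h.tendsto_factor_rpow p).mul (hL.comp h.tendsto_gap)).congr' (h.gradMoment_eventuallyEq p)⟩

theorem tendsto_gradMoment_of_atTop (h : IsExtremum lam u0 M S)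
    (hL : Tendsto (devMoment lam (fun a => 1 - deriv u0 a / M) p) (𝓝[>] 0) atTop) :
    Tendsto (gradMoment lam (deriv u0) p) (𝓝[<] etaStar lam u0) atTop :=
  ((h.tendsto_factor_rpow p).pos_mul_atTop
    (Real.rpow_pos_of_pos (abs_pos.2 (right_ne_zero_of_mul h.pos.ne')) _)
    (hL.comp h.tendsto_gap)).congr' (h.gradMoment_eventuallyEq p)

/-- For λ < 0 the lower bound on λ says p + 1/λ < 1/2, the convergent regime. For 0 < λ ≤ 1 the
exact order e^(p(1−λ)) gives limit 0 if λ < 1 and a positive constant if λ = 1. -/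
theorem exists_tendsto_gradMoment (h : IsExtremum lam u0 M S) (hp : 1 ≤ p)
    (hl : 2 / (1 - 2 * p) < lam) (hl1 : lam ≤ 1) :
    ∃ L, Tendsto (gradMoment lam (deriv u0) p) (𝓝[<] etaStar lam u0) (𝓝 L) := by
  rcases h.ne_zero.lt_or_gt with h0 | h0
  · rw [div_lt_iff_of_neg (by linarith)] at hl
    obtain ⟨L, hL⟩ := h.weighted.exists_tendsto_devMoment_of_neg h0 hp (by
      have : 1 / lam * lam = 1 := one_div_mul_cancel h.ne_zero
      nlinarith)
    exact h.tendsto_gradMoment_of_nhds hL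
  · obtain ⟨A, -, hA⟩ := h.weighted.exists_tendsto_devMoment (p := p) h0 (by linarith) (by linarith)
    rcases hl1.eq_or_lt with rfl | hl1
    · simp only [sub_self, mul_zero, neg_zero, Real.rpow_zero, one_mul] at hA
      exact h.tendsto_gradMoment_of_nhds hA
    · have hpos : 0 < p * (1 - lam) := mul_pos (by linarith) (by linarith)
      refine h.tendsto_gradMoment_of_nhds (((tendsto_rpow_nhdsGT_zero hpos).mul hA).congr' ?_)
      filter_upwards [eventually_mem_Ioo one_pos] with e he
      rw [← mul_assoc, ← Real.rpow_add he.1, add_neg_cancel, Real.rpow_zero, one_mul]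

theorem tendsto_gradMoment_atTop (h : IsExtremum lam u0 M S) (hp : 1 < p)
    (hl : 1 < lam ∨ lam < 0 ∧ 1 / 2 ≤ p + 1 / lam) :
    Tendsto (gradMoment lam (deriv u0) p) (𝓝[<] etaStar lam u0) atTop := by
  rcases hl with hl | ⟨hl, hpl⟩
  · rcases lt_or_ge lam 2 with h2 | h2
    · obtain ⟨A, hA0, hA⟩ := h.weighted.exists_tendsto_devMoment (p := p)
        (by linarith) h2 (by linarith)
      refine h.tendsto_gradMoment_of_atTop (((tendsto_rpow_neg_nhdsGT_zero
        (σ := p * (lam - 1)) (by nlinarith)).atTop_mul_pos hA0 hA).congr' ?_)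
      filter_upwards [eventually_mem_Ioo one_pos] with e he
      rw [← mul_assoc, ← Real.rpow_add he.1,
        show -(p * (lam - 1)) + -(p * (1 - lam)) = 0 by ring, Real.rpow_zero, one_mul]
    · exact h.tendsto_gradMoment_of_atTop (h.weighted.tendsto_devMoment_of_two_le h2 (by linarith))
  · exact h.tendsto_gradMoment_of_atTop (h.weighted.tendsto_devMoment_of_neg hl hp hpl)

theorem cubeOf_eventuallyEq (h0 : IsAdmissible lam u0) (h : IsExtremum lam u0 M S) :
    (fun s => (lam * s)⁻¹ ^ 3 * cubeMoment lam (fun a => 1 - deriv u0 a / M) (1 - lam * M * s))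
      =ᶠ[𝓝[<] etaStar lam u0] cubeOf lam (deriv u0) := by
  filter_upwards [h.eventually_mem] with s hs
  exact (cubeOf_eq_cubeMoment (continuous_deriv_data h0) h.ne_zero hs.1.ne' (h.one_sub_eq_reg s)
    h.weighted.toIsProfile (h.gap_mem hs)).symm

theorem tendsto_cubeOf_atTop (h0 : IsAdmissible lam u0) (h : IsExtremum lam u0 M S)
    (hl : 1 < lam) : Tendsto (cubeOf lam (deriv u0)) (𝓝[<] etaStar lam u0) atTop := by
  have hM : 0 < M := (pos_iff_pos_of_mul_pos h.pos).1 (by linarith)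
  have hc : Tendsto (cubeMoment lam fun a => 1 - deriv u0 a / M) (𝓝[>] 0) atTop := by
    rcases lt_or_ge lam 2 with h2 | h2
    · exact h.weighted.tendsto_cubeMoment_of_lt_two hl h2
    · exact h.weighted.tendsto_cubeMoment_of_two_le h2
  exact ((h.tendsto_factor.pow 3).pos_mul_atTop (by positivity)
    (hc.comp h.tendsto_gap)).congr' (cubeOf_eventuallyEq h0 h)

/-- The profile moment still tends to +∞, but for λ < 0 the factor 1/(λs) tends to M < 0 and its
cube reverses the sign. -/
theorem tendsto_cubeOf_atBot (h0 : IsAdmissible lam u0) (h : IsExtremum lam u0 M S)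
    (hl : lam < 0) (hl3 : 1 / 2 ≤ 1 / lam + 3) :
    Tendsto (cubeOf lam (deriv u0)) (𝓝[<] etaStar lam u0) atBot := by
  have hM : M < 0 := (neg_iff_neg_of_mul_pos h.pos).1 hl
  exact ((h.tendsto_factor.pow 3).neg_mul_atTop (Odd.pow_neg (by decide) hM)
    ((h.weighted.tendsto_cubeMoment_of_neg hl hl3).comp h.tendsto_gap)).congr'
    (cubeOf_eventuallyEq h0 h)

theorem timeOf_eq (h : IsExtremum lam u0 M S) (hs : s ∈ Ioo 0 (etaStar lam u0)) :
    timeOfEta lam u0 s = timeOf lam (deriv u0) s := by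
  unfold timeOfEta timeOf
  refine intervalIntegral.integral_congr fun r hr => ?_
  rw [uIcc_of_le hs.1.le] at hr
  have hd := (h.mem_dom_iff hr.1).2 (hr.2.trans_lt hs.2)
  refine congrArg (· ^ (2 * lam)) ?_
  refine intervalIntegral.integral_congr fun a _ => ?_
  simp [ker, h.ne_zero, Real.rpow_neg (hd a).le]

/-- The derivative of the time with respect to the parameter. -/
theorem hasDerivAt_time (h0 : IsAdmissible lam u0) (h : IsExtremum lam u0 M S)
    (hs : s ∈ Ioo 0 (etaStar lam u0)) : HasDerivAt (timeOf lam (deriv u0))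
      (powInt (fun a => 1 - deriv u0 a / M) (1 / lam) (1 - lam * M * s) ^ (2 * lam)) s := by
  rw [← kerInt_zero_eq_powInt h.ne_zero (h.one_sub_eq_reg s)]
  exact hasDerivAt_timeOf (continuous_deriv_data h0) (periodic_deriv h0.periodic)
    ((h.mem_dom_iff hs.1.le).2 hs.2)

theorem exists_time_le (h0 : IsAdmissible lam u0) (h : IsExtremum lam u0 M S)
    (hl : lam < 0 ∨ 1 < lam) :
    ∃ B, ∀ᶠ s in 𝓝[<] etaStar lam u0, timeOf lam (deriv u0) s ≤ B := by
  obtain ⟨ρ, hρ, hb⟩ := h.weighted.exists_rpow_bound hl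
  have hev := (h.tendsto_gap.eventually hb).and h.eventually_mem
  obtain ⟨l, hl0, hlr⟩ := (mem_nhdsLT_iff_exists_Ioo_subset' h.etaStar_pos).1 hev
  obtain ⟨c, hc1, hc2⟩ := exists_between (mem_Iio.1 hl0)
  have hρ' : 0 < 1 - ρ := by linarith
  -- The added term has derivative −e^(−ρ), which dominates the density of time, so φ decreases;
  -- since ρ < 1 the term is a positive power of `e` and can be dropped from the bound.
  set φ : ℝ → ℝ := fun s => timeOf lam (deriv u0) s +
    (lam * M)⁻¹ * (1 - ρ)⁻¹ * (1 - lam * M * s) ^ (1 - ρ) with hφ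
  have hder : ∀ s ∈ Ico c (etaStar lam u0), HasDerivAt φ
      (powInt (fun a => 1 - deriv u0 a / M) (1 / lam) (1 - lam * M * s) ^ (2 * lam)
        - (1 - lam * M * s) ^ (-ρ)) s := by
    intro s hs
    have hs' := hlr ⟨hc1.trans_le hs.1, hs.2⟩
    have hg := (h.gap_mem hs'.2).1
    have h1 : HasDerivAt (fun s => 1 - lam * M * s) (-(lam * M)) s := by
      simpa using ((hasDerivAt_id s).const_mul (lam * M)).const_sub 1
    refine ((h.hasDerivAt_time h0 hs'.2).add
      ((h1.rpow_const (p := 1 - ρ) (Or.inl hg.ne')).const_mul _)).congr_deriv ?_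
    have := h.pos.ne'
    rw [show 1 - ρ - 1 = -ρ by ring]
    generalize powInt _ (1 / lam) (1 - lam * M * s) ^ (2 * lam) = P
    generalize 1 - lam * M * s = e at *
    generalize lam * M = L at *
    field_simp
    ring
  have hanti : AntitoneOn φ (Ico c (etaStar lam u0)) := by
    refine antitoneOn_of_deriv_nonpos (convex_Ico _ _)
      (fun s hs => (hder s hs).continuousAt.continuousWithinAt)
      (fun s hs => (hder s (interior_subset hs)).differentiableAt.differentiableWithinAt)
      fun s hs => ?_
    have hs := interior_subset hs
    rw [(hder s hs).deriv]
    exact sub_nonpos.2 (hlr ⟨hc1.trans_le hs.1, hs.2⟩).1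
  refine ⟨φ c, ?_⟩
  filter_upwards [Ioo_mem_nhdsLT hc2] with s hs
  refine le_trans ?_ (hanti (left_mem_Ico.2 hc2) (Ioo_subset_Ico_self hs) hs.1.le)
  have hg := (h.gap_mem (hlr ⟨hc1.trans hs.1, hs.2⟩).2).1
  have := h.pos
  rw [hφ]
  exact le_add_of_nonneg_right (by positivity)

theorem tendsto_time_atTop (h0 : IsAdmissible lam u0) (h : IsExtremum lam u0 M S)
    (hl : 0 < lam) (hl1 : lam ≤ 1) :
    Tendsto (timeOf lam (deriv u0)) (𝓝[<] etaStar lam u0) atTop := by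
  obtain ⟨k, hk, hb⟩ := h.weighted.exists_lower_bound hl hl1
  have hev := (h.tendsto_gap.eventually hb).and h.eventually_mem
  obtain ⟨l, hl0, hlr⟩ := (mem_nhdsLT_iff_exists_Ioo_subset' h.etaStar_pos).1 hev
  obtain ⟨c, hc1, hc2⟩ := exists_between (mem_Iio.1 hl0)
  -- The logarithm subtracts the lower bound k/e from the density of time, so φ increases and the
  -- time grows at least like −log e.
  set φ : ℝ → ℝ := fun s => timeOf lam (deriv u0) s +
    (lam * M)⁻¹ * k * Real.log (1 - lam * M * s) with hφ
  have hder : ∀ s ∈ Ico c (etaStar lam u0), HasDerivAt φ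
      (powInt (fun a => 1 - deriv u0 a / M) (1 / lam) (1 - lam * M * s) ^ (2 * lam)
        - k * (1 - lam * M * s)⁻¹) s := by
    intro s hs
    have hs' := hlr ⟨hc1.trans_le hs.1, hs.2⟩
    have hg := (h.gap_mem hs'.2).1
    have h1 : HasDerivAt (fun s => 1 - lam * M * s) (-(lam * M)) s := by
      simpa using ((hasDerivAt_id s).const_mul (lam * M)).const_sub 1
    refine ((h.hasDerivAt_time h0 hs'.2).add ((h1.log hg.ne').const_mul _)).congr_deriv ?_
    have := h.pos.ne'
    have := hg.ne'
    generalize powInt _ (1 / lam) (1 - lam * M * s) ^ (2 * lam) = P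
    generalize 1 - lam * M * s = e at *
    generalize lam * M = L at *
    field_simp
    ring
  have hmono : MonotoneOn φ (Ico c (etaStar lam u0)) := by
    refine monotoneOn_of_deriv_nonneg (convex_Ico _ _)
      (fun s hs => (hder s hs).continuousAt.continuousWithinAt)
      (fun s hs => (hder s (interior_subset hs)).differentiableAt.differentiableWithinAt)
      fun s hs => ?_
    have hs := interior_subset hs
    rw [(hder s hs).deriv]
    exact sub_nonneg.2 (hlr ⟨hc1.trans_le hs.1, hs.2⟩).1
  have hlog := (Real.tendsto_log_nhdsGT_zero.comp h.tendsto_gap).const_mul_atBot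
    (show 0 < (lam * M)⁻¹ * k from mul_pos (inv_pos.2 h.pos) hk)
  refine tendsto_atTop_mono' _ ?_ (tendsto_atTop_add_const_left _ (φ c)
    (tendsto_neg_atBot_atTop.comp hlog))
  filter_upwards [Ioo_mem_nhdsLT hc2] with s hs
  have := hmono (left_mem_Ico.2 hc2) (Ioo_subset_Ico_self hs) hs.1.le
  simp only [Function.comp]
  simp only [hφ] at this ⊢
  linarith

end IsExtremum

end
end ProudmanJohnson

/-! ### The case of exponential tilting, and the time `tStar` -/

namespace ProudmanJohnson
noncomputable section

variable {lam : ℝ} {f u0 : ℝ → ℝ} {s p : ℝ}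

/-- By continuity f exceeds `v` on a whole interval inside (0, 1), also when the point itself is an
endpoint. -/
theorem kerInt_exp_lower (hf : Continuous f) {a : ℝ} (ha : a ∈ Icc (0 : ℝ) 1) {v : ℝ}
    (hv : v < f a) : ∃ c > 0, ∀ s ≥ 0, c * Real.exp (s * v) ≤ kerInt 0 f 0 s := by
  have hU : IsOpen (f ⁻¹' Ioi v) := isOpen_Ioi.preimage hf
  have hcl : a ∈ closure (Ioo (0 : ℝ) 1) := by rwa [closure_Ioo zero_ne_one]
  obtain ⟨b, hb⟩ := mem_closure_iff.1 hcl _ hU hv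
  obtain ⟨δ, hδ, hball⟩ := Metric.isOpen_iff.1 (hU.inter isOpen_Ioo) b hb
  have hsub : Icc (b - δ / 2) (b + δ / 2) ⊆ f ⁻¹' Ioi v ∩ Ioo 0 1 := fun x hx => hball <| by
    rw [Real.ball_eq_Ioo]; constructor <;> linarith [hx.1, hx.2]
  have h1 := hsub (left_mem_Icc.2 (by linarith))
  have h2 := hsub (right_mem_Icc.2 (by linarith))
  refine ⟨δ, hδ, fun s hs => ?_⟩
  have hc : Continuous fun a => Real.exp (s * f a) := by fun_prop
  calc δ * Real.exp (s * v) = ∫ _ in (b - δ / 2)..(b + δ / 2), Real.exp (s * v) := by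
        rw [intervalIntegral.integral_const, smul_eq_mul]; ring
    _ ≤ ∫ a in (b - δ / 2)..(b + δ / 2), Real.exp (s * f a) := by
        refine intervalIntegral.integral_mono_on (by linarith) (by simp)
          (hc.intervalIntegrable _ _) fun x hx => ?_
        exact Real.exp_le_exp.2 (mul_le_mul_of_nonneg_left (hsub hx).1.le hs)
    _ ≤ ∫ a in (0 : ℝ)..1, Real.exp (s * f a) := by
        refine intervalIntegral.integral_mono_interval h1.2.1.le (by linarith) h2.2.2.le
          (Eventually.of_forall fun x => (Real.exp_pos _).le) (hc.intervalIntegrable _ _)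
    _ = kerInt 0 f 0 s := by simp [kerInt, ker]

theorem mem_dom_zero (s : ℝ) : s ∈ dom 0 f := fun a => by simp

/-- Under exponential tilting the mean converges to the greatest value. -/
theorem tendsto_tilted_mean (hf : Continuous f) {a : ℝ} (ha : a ∈ Icc (0 : ℝ) 1)
    (hmax : ∀ x, f x ≤ f a) :
    Tendsto (fun s => kerInt 0 f 1 s / kerInt 0 f 0 s) atTop (𝓝 (f a)) := by
  obtain ⟨B, hB⟩ := (isCompact_Icc (a := (0 : ℝ)) (b := 1)).exists_bound_of_continuousOn
    hf.continuousOn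
  have hB' : ∀ x ∈ Icc (0 : ℝ) 1, f a - f x ≤ 2 * B := fun x hx => by
    have h1 := abs_le.1 (hB x hx)
    have h2 := abs_le.1 (hB a ha)
    linarith [h1.1, h2.2]
  have hB0 : 0 ≤ B := (norm_nonneg _).trans (hB a ha)
  have hk0 : ∀ s, 0 < kerInt 0 f 0 s := fun s => kerInt_pos hf (mem_dom_zero s)
  have hi := fun j s => (continuous_kerInt_integrand hf j (mem_dom_zero s)).intervalIntegrable
    (μ := volume) 0 1
  have hup : ∀ s, kerInt 0 f 1 s / kerInt 0 f 0 s ≤ f a := fun s => by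
    rw [div_le_iff₀ (hk0 s)]
    unfold kerInt
    rw [← intervalIntegral.integral_const_mul]
    refine intervalIntegral.integral_mono_on zero_le_one (hi 1 s) ((hi 0 s).const_mul _)
      fun x _ => ?_
    simpa [ker] using mul_le_mul_of_nonneg_right (hmax x) (Real.exp_pos _).le
  refine tendsto_order.2 ⟨fun v hv => ?_, fun v hv => Eventually.of_forall fun s =>
    (hup s).trans_lt hv⟩
  set δ := (f a - v) / 2 with hδ
  have hδ0 : 0 < δ := by simp only [hδ]; linarith
  -- Points where f is below its maximum by more than δ contribute at most a multiple of exp(s(f a −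
  -- δ)), which loses against a normalization of size at least exp(s(f a − δ/2)).
  obtain ⟨c, hc, hlow⟩ := kerInt_exp_lower hf ha (v := f a - δ / 2) (by linarith)
  have hexp : Tendsto (fun s : ℝ => 2 * B / c * Real.exp (-(s * (δ / 2)))) atTop (𝓝 0) := by
    have := (Real.tendsto_exp_neg_atTop_nhds_zero.comp
      (tendsto_id.atTop_mul_const (half_pos hδ0))).const_mul (2 * B / c)
    simpa using this
  filter_upwards [hexp.eventually (gt_mem_nhds hδ0), eventually_ge_atTop 0] with s hs hs0
  have key : (f a - δ) * kerInt 0 f 0 s - 2 * B * Real.exp (s * (f a - δ)) ≤ kerInt 0 f 1 s := by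
    have : (f a - δ) * kerInt 0 f 0 s - 2 * B * Real.exp (s * (f a - δ)) =
        ∫ x in (0 : ℝ)..1, ((f a - δ) * (f x ^ 0 * ker 0 s (f x) / (1 - 0 * s * f x) ^ 0) -
          2 * B * Real.exp (s * (f a - δ))) := by
      rw [intervalIntegral.integral_sub ((hi 0 s).const_mul _) (by simp),
        intervalIntegral.integral_const_mul]
      simp [kerInt]
    rw [this]
    refine intervalIntegral.integral_mono_on zero_le_one
      (((hi 0 s).const_mul _).sub (by simp)) (hi 1 s) fun x hx => ?_
    have h3 := (Real.exp_pos (s * f x)).le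
    simp only [ker, if_true, pow_zero, pow_one, one_mul, zero_mul, sub_zero, div_one]
    rcases le_total (f a - δ) (f x) with h | h
    · have := mul_le_mul_of_nonneg_right h h3
      have : 0 ≤ 2 * B * Real.exp (s * (f a - δ)) := by positivity
      linarith
    · have h4 : Real.exp (s * f x) ≤ Real.exp (s * (f a - δ)) :=
        Real.exp_le_exp.2 (mul_le_mul_of_nonneg_left h hs0)
      have h5 : (f a - δ - f x) * Real.exp (s * f x) ≤ 2 * B * Real.exp (s * (f a - δ)) :=
        mul_le_mul (by linarith [hB' x hx]) h4 h3 (by positivity)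
      linarith
  have h6 : 2 * B * Real.exp (s * (f a - δ)) < δ * kerInt 0 f 0 s := by
    have h7 : Real.exp (s * (f a - δ)) =
        Real.exp (-(s * (δ / 2))) * Real.exp (s * (f a - δ / 2)) := by
      rw [← Real.exp_add]; ring_nf
    rw [h7]
    calc _ = 2 * B / c * Real.exp (-(s * (δ / 2))) * (c * Real.exp (s * (f a - δ / 2))) := by
          field_simp
      _ < δ * (c * Real.exp (s * (f a - δ / 2))) := by gcongr
      _ ≤ _ := by gcongr; exact hlow s hs0
  rw [lt_div_iff₀ (hk0 s)]
  have h8 : v = f a - δ - δ := by rw [hδ]; ring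
  rw [h8]
  linarith

theorem grad_zero (s a : ℝ) : grad 0 f s a = f a - kerInt 0 f 1 s / kerInt 0 f 0 s := by
  simp [grad]

theorem gradMoment_nonneg (hf : Continuous f) (hs : s ∈ dom lam f) : 0 ≤ gradMoment lam f p s :=
  intervalIntegral.integral_nonneg zero_le_one fun a _ =>
    mul_nonneg (Real.rpow_nonneg (abs_nonneg _) _) (jac_pos hf hs a).le

/-- The gradient is uniformly bounded once the tilted mean is near the maximum, so the p-th moment
is controlled by the first. The latter is at most the mean of max f − f plus the distance of the
mean from max f, and both tend to 0. -/
theorem tendsto_gradMoment_zero (hf : Continuous f) (hper : Function.Periodic f 1) (hp : 1 ≤ p) :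
    Tendsto (gradMoment 0 f p) atTop (𝓝 0) := by
  obtain ⟨a, ha, hmax'⟩ := exists_isCritical (lam := 1) hf hper
  have hmax : ∀ x, f x ≤ f a := fun x => by simpa using hmax' x
  have hmean := tendsto_tilted_mean hf ha hmax
  obtain ⟨B, hB⟩ := (isCompact_Icc (a := (0 : ℝ)) (b := 1)).exists_bound_of_continuousOn
    hf.continuousOn
  have hB0 : 0 ≤ B := (norm_nonneg _).trans (hB a ha)
  set m : ℝ → ℝ := fun s => kerInt 0 f 1 s / kerInt 0 f 0 s with hm
  have hlim : Tendsto (fun s => (2 * B + 1) ^ (p - 1) * (f a - m s + |f a - m s|)) atTop (𝓝 0) := by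
    have h1 := hmean.const_sub (f a)
    rw [sub_self] at h1
    simpa using (h1.add h1.abs).const_mul ((2 * B + 1) ^ (p - 1))
  have hev : ∀ᶠ s in atTop, |f a - m s| < 1 := by
    have h1 := hmean.const_sub (f a)
    rw [sub_self] at h1
    simpa using h1.abs.eventually (gt_mem_nhds (show |(0 : ℝ)| < 1 by simp))
  refine squeeze_zero' (Eventually.of_forall fun s => gradMoment_nonneg hf (mem_dom_zero s)) ?_ hlim
  filter_upwards [hev] with s hs
  have hdom := mem_dom_zero (f := f) s
  have hj := continuous_jac hf hdom
  have hg := continuous_grad hf hdom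
  have hk0 := kerInt_pos hf hdom
  have hI : ∫ x in (0 : ℝ)..1, ((f a - f x) + |f a - m s|) * jac 0 f s x =
      f a - m s + |f a - m s| := by
    have h2 : ∫ x in (0 : ℝ)..1, f x * jac 0 f s x = m s := by
      simp only [hm, kerInt, jac, ← intervalIntegral.integral_div]
      refine intervalIntegral.integral_congr fun x _ => ?_
      simp [mul_div_assoc]
    have h3 : ∀ x, ((f a - f x) + |f a - m s|) * jac 0 f s x =
        (f a + |f a - m s|) * jac 0 f s x - f x * jac 0 f s x := fun x => by ring
    simp only [h3]
    rw [intervalIntegral.integral_sub ((hj.const_mul _).intervalIntegrable _ _)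
      ((hf.fun_mul hj).intervalIntegrable _ _), intervalIntegral.integral_const_mul,
      integral_jac hf hdom, h2]
    ring
  rw [← hI, ← intervalIntegral.integral_const_mul]
  refine intervalIntegral.integral_mono_on zero_le_one ?_ ?_ fun x hx => ?_
  · exact ((hg.abs.rpow_const fun _ => Or.inr (by linarith)).mul hj).intervalIntegrable _ _
  · exact (continuous_const.mul (((continuous_const.sub hf).add continuous_const).mul
      hj)).intervalIntegrable _ _
  · rw [← mul_assoc]
    refine mul_le_mul_of_nonneg_right ?_ (jac_pos hf hdom x).le
    have h4 : |grad 0 f s x| ≤ (f a - f x) + |f a - m s| := by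
      rw [grad_zero]
      calc |f x - m s| = |-(f a - f x) + (f a - m s)| := by ring_nf
        _ ≤ |-(f a - f x)| + |f a - m s| := abs_add_le _ _
        _ = _ := by rw [abs_neg, abs_of_nonneg (sub_nonneg.2 (hmax x))]
    have h5 : |grad 0 f s x| ≤ 2 * B + 1 := by
      have h1 := abs_le.1 (hB x hx)
      have h2 := abs_le.1 (hB a ha)
      linarith [h1.1, h2.2]
    rcases (abs_nonneg (grad 0 f s x)).eq_or_lt with h6 | h6
    · rw [← h6, Real.zero_rpow (by linarith)]
      exact mul_nonneg (by positivity) (h6.le.trans h4)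
    · calc |grad 0 f s x| ^ p = |grad 0 f s x| ^ (p - 1) * |grad 0 f s x| := by
            rw [Real.rpow_sub_one h6.ne', div_mul_cancel₀ _ h6.ne']
        _ ≤ _ := by gcongr

theorem timeOf_zero_eq (s : ℝ) : timeOf 0 f s = s := by simp [timeOf]

theorem endParam_pos (h0 : IsAdmissible lam u0) : 0 < endParam lam u0 := by
  by_cases hl : lam = 0
  · simp [endParam, hl]
  · obtain ⟨M, S, h⟩ := exists_isExtremum h0 hl
    rw [h.endParam_eq]
    exact_mod_cast h.etaStar_pos

theorem mem_timeInterval_endParam (h0 : IsAdmissible lam u0) :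
    s ∈ timeInterval (endParam lam u0) ↔ 0 ≤ s ∧ s ∈ dom lam (deriv u0) := by
  refine and_congr_right fun hs => ?_
  by_cases hl : lam = 0
  · subst hl; simp [endParam, mem_dom_zero]
  · obtain ⟨M, S, h⟩ := exists_isExtremum h0 hl
    rw [h.endParam_eq, h.mem_dom_iff hs, EReal.coe_lt_coe_iff]

/-- A form valid for all λ. For λ = 0 time equals the parameter and the supremum is infinite;
otherwise adding s = 0 to the range does not change the supremum, as time increases. -/
theorem tStar_eq (h0 : IsAdmissible lam u0) :
    tStar lam u0 = ⨆ s ∈ timeInterval (endParam lam u0), (timeOf lam (deriv u0) s : EReal) := by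
  by_cases hl : lam = 0
  · subst hl
    rw [tStar, if_pos rfl, eq_comm, EReal.eq_top_iff_forall_lt]
    intro y
    refine lt_of_lt_of_le (EReal.coe_lt_coe_iff.2 (lt_add_one y)) ?_
    refine le_trans ?_ (le_iSup₂ (f := fun s (_ : s ∈ timeInterval (endParam 0 u0)) =>
      (timeOf 0 (deriv u0) s : EReal)) (max 0 (y + 1))
      ((mem_timeInterval_endParam h0).2 ⟨le_max_left _ _, mem_dom_zero _⟩))
    rw [timeOf_zero_eq]
    exact EReal.coe_le_coe_iff.2 (le_max_right _ _)
  · obtain ⟨M, S, h⟩ := exists_isExtremum h0 hl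
    rw [tStar, if_neg hl, h.endParam_eq]
    refine le_antisymm (iSup₂_le fun s hs => ?_) (iSup₂_le fun s hs => ?_)
    · rw [h.timeOf_eq hs]
      exact le_iSup₂ (f := fun s (_ : s ∈ timeInterval (etaStar lam u0)) =>
        (timeOf lam (deriv u0) s : EReal)) s ⟨hs.1.le, EReal.coe_lt_coe_iff.2 hs.2⟩
    · obtain ⟨r, hr, hsr⟩ := exists_gt_mem_timeInterval hs
      have hr' : r ∈ Ioo 0 (etaStar lam u0) := ⟨hs.1.trans_lt hsr, EReal.coe_lt_coe_iff.1 hr.2⟩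
      refine le_trans ?_ (le_iSup₂ (f := fun s (_ : s ∈ Ioo 0 (etaStar lam u0)) =>
        (timeOfEta lam u0 s : EReal)) r hr')
      rw [h.timeOf_eq hr']
      refine EReal.coe_le_coe_iff.2 ((strictMonoOn_timeOf (continuous_deriv_data h0)
        (periodic_deriv h0.periodic)).monotoneOn ?_ ?_ hsr.le)
      · exact (h.mem_dom_iff hs.1).2 (hsr.trans hr'.2)
      · exact (h.mem_dom_iff hr'.1.le).2 hr'.2

theorem strictMonoOn_timeOf_endParam (h0 : IsAdmissible lam u0) :
    StrictMonoOn (timeOf lam (deriv u0)) (timeInterval (endParam lam u0)) :=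
  (strictMonoOn_timeOf (continuous_deriv_data h0) (periodic_deriv h0.periodic)).mono
    fun _ hs => ((mem_timeInterval_endParam h0).1 hs).2

theorem continuousOn_timeOf_endParam (h0 : IsAdmissible lam u0) :
    ContinuousOn (timeOf lam (deriv u0)) (timeInterval (endParam lam u0)) := fun _ hs =>
  (hasDerivAt_timeOf (continuous_deriv_data h0) (periodic_deriv h0.periodic)
    ((mem_timeInterval_endParam h0).1 hs).2).continuousAt.continuousWithinAt

theorem tStar_pos (h0 : IsAdmissible lam u0) : 0 < tStar lam u0 := by
  have hz : (0 : ℝ) ∈ timeInterval (endParam lam u0) := ⟨le_rfl, endParam_pos h0⟩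
  obtain ⟨r, hr, hsr⟩ := exists_gt_mem_timeInterval hz
  have h1 := strictMonoOn_timeOf_endParam h0 hz hr hsr
  rw [timeOf_zero] at h1
  rw [tStar_eq h0]
  exact (EReal.coe_lt_coe_iff.2 h1).trans_le
    (le_iSup₂ (f := fun s (_ : s ∈ timeInterval (endParam lam u0)) =>
      (timeOf lam (deriv u0) s : EReal)) r hr)

theorem timeInterval_tStar (h0 : IsAdmissible lam u0) :
    timeInterval (tStar lam u0) = timeOf lam (deriv u0) '' timeInterval (endParam lam u0) := by
  rw [tStar_eq h0]
  exact timeInterval_eq_image (endParam_pos h0) (continuousOn_timeOf_endParam h0)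
    (strictMonoOn_timeOf_endParam h0) timeOf_zero

theorem tendsto_paramOf (h0 : IsAdmissible lam u0) :
    Tendsto (paramOf lam (deriv u0)) (upTo (tStar lam u0)) (upTo (endParam lam u0)) := by
  have h1 := tStar_pos h0
  rw [tStar_eq h0] at h1 ⊢
  exact tendsto_upTo_inverse (endParam_pos h0) (continuousOn_timeOf_endParam h0)
    (strictMonoOn_timeOf_endParam h0) timeOf_zero (fun s hs => paramOf_timeOf
      (continuous_deriv_data h0) (periodic_deriv h0.periodic)
      ((mem_timeInterval_endParam h0).1 hs).2) h1

theorem tStar_eq_top_iff (h0 : IsAdmissible lam u0) :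
    tStar lam u0 = ⊤ ↔ lam ∈ Icc (0 : ℝ) 1 := by
  by_cases hl : lam = 0
  · simp [tStar, hl]
  obtain ⟨M, S, h⟩ := exists_isExtremum h0 hl
  have hle : ∀ s ∈ timeInterval (etaStar lam u0 : EReal),
      (timeOf lam (deriv u0) s : EReal) ≤ tStar lam u0 := fun s hs => by
    rw [tStar_eq h0, h.endParam_eq]
    exact le_iSup₂ (f := fun s (_ : s ∈ timeInterval (etaStar lam u0 : EReal)) =>
      (timeOf lam (deriv u0) s : EReal)) s hs
  have hpos : (0 : EReal) < (etaStar lam u0 : EReal) := EReal.coe_pos.2 h.etaStar_pos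
  constructor
  · intro htop
    by_contra hcon
    have hl' : lam < 0 ∨ 1 < lam := by
      rcases lt_or_ge lam 0 with h1 | h1
      · exact Or.inl h1
      · exact Or.inr (not_le.1 fun h2 => hcon ⟨h1, h2⟩)
    obtain ⟨B, hB⟩ := h.exists_time_le h0 hl'
    rw [← upTo_coe] at hB
    obtain ⟨c, hc, hcB⟩ := (eventually_upTo hpos).1 hB
    have : tStar lam u0 ≤ B := by
      rw [tStar_eq h0, h.endParam_eq]
      refine iSup₂_le fun s hs => EReal.coe_le_coe_iff.2 ?_
      rcases lt_or_ge c s with hcs | hcs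
      · exact hcB s hs hcs
      · obtain ⟨r, hr, hcr⟩ := exists_gt_mem_timeInterval hc
        refine le_trans ?_ (hcB r hr hcr)
        have := (strictMonoOn_timeOf_endParam h0).monotoneOn
        rw [h.endParam_eq] at this
        exact this hs hr (hcs.trans hcr.le)
    rw [htop, top_le_iff] at this
    exact EReal.coe_ne_top B this
  · rintro ⟨h1, h2⟩
    have ht := h.tendsto_time_atTop h0 (lt_of_le_of_ne h1 (Ne.symm hl)) h2
    rw [EReal.eq_top_iff_forall_lt]
    intro y
    have hev := ht.eventually (eventually_gt_atTop y)
    rw [← upTo_coe] at hev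
    have := upTo_neBot (etaStar lam u0 : EReal)
    obtain ⟨s, hs, hs'⟩ := (hev.and (eventually_mem_timeInterval hpos)).exists
    exact (EReal.coe_lt_coe_iff.2 hs).trans_le (hle s hs')

end
end ProudmanJohnson

/-! ### Transfer to solutions -/

namespace ProudmanJohnson
noncomputable section

variable {lam : ℝ} {f u0 : ℝ → ℝ} {s t p : ℝ} {T b : EReal} {u : ℝ → ℝ → ℝ}

theorem continuousOn_gradMoment (hf : Continuous f) (hper : Function.Periodic f 1) (hp : 0 ≤ p) :
    ContinuousOn (gradMoment lam f p) (dom lam f) :=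
  continuousOn_parametric_integral (F := fun s a => |grad lam f s a| ^ p * jac lam f s a)
    (((continuousOn_grad hf hper).abs.rpow_const fun _ _ => Or.inr hp).mul
      (continuousOn_jac hf hper)) 0 1

theorem exists_bound_of_tendsto {g : ℝ → ℝ} {L : ℝ} (hb : 0 < b)
    (hg : ContinuousOn g (timeInterval b)) (hL : Tendsto g (upTo b) (𝓝 L)) :
    ∃ C, ∀ s ∈ timeInterval b, |g s| ≤ C := by
  obtain ⟨c, hc, hcb⟩ := (eventually_upTo hb).1
    (hL.abs.eventually (gt_mem_nhds (lt_add_one |L|)))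
  obtain ⟨C, hC⟩ := (isCompact_Icc (a := (0 : ℝ)) (b := c)).exists_bound_of_continuousOn
    (hg.mono fun r hr => mem_timeInterval_of_le hc hr.1 hr.2)
  refine ⟨max C (|L| + 1), fun s hs => ?_⟩
  rcases le_or_gt s c with h | h
  · exact (hC s ⟨hs.1, h⟩).trans (le_max_left _ _)
  · exact (hcb s hs h).le.trans (le_max_right _ _)

theorem energyOf_eq_gradMoment : energyOf lam f s = gradMoment lam f 2 s :=
  intervalIntegral.integral_congr fun a _ => by simp

/-- Reduces boundedness of the derivative of the energy to that of the third absolute moment, whose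
convergence threshold 2/(1 − 2p) at p = 3 is −2/5. -/
theorem abs_cubeOf_le (hf : Continuous f) (hs : s ∈ dom lam f) :
    |cubeOf lam f s| ≤ gradMoment lam f 3 s := by
  refine (intervalIntegral.abs_integral_le_integral_abs zero_le_one).trans_eq
    (intervalIntegral.integral_congr fun a _ => ?_)
  have : |grad lam f s a| ^ (3 : ℝ) = |grad lam f s a| ^ 3 := Real.rpow_ofNat _ 3
  simp only [abs_mul, abs_pow, abs_of_pos (jac_pos hf hs a), this]

theorem paramOf_mem_timeInterval (h0 : IsAdmissible lam u0) (ht : t ∈ timeInterval (tStar lam u0)) :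
    paramOf lam (deriv u0) t ∈ timeInterval (endParam lam u0) := by
  rw [timeInterval_tStar h0] at ht
  obtain ⟨s, hs, rfl⟩ := ht
  rwa [paramOf_timeOf (continuous_deriv_data h0) (periodic_deriv h0.periodic)
    ((mem_timeInterval_endParam h0).1 hs).2]

theorem timeInterval_tStar_subset (h0 : IsAdmissible lam u0) :
    timeInterval (tStar lam u0) ⊆ timeOf lam (deriv u0) '' dom lam (deriv u0) := by
  rw [timeInterval_tStar h0]
  exact image_mono fun s hs => ((mem_timeInterval_endParam h0).1 hs).2

theorem exists_bound_gradMoment (h0 : IsAdmissible lam u0) (hp : 0 ≤ p) {L : ℝ}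
    (hL : Tendsto (gradMoment lam (deriv u0) p) (upTo (endParam lam u0)) (𝓝 L)) :
    ∃ C, ∀ t ∈ timeInterval (tStar lam u0),
      gradMoment lam (deriv u0) p (paramOf lam (deriv u0) t) ≤ C := by
  obtain ⟨C, hC⟩ := exists_bound_of_tendsto (endParam_pos h0)
    ((continuousOn_gradMoment (continuous_deriv_data h0) (periodic_deriv h0.periodic) hp).mono
      fun s hs => ((mem_timeInterval_endParam h0).1 hs).2) hL
  exact ⟨C, fun t ht => (le_abs_self _).trans (hC _ (paramOf_mem_timeInterval h0 ht))⟩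

/-- Finite limits of the moments. -/
theorem exists_tendsto_gradMoment_upTo (h0 : IsAdmissible lam u0) (hp : 1 ≤ p)
    (hl : 2 / (1 - 2 * p) < lam) (hl1 : lam ≤ 1) :
    ∃ L, Tendsto (gradMoment lam (deriv u0) p) (upTo (endParam lam u0)) (𝓝 L) := by
  by_cases h : lam = 0
  · subst h
    refine ⟨0, ?_⟩
    simpa [endParam, upTo] using
      tendsto_gradMoment_zero (continuous_deriv_data h0) (periodic_deriv h0.periodic) hp
  · obtain ⟨M, S, hE⟩ := exists_isExtremum h0 h
    rw [hE.endParam_eq, upTo_coe]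
    exact hE.exists_tendsto_gradMoment hp hl hl1

/-- Infinite limits of the moments. -/
theorem tendsto_gradMoment_upTo (h0 : IsAdmissible lam u0) (hp : 1 < p)
    (hl : 1 < lam ∨ lam < 0 ∧ 1 / 2 ≤ p + 1 / lam) :
    Tendsto (gradMoment lam (deriv u0) p) (upTo (endParam lam u0)) atTop := by
  obtain ⟨M, S, hE⟩ := exists_isExtremum h0 (by rcases hl with h | ⟨h, -⟩ <;> linarith)
  rw [hE.endParam_eq, upTo_coe]
  exact hE.tendsto_gradMoment_atTop hp hl

/-- The divergence condition p + 1/λ ≥ 1/2 for negative λ means λ ≤ −c with c = 1/(p − 1/2). The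
cases c = 2/3 and c = 2/5 are p = 2 and p = 3. -/
theorem lt_zero_and_le {lam c p : ℝ} (hc : 0 < c) (h : lam ≤ -c) (hcp : c * (p - 1 / 2) = 1) :
    lam < 0 ∧ 1 / 2 ≤ p + 1 / lam := by
  have hl : lam < 0 := by linarith
  refine ⟨hl, ?_⟩
  have : -(p - 1 / 2) ≤ 1 / lam := by
    rw [le_div_iff_of_neg hl]
    nlinarith
  linarith

namespace IsSolution

theorem integral_eq (h0 : IsAdmissible lam u0) (hu : IsSolution lam u0 T u)
    (ht : t ∈ timeInterval T) {F : ℝ → ℝ} (hF : Continuous F) :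
    ∫ x in (0 : ℝ)..1, F (ux u t x) = ∫ a in (0 : ℝ)..1,
      F (grad lam (deriv u0) (paramOf lam (deriv u0) t) a) *
        jac lam (deriv u0) (paramOf lam (deriv u0) t) a := by
  obtain ⟨s, hs, -, rfl, hI⟩ := hu.exists_param h0 ht
  rw [paramOf_timeOf (continuous_deriv_data h0) (periodic_deriv h0.periodic) hs]
  exact hI F hF

theorem energy_eq (h0 : IsAdmissible lam u0) (hu : IsSolution lam u0 T u)
    (ht : t ∈ timeInterval T) :
    energy u t = energyOf lam (deriv u0) (paramOf lam (deriv u0) t) :=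
  hu.integral_eq h0 ht (F := fun v => v ^ 2) (by fun_prop)

theorem uxNorm_eq (h0 : IsAdmissible lam u0) (hu : IsSolution lam u0 T u)
    (ht : t ∈ timeInterval T) (hp : 0 < p) :
    uxNorm u (ENNReal.ofReal p) t =
      ENNReal.ofReal (gradMoment lam (deriv u0) p (paramOf lam (deriv u0) t) ^ p⁻¹) := by
  have hc := hu.continuous_ux ht
  have hmem : MemLp (ux u t) (ENNReal.ofReal p) (volume.restrict (Ioo (0 : ℝ) 1)) := by
    obtain ⟨C, hC⟩ := (isCompact_Icc (a := (0 : ℝ)) (b := 1)).exists_bound_of_continuousOn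
      hc.continuousOn
    refine MemLp.of_bound hc.aestronglyMeasurable C ?_
    filter_upwards [ae_restrict_mem measurableSet_Ioo] with x hx
    exact hC x (Ioo_subset_Icc_self hx)
  rw [uxNorm, hmem.eLpNorm_eq_integral_rpow_norm (by simpa using hp) ENNReal.ofReal_ne_top,
    ENNReal.toReal_ofReal hp.le, ← integral_Ioc_eq_integral_Ioo,
    ← intervalIntegral.integral_of_le zero_le_one]
  congr 2
  exact hu.integral_eq h0 ht (F := fun v => |v| ^ p)
    (continuous_abs.rpow_const fun _ => Or.inr hp.le)

theorem uxNorm_eventuallyEq (h0 : IsAdmissible lam u0) (hu : IsSolution lam u0 (tStar lam u0) u)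
    (hp : 0 < p) :
    (fun t => ENNReal.ofReal (gradMoment lam (deriv u0) p (paramOf lam (deriv u0) t) ^ p⁻¹))
      =ᶠ[upTo (tStar lam u0)] uxNorm u (ENNReal.ofReal p) := by
  filter_upwards [eventually_mem_timeInterval (tStar_pos h0)] with t ht
  exact (hu.uxNorm_eq h0 ht hp).symm

theorem exists_tendsto_uxNorm (h0 : IsAdmissible lam u0)
    (hu : IsSolution lam u0 (tStar lam u0) u) (hp : 1 ≤ p)
    (hl : 2 / (1 - 2 * p) < lam) (hl1 : lam ≤ 1) :
    ∃ L : ENNReal, L ≠ ⊤ ∧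
      Tendsto (uxNorm u (ENNReal.ofReal p)) (upTo (tStar lam u0)) (𝓝 L) := by
  have hp0 : 0 < p := by linarith
  obtain ⟨L, hL⟩ := exists_tendsto_gradMoment_upTo h0 hp hl hl1
  refine ⟨_, ENNReal.ofReal_ne_top, Tendsto.congr' (hu.uxNorm_eventuallyEq h0 hp0)
    (ENNReal.tendsto_ofReal (Tendsto.rpow_const (hL.comp (tendsto_paramOf h0)) (Or.inr ?_)))⟩
  positivity

theorem tendsto_uxNorm_top (h0 : IsAdmissible lam u0)
    (hu : IsSolution lam u0 (tStar lam u0) u) (hp : 1 < p)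
    (hl : 1 < lam ∨ lam < 0 ∧ 1 / 2 ≤ p + 1 / lam) :
    Tendsto (uxNorm u (ENNReal.ofReal p)) (upTo (tStar lam u0)) (𝓝 ⊤) := by
  have hp0 : 0 < p := by linarith
  refine Tendsto.congr' (hu.uxNorm_eventuallyEq h0 hp0) (ENNReal.tendsto_ofReal_atTop.comp
    ((tendsto_rpow_atTop (inv_pos.2 hp0)).comp ?_))
  exact (tendsto_gradMoment_upTo h0 hp hl).comp (tendsto_paramOf h0)

/-- On a probability space the uniform norm dominates every L^p norm, and some finite `p` already
gives blow-up. -/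
theorem tendsto_uxNorm_sup (h0 : IsAdmissible lam u0)
    (hu : IsSolution lam u0 (tStar lam u0) u) (hl : lam ∉ Icc (0 : ℝ) 1) :
    Tendsto (uxNorm u ⊤) (upTo (tStar lam u0)) (𝓝 ⊤) := by
  obtain ⟨p, hp, hlp⟩ : ∃ p : ℝ, 1 < p ∧ (1 < lam ∨ lam < 0 ∧ 1 / 2 ≤ p + 1 / lam) := by
    rcases lt_or_ge lam 0 with h | h
    · have := one_div_neg.2 h
      exact ⟨2 - 1 / lam, by linarith, Or.inr ⟨h, by norm_num⟩⟩
    · exact ⟨2, one_lt_two, Or.inl (not_le.1 fun h1 => hl ⟨h, h1⟩)⟩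
  have : IsProbabilityMeasure (volume.restrict (Ioo (0 : ℝ) 1)) := ⟨by simp⟩
  refine tendsto_nhds_top_mono (hu.tendsto_uxNorm_top h0 hp hlp) ?_
  filter_upwards [eventually_mem_timeInterval (tStar_pos h0)] with t ht
  exact eLpNorm_le_eLpNorm_of_exponent_le le_top (hu.continuous_ux ht).aestronglyMeasurable

theorem energy_eventuallyEq (h0 : IsAdmissible lam u0)
    (hu : IsSolution lam u0 (tStar lam u0) u) :
    (fun t => gradMoment lam (deriv u0) 2 (paramOf lam (deriv u0) t))
      =ᶠ[upTo (tStar lam u0)] energy u := by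
  filter_upwards [eventually_mem_timeInterval (tStar_pos h0)] with t ht
  rw [hu.energy_eq h0 ht, energyOf_eq_gradMoment]

theorem tendsto_energy_atTop (h0 : IsAdmissible lam u0)
    (hu : IsSolution lam u0 (tStar lam u0) u) (hl : lam ∉ Ioc (-2 / 3 : ℝ) 1) :
    Tendsto (energy u) (upTo (tStar lam u0)) atTop := by
  refine Tendsto.congr' (hu.energy_eventuallyEq h0)
    ((tendsto_gradMoment_upTo h0 one_lt_two ?_).comp (tendsto_paramOf h0))
  rcases le_or_gt lam (-2 / 3) with h | h
  · exact Or.inr (lt_zero_and_le (c := 2 / 3) (by norm_num) (by linarith) (by norm_num))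
  · exact Or.inl (not_le.1 fun h1 => hl ⟨h, h1⟩)

theorem energy_bounded (h0 : IsAdmissible lam u0)
    (hu : IsSolution lam u0 (tStar lam u0) u) (hl : lam ∈ Ioc (-2 / 3 : ℝ) 1) :
    (∃ C : ℝ, ∀ t ∈ timeInterval (tStar lam u0), energy u t ≤ C) ∧
      ∃ L : ℝ, Tendsto (energy u) (upTo (tStar lam u0)) (𝓝 L) := by
  obtain ⟨L, hL⟩ := exists_tendsto_gradMoment_upTo h0 one_le_two
    (by norm_num; linarith [hl.1]) hl.2
  obtain ⟨C, hC⟩ := exists_bound_gradMoment h0 zero_le_two hL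
  refine ⟨⟨C, fun t ht => ?_⟩, L, Tendsto.congr' (hu.energy_eventuallyEq h0)
    (hL.comp (tendsto_paramOf h0))⟩
  rw [hu.energy_eq h0 ht, energyOf_eq_gradMoment]
  exact hC t ht

theorem hasDerivWithinAt_energy (h0 : IsAdmissible lam u0)
    (hu : IsSolution lam u0 (tStar lam u0) u) (ht : t ∈ timeInterval (tStar lam u0)) :
    HasDerivWithinAt (energy u)
      ((1 + 2 * lam) * cubeOf lam (deriv u0) (paramOf lam (deriv u0) t))
      (timeInterval (tStar lam u0)) t :=
  ((hasDerivAt_energyOf_paramOf (continuous_deriv_data h0) (periodic_deriv h0.periodic)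
    (timeInterval_tStar_subset h0 ht)).hasDerivWithinAt).congr
    (fun _ hr => hu.energy_eq h0 hr) (hu.energy_eq h0 ht)

end IsSolution

theorem tendsto_cubeOf_atTop (h0 : IsAdmissible lam u0) (hl : 1 < lam) :
    Tendsto (fun t => cubeOf lam (deriv u0) (paramOf lam (deriv u0) t))
      (upTo (tStar lam u0)) atTop := by
  obtain ⟨M, S, hE⟩ := exists_isExtremum h0 (by linarith)
  have h1 := hE.tendsto_cubeOf_atTop h0 hl
  rw [← upTo_coe, ← hE.endParam_eq] at h1
  exact h1.comp (tendsto_paramOf h0)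

theorem tendsto_cubeOf_atBot (h0 : IsAdmissible lam u0) (hl : lam ≤ -2 / 5) :
    Tendsto (fun t => cubeOf lam (deriv u0) (paramOf lam (deriv u0) t))
      (upTo (tStar lam u0)) atBot := by
  obtain ⟨M, S, hE⟩ := exists_isExtremum h0 (show lam ≠ 0 by linarith)
  obtain ⟨h1, h2⟩ := lt_zero_and_le (lam := lam) (c := 2 / 5) (p := 3) (by norm_num) (by linarith)
    (by norm_num)
  have h3 := hE.tendsto_cubeOf_atBot h0 h1 (by linarith)
  rw [← upTo_coe, ← hE.endParam_eq] at h3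
  exact h3.comp (tendsto_paramOf h0)

theorem exists_bound_cubeOf (h0 : IsAdmissible lam u0) (hl : lam ∈ Ioc (-2 / 5 : ℝ) 1) :
    ∃ C, ∀ t ∈ timeInterval (tStar lam u0),
      |cubeOf lam (deriv u0) (paramOf lam (deriv u0) t)| ≤ C := by
  obtain ⟨L, hL⟩ := exists_tendsto_gradMoment_upTo (p := 3) h0 (by norm_num)
    (by norm_num; linarith [hl.1]) hl.2
  obtain ⟨C, hC⟩ := exists_bound_gradMoment h0 zero_le_three hL
  exact ⟨C, fun t ht => (abs_cubeOf_le (continuous_deriv_data h0)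
    ((mem_timeInterval_endParam h0).1 (paramOf_mem_timeInterval h0 ht)).2).trans (hC t ht)⟩

end
end ProudmanJohnson

/-! ### Assembly of the theorem -/

theorem mainTheorem5 (lam : ℝ) (u0 : ℝ → ℝ) (h0 : ProudmanJohnson.IsAdmissible lam u0) :
    0 < ProudmanJohnson.tStar lam u0 ∧
    (ProudmanJohnson.tStar lam u0 = ⊤ ↔ lam ∈ Set.Icc (0 : ℝ) 1) ∧
    (∃ u, ProudmanJohnson.IsSolution lam u0 (ProudmanJohnson.tStar lam u0) u) ∧
    ∀ u, ProudmanJohnson.IsSolution lam u0 (ProudmanJohnson.tStar lam u0) u →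
      -- `t_*` is the blow-up time in the uniform norm
      (lam ∉ Set.Icc (0 : ℝ) 1 →
        Filter.Tendsto (ProudmanJohnson.uxNorm u ⊤)
          (ProudmanJohnson.upTo (ProudmanJohnson.tStar lam u0)) (nhds ⊤)) ∧
      -- finite limits of the `L^p` norms
      (∀ p : ℝ, 1 ≤ p → 2 / (1 - 2 * p) < lam → lam ≤ 1 →
        ∃ L : ENNReal, L ≠ ⊤ ∧
          Filter.Tendsto (ProudmanJohnson.uxNorm u (ENNReal.ofReal p))
            (ProudmanJohnson.upTo (ProudmanJohnson.tStar lam u0)) (nhds L)) ∧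
      -- blow-up of the `L^p` norms
      (∀ p : ℝ, 1 < p →
        (lam ∉ Set.Ioc (-2 : ℝ) 1 ∨ lam ∈ Set.Ioc (-2 : ℝ) (-2 / p)) →
          Filter.Tendsto (ProudmanJohnson.uxNorm u (ENNReal.ofReal p))
            (ProudmanJohnson.upTo (ProudmanJohnson.tStar lam u0)) (nhds ⊤)) ∧
      -- the energy
      (lam ∉ Set.Ioc (-2 / 3 : ℝ) 1 →
        Filter.Tendsto (ProudmanJohnson.energy u)
          (ProudmanJohnson.upTo (ProudmanJohnson.tStar lam u0)) Filter.atTop) ∧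
      (lam ∈ Set.Ioc (-2 / 3 : ℝ) 1 →
        (∃ C : ℝ, ∀ t ∈ ProudmanJohnson.timeInterval (ProudmanJohnson.tStar lam u0),
          ProudmanJohnson.energy u t ≤ C) ∧
        ∃ L : ℝ, Filter.Tendsto (ProudmanJohnson.energy u)
          (ProudmanJohnson.upTo (ProudmanJohnson.tStar lam u0)) (nhds L)) ∧
      -- the derivative `E'` of the energy (one-sided at `t = 0`)
      ∃ E' : ℝ → ℝ,
        (∀ t ∈ ProudmanJohnson.timeInterval (ProudmanJohnson.tStar lam u0),
          HasDerivWithinAt (ProudmanJohnson.energy u) (E' t)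
            (ProudmanJohnson.timeInterval (ProudmanJohnson.tStar lam u0)) t) ∧
        (lam ∉ Set.Icc (-1 / 2 : ℝ) 1 →
          Filter.Tendsto E' (ProudmanJohnson.upTo (ProudmanJohnson.tStar lam u0))
            Filter.atTop) ∧
        (lam = -1 / 2 →
          ∀ t ∈ ProudmanJohnson.timeInterval (ProudmanJohnson.tStar lam u0), E' t = 0) ∧
        (lam ∈ Set.Ioc (-1 / 2 : ℝ) (-2 / 5) →
          Filter.Tendsto E' (ProudmanJohnson.upTo (ProudmanJohnson.tStar lam u0))
            Filter.atBot) ∧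
        (lam ∈ Set.Ioc (-2 / 5 : ℝ) 1 →
          ∃ C : ℝ, ∀ t ∈ ProudmanJohnson.timeInterval (ProudmanJohnson.tStar lam u0),
            |E' t| ≤ C) := by
  open ProudmanJohnson in
  refine ⟨tStar_pos h0, tStar_eq_top_iff h0, exists_isSolution h0 (timeInterval_tStar_subset h0),
    fun u hu => ⟨hu.tendsto_uxNorm_sup h0, fun p hp => hu.exists_tendsto_uxNorm h0 hp,
      fun p hp hl => hu.tendsto_uxNorm_top h0 hp ?_, hu.tendsto_energy_atTop h0,
      hu.energy_bounded h0, _, fun t ht => hu.hasDerivWithinAt_energy h0 ht,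
      fun hl => ?_, fun hl t ht => ?_, fun hl => ?_, fun hl => ?_⟩⟩
  · rcases hl with hl | hl
    · rcases le_or_gt lam (-2) with h | h
      -- For λ ≤ −2 the divergence condition holds already at p = 1, hence for every larger p.
      · obtain ⟨h1, h2⟩ := lt_zero_and_le (p := 1) two_pos h (by norm_num)
        exact Or.inr ⟨h1, by linarith⟩
      · exact Or.inl (not_le.1 fun h1 => hl ⟨h, h1⟩)
    · have hp0 : 0 < p := by linarith
      -- The bound λ ≤ −2/p is the exact threshold for the smaller exponent p/2 + 1/2, so it
      -- suffices for p.
      obtain ⟨h1, h2⟩ := lt_zero_and_le (lam := lam) (c := 2 / p) (p := p / 2 + 1 / 2)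
        (by positivity) (by rw [← neg_div]; exact hl.2) (by field_simp; ring)
      exact Or.inr ⟨h1, by linarith⟩
  -- Below −1/2 the factor 1 + 2λ is negative and the third moment tends to −∞; above 1 both are
  -- positive.
  · rcases lt_or_ge lam (-1 / 2) with h | h
    · exact (tendsto_cubeOf_atBot h0 (by linarith)).const_mul_atBot_of_neg (by linarith)
    · have hl1 : 1 < lam := not_le.1 fun h1 => hl ⟨h, h1⟩
      exact (tendsto_cubeOf_atTop h0 hl1).const_mul_atTop (by linarith)
  · rw [hl]; norm_num
  · exact (tendsto_cubeOf_atBot h0 hl.2).const_mul_atBot (by linarith [hl.1])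
  · obtain ⟨C, hC⟩ := exists_bound_cubeOf h0 hl
    refine ⟨|1 + 2 * lam| * C, fun t ht => ?_⟩
    rw [abs_mul]
    exact mul_le_mul_of_nonneg_left (hC t ht) (abs_nonneg _)
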